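/- Let $d\ge 2$, $T\in(0,\infty]$ and $p>2$, let $\mathbb T^d=\mathbb R^d/\mathbb Z^d$, and let $[0,T]$ mean $[0,\infty)$ if $T=\infty$. Let $b\in L^\infty([0,T],W^{1,p}(\mathbb T^d,\mathbb R^d))$ be a divergence free (time dependent) vector field and let $u_0\in W^{1,2}(\mathbb T^d)\cap L^\infty(\mathbb T^d)$. For $\nu>0$ let $u^\nu$ be a solution of $$\partial_t u^\nu+b\cdot\nabla u^\nu-\nu\Delta u^\nu=0\ \text{ on }\mathbb T^d\times(0,T],\qquad u^\nu(0,\cdot)=u_0,$$ and let $u^0$ be a solution of $$\partial_t u^0+b\cdot\nabla u^0=0\ \text{ on }\mathbb T^d\times(0,T],\qquad u^0(0,\cdot)=u_0.$$ Solutions are understood in the sense of distributions, are mean free in $x$, and belong to the classes $$u^\nu\in L^\infty([0,T]\times\mathbb T^d)\cap C([0,T],L^2(\mathbb T^d))\cap L^1([0,T],W^{1,2}(\mathbb T^d)),\qquad u^0\in C([0,T],(L^\infty(\mathbb T^d),w^*)).$$ For $\alpha>0$ let $H^{\log,\alpha}$ be the space of all $u\in L^2(\mathbb T^d)$ with $$[u]_{H^{\log,\alpha}}^2:=\int_{B_{1/3}}\int_{\mathbb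 T^d}\frac{|u(x+h)-u(x)|^2}{|h|^d}\,\frac{1}{\log(1/|h|)^{1-\alpha}}\,dx\,dh<\infty ,$$ where $B_{1/3}\subset\mathbb R^d$ is the Euclidean ball of radius $1/3$ centred at $0$. If there exist $t\in(0,T)$, $\nu_0\in(0,1)$, $C>0$ and $r>0$ such that $$\|u^\nu_t-u^0_t\|_{L^2}^2\le C\,\log(1/\nu)^{-r}\qquad\text{for every }0<\nu<\nu_0,$$ then $u^0_t\in H^{\log,r_1}$ for every $0<r_1<r$. -/

import Mathlib

open MeasureTheory Filter Topology
open scoped ENNReal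

noncomputable section

/-- The projection `ℝ^d → 𝕋^d = (ℝ/ℤ)^d`. -/
def toTorus {d : ℕ} (y : EuclideanSpace ℝ (Fin d)) : UnitAddTorus (Fin d) :=
  fun i => ((y i : ℝ) : UnitAddCircle)

/-- The classical partial derivative `∂_i f (x)` of a function on the torus: the derivative at
`s = 0` of `s ↦ f (x + s e_i)`. -/
def torusPartial {d : ℕ} (i : Fin d) (f : UnitAddTorus (Fin d) → ℝ) (x : UnitAddTorus (Fin d)) :
    ℝ :=
  deriv (fun s : ℝ => f (x + toTorus (EuclideanSpace.single i s))) 0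

/-- The classical Laplacian on the torus. -/
def torusLaplacian {d : ℕ} (f : UnitAddTorus (Fin d) → ℝ) (x : UnitAddTorus (Fin d)) : ℝ :=
  ∑ i, torusPartial i (torusPartial i f) x

/-- `f ∈ C^∞(𝕋^d)`: the periodic lift of `f` to `ℝ^d` is smooth. -/
def TorusSmooth {d : ℕ} (f : UnitAddTorus (Fin d) → ℝ) : Prop :=
  ContDiff ℝ ((⊤ : ℕ∞) : WithTop ℕ∞) (fun y : EuclideanSpace ℝ (Fin d) => f (toTorus y))

/-- `g` is the weak `i`-th partial derivative of `f` on the torus (for integrable `f`, `g`). -/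
def IsWeakPartial {d : ℕ} (i : Fin d) (f g : UnitAddTorus (Fin d) → ℝ) : Prop :=
  ∀ φ : UnitAddTorus (Fin d) → ℝ, TorusSmooth φ →
    ∫ x, f x * torusPartial i φ x = - ∫ x, g x * φ x

/-- The Sobolev space `W^{1,p}(𝕋^d)`. -/
def MemSobolevOne {d : ℕ} (p : ℝ≥0∞) (f : UnitAddTorus (Fin d) → ℝ) : Prop :=
  MemLp f p volume ∧
    ∀ i, ∃ g : UnitAddTorus (Fin d) → ℝ, MemLp g p volume ∧ IsWeakPartial i f g

/-- The time interval `[0,T]` for `T ∈ (0,∞]`, read as `[0,∞)` when `T = ∞`. -/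
def timeInterval (T : EReal) : Set ℝ := {s : ℝ | 0 ≤ s ∧ (s : EReal) ≤ T}

/-- The Bochner space `L^q(I, W^{1,p}(𝕋^d))`, for a set of times `I`: `f` and its weak spatial
derivatives `G i` are measurable in `(s,x)`, and the function
`s ↦ ‖f_s‖_{L^p} + ∑_i ‖∂_i f_s‖_{L^p}` lies in `L^q(I)`. -/
def MemBochnerSobolev {d : ℕ} (q p : ℝ≥0∞) (I : Set ℝ) (f : ℝ → UnitAddTorus (Fin d) → ℝ) :
    Prop :=
  ∃ G : Fin d → ℝ → UnitAddTorus (Fin d) → ℝ,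
    AEStronglyMeasurable (Function.uncurry f) ((volume.restrict I).prod volume) ∧
    (∀ i, AEStronglyMeasurable (Function.uncurry (G i)) ((volume.restrict I).prod volume)) ∧
    (∀ᵐ s ∂(volume.restrict I), ∀ i, IsWeakPartial i (f s) (G i s)) ∧
    eLpNorm (fun s : ℝ => eLpNorm (f s) p volume + ∑ i, eLpNorm (G i s) p volume) q
      (volume.restrict I) < ∞

/-- `b ∈ L^q(I, W^{1,p}(𝕋^d, ℝ^d))`, componentwise. -/
def MemBochnerSobolevVec {d : ℕ} (q p : ℝ≥0∞) (I : Set ℝ)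
    (b : ℝ → UnitAddTorus (Fin d) → EuclideanSpace ℝ (Fin d)) : Prop :=
  ∀ i, MemBochnerSobolev q p I (fun s x => b s x i)

/-- `div b_s = 0` in the sense of distributions on `𝕋^d`, for a.e. `s ∈ I`. -/
def IsDivFree {d : ℕ} (I : Set ℝ)
    (b : ℝ → UnitAddTorus (Fin d) → EuclideanSpace ℝ (Fin d)) : Prop :=
  ∀ᵐ s ∂(volume.restrict I), ∀ φ : UnitAddTorus (Fin d) → ℝ, TorusSmooth φ →
    ∫ x, ∑ i, b s x i * torusPartial i φ x = 0

/-- Test functions `φ ∈ C_c^∞((0,T) × 𝕋^d)` (extended by zero to all times). -/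
def IsSpaceTimeTest {d : ℕ} (T : EReal) (φ : ℝ → UnitAddTorus (Fin d) → ℝ) : Prop :=
  ContDiff ℝ ((⊤ : ℕ∞) : WithTop ℕ∞) (fun z : ℝ × EuclideanSpace ℝ (Fin d) => φ z.1 (toTorus z.2)) ∧
    ∃ a c : ℝ, 0 < a ∧ (c : EReal) < T ∧ ∀ s x, s < a ∨ c < s → φ s x = 0

/-- `∂_t u + b · ∇u - ν Δu = 0` in the sense of distributions on `(0,T) × 𝕋^d`, for a
divergence free field `b` (so that `b · ∇u = div (b u)`), and `u(0,·) = u₀`. -/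
def SolvesAdvectionDiffusion {d : ℕ} (T : EReal) (ν : ℝ)
    (b : ℝ → UnitAddTorus (Fin d) → EuclideanSpace ℝ (Fin d))
    (u₀ : UnitAddTorus (Fin d) → ℝ) (u : ℝ → UnitAddTorus (Fin d) → ℝ) : Prop :=
  u 0 =ᵐ[volume] u₀ ∧
  ∀ φ : ℝ → UnitAddTorus (Fin d) → ℝ, IsSpaceTimeTest T φ →
    ∫ s in timeInterval T, ∫ x,
      u s x * (deriv (fun τ : ℝ => φ τ x) s + ∑ i, b s x i * torusPartial i (φ s) x
        + ν * torusLaplacian (φ s) x) = 0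

/-- `u` is a solution `u^ν` of the advection-diffusion equation with viscosity `ν`: it solves it in
the sense of distributions, is mean free, and belongs to
`L^∞([0,T] × 𝕋^d) ∩ C([0,T], L²(𝕋^d)) ∩ L¹([0,T], W^{1,2}(𝕋^d))`. -/
structure IsViscousSolution {d : ℕ} (T : EReal) (ν : ℝ)
    (b : ℝ → UnitAddTorus (Fin d) → EuclideanSpace ℝ (Fin d))
    (u₀ : UnitAddTorus (Fin d) → ℝ) (u : ℝ → UnitAddTorus (Fin d) → ℝ) : Prop where
  solves : SolvesAdvectionDiffusion T ν b u₀ u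
  mean_free : ∀ s ∈ timeInterval T, ∫ x, u s x = 0
  bounded : MemLp (Function.uncurry u) ∞ ((volume.restrict (timeInterval T)).prod volume)
  memLp_two : ∀ s ∈ timeInterval T, MemLp (u s) 2 volume
  continuous_L2 : ∀ s₀ ∈ timeInterval T,
    Tendsto (fun s => eLpNorm (u s - u s₀) 2 volume) (𝓝[timeInterval T] s₀) (𝓝 0)
  sobolev : MemBochnerSobolev 1 2 (timeInterval T) u

/-- `u` is a solution `u^0` of the transport equation: it solves it in the sense of
distributions, is mean free, and belongs to `C([0,T], (L^∞(𝕋^d), w*))`; `u` is understood as a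
measurable function of `(s,x)`. -/
structure IsTransportSolution {d : ℕ} (T : EReal)
    (b : ℝ → UnitAddTorus (Fin d) → EuclideanSpace ℝ (Fin d))
    (u₀ : UnitAddTorus (Fin d) → ℝ) (u : ℝ → UnitAddTorus (Fin d) → ℝ) : Prop where
  solves : SolvesAdvectionDiffusion T 0 b u₀ u
  mean_free : ∀ s ∈ timeInterval T, ∫ x, u s x = 0
  measurable : AEStronglyMeasurable (Function.uncurry u)
    ((volume.restrict (timeInterval T)).prod volume)
  memLp_top : ∀ s ∈ timeInterval T, MemLp (u s) ∞ volume
  continuous_weakStar : ∀ g : UnitAddTorus (Fin d) → ℝ, Integrable g volume →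
    ContinuousOn (fun s => ∫ x, u s x * g x) (timeInterval T)

/-- The square of the seminorm `[u]_{H^{log,α}}`:
`∫_{B_{1/3}} ∫_{𝕋^d} |u(x+h)-u(x)|² / |h|^d · 1 / log(1/|h|)^{1-α} dx dh`. -/
def logSobolevSeminormSq {d : ℕ} (α : ℝ) (u : UnitAddTorus (Fin d) → ℝ) : ℝ≥0∞ :=
  ∫⁻ h in Metric.ball (0 : EuclideanSpace ℝ (Fin d)) (1 / 3), ∫⁻ x,
    ENNReal.ofReal (|u (x + toTorus h) - u x| ^ 2 / ‖h‖ ^ d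
      * (1 / Real.log (1 / ‖h‖) ^ (1 - α)))

/-- The log-Sobolev class `H^{log,α}(𝕋^d)`. -/
def MemLogSobolev {d : ℕ} (α : ℝ) (u : UnitAddTorus (Fin d) → ℝ) : Prop :=
  MemLp u 2 volume ∧ logSobolevSeminormSq α u < ∞

end

noncomputable section

/-! ### Smooth functions on the torus -/

/-! The function `u0 t` is approximated by `uν ν t`, with a logarithmic error in `ν`, and each
approximant is regular at a cost that is only polynomial in `1/ν`. Since a power of `|h|` beats
every power of `log (1/|h|)`, balancing the two errors gives the logarithmic modulus of continuity
`‖u0 t (· + h) - u0 t‖² ≲ log(1/|h|)^(-r)` in `L²`. Integrated in polar coordinates against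
`|h|^(-d) log(1/|h|)^(r₁ - 1)`, this leaves `ρ⁻¹ log(1/ρ)^(-1-(r-r₁))`, which is integrable at `0`
exactly because `r₁ < r`.

The regularity bound is `‖uν ν t (· + h) - uν ν t‖² ≤ K |h| ν^(-3/2)`
(`IsViscousSolution.integral_sq_increment_le`). The equation is solved mode by mode with Duhamel's
formula, treating `div (b u)` as a source. The heat factor absorbs the derivative of the source, and
half a derivative more at the price of an integrable singularity `(t - s)^(-1/2)`. Parseval's
identity for `u b_i` sums the modes. The choice `ν = |h|^(1/3)` turns the bound into `K |h|^(1/2)`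
and changes `log(1/ν)` only by a factor `3` (`exists_log_modulus`).

For this `K` must not depend on `ν`, so the sup bound on `uν ν` has to be uniform in `ν`. That is
the maximum principle `IsViscousSolution.ae_abs_le`, and it needs a proof because the solutions are
merely distributional. The solution is mollified in space, and the `L^(2m+2)` norm of the mollified
function `v` is followed in time. Diffusion decreases it, transport by a divergence free field
preserves it, and what remains is the commutator `b · (K * ∇u) - K * (b · ∇u)`. This tends to `0` in
`L¹` of space and time because translations are continuous in `L²` and `u` lies in `L¹ W^{1,2}`.
Letting `m → ∞` gives `|uν ν s| ≤ ‖u₀‖_∞` for almost every `s`.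

The mollifiers are trigonometric polynomials. A mollified solution is then a finite sum of products
of a function of `s` and a function of `x`, so the energy identity reduces to scalar differential
equations and Fubini's theorem. -/

lemma volume_unitAddCircle_eq_haar :
    (volume : Measure UnitAddCircle) = AddCircle.haarAddCircle := by
  rw [AddCircle.volume_eq_smul_haarAddCircle]; simp

instance isProbabilityMeasure_volume_unitAddCircle :
    IsProbabilityMeasure (volume : Measure UnitAddCircle) := by
  rw [volume_unitAddCircle_eq_haar]; infer_instance

lemma toTorus_add {d : ℕ} (y z : EuclideanSpace ℝ (Fin d)) :
    toTorus (y + z) = toTorus y + toTorus z := by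
  ext i; simp [toTorus]

@[simp] lemma toTorus_zero {d : ℕ} : toTorus (0 : EuclideanSpace ℝ (Fin d)) = 0 := by
  ext i; simp [toTorus]

lemma toTorus_neg {d : ℕ} (y : EuclideanSpace ℝ (Fin d)) : toTorus (-y) = -toTorus y := by
  ext i; simp [toTorus]

/-- This lets continuity be checked on the periodic lift and lets every point of the torus be
represented by a vector, which is how statements about smooth functions are transferred from
Euclidean space. -/
lemma isOpenQuotientMap_toTorus (d : ℕ) :
    IsOpenQuotientMap (toTorus : EuclideanSpace ℝ (Fin d) → UnitAddTorus (Fin d)) := by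
  have h1 : IsOpenQuotientMap (Pi.map fun (_ : Fin d) (x : ℝ) => (x : UnitAddCircle)) :=
    IsOpenQuotientMap.piMap fun _ => QuotientAddGroup.isOpenQuotientMap_mk
  exact h1.comp (EuclideanSpace.equiv (Fin d) ℝ).toHomeomorph.isOpenQuotientMap

lemma toTorus_surjective {d : ℕ} :
    Function.Surjective (toTorus : EuclideanSpace ℝ (Fin d) → UnitAddTorus (Fin d)) :=
  (isOpenQuotientMap_toTorus d).surjective

namespace TorusSmooth

variable {d : ℕ} {f g : UnitAddTorus (Fin d) → ℝ}

lemma continuous (hf : TorusSmooth f) : Continuous f :=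
  (isOpenQuotientMap_toTorus d).isQuotientMap.continuous_iff.2 (ContDiff.continuous hf)

lemma const (c : ℝ) : TorusSmooth fun _ : UnitAddTorus (Fin d) => c := contDiff_const

lemma add (hf : TorusSmooth f) (hg : TorusSmooth g) : TorusSmooth fun x => f x + g x :=
  ContDiff.add hf hg

lemma mul (hf : TorusSmooth f) (hg : TorusSmooth g) : TorusSmooth fun x => f x * g x :=
  ContDiff.mul hf hg

lemma const_mul (hf : TorusSmooth f) (c : ℝ) : TorusSmooth fun x => c * f x :=
  (const c).mul hf

lemma pow (hf : TorusSmooth f) (n : ℕ) : TorusSmooth fun x => f x ^ n :=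
  ContDiff.pow hf n

lemma sum {ι : Type*} {s : Finset ι} {F : ι → UnitAddTorus (Fin d) → ℝ}
    (hF : ∀ j ∈ s, TorusSmooth (F j)) : TorusSmooth fun x => ∑ j ∈ s, F j x :=
  ContDiff.sum hF

lemma comp_add_right (hf : TorusSmooth f) (a : UnitAddTorus (Fin d)) :
    TorusSmooth fun x => f (x + a) := by
  obtain ⟨z, rfl⟩ := toTorus_surjective a
  have : ContDiff ℝ ((⊤ : ℕ∞) : WithTop ℕ∞) fun y : EuclideanSpace ℝ (Fin d) => y + z := by
    fun_prop
  simpa [TorusSmooth, Function.comp_def, toTorus_add] using ContDiff.comp hf this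

lemma comp_neg (hf : TorusSmooth f) : TorusSmooth fun x => f (-x) := by
  have : ContDiff ℝ ((⊤ : ℕ∞) : WithTop ℕ∞) fun y : EuclideanSpace ℝ (Fin d) => -y := by
    fun_prop
  simpa [TorusSmooth, Function.comp_def, toTorus_neg] using ContDiff.comp hf this

lemma hasDerivAt_lift (hf : TorusSmooth f) (i : Fin d) (y : EuclideanSpace ℝ (Fin d)) :
    HasDerivAt (fun s : ℝ => f (toTorus y + toTorus (EuclideanSpace.single i s)))
      (fderiv ℝ (fun y => f (toTorus y)) y (EuclideanSpace.single i 1)) 0 := by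
  have h1 : HasFDerivAt (fun y => f (toTorus y)) (fderiv ℝ (fun y => f (toTorus y)) y)
      (y + (0 : ℝ) • EuclideanSpace.single i (1 : ℝ)) := by
    simpa using (ContDiff.differentiable hf (by simp) y).hasFDerivAt
  have h2 : HasDerivAt (fun s : ℝ => y + s • EuclideanSpace.single i (1 : ℝ))
      (EuclideanSpace.single i 1) 0 := by
    simpa using ((hasDerivAt_id (0 : ℝ)).smul_const (EuclideanSpace.single i (1 : ℝ))).const_add y
  have e : (fun s : ℝ => f (toTorus y + toTorus (EuclideanSpace.single i s))) =
      fun s : ℝ => f (toTorus (y + s • EuclideanSpace.single i (1 : ℝ))) := by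
    ext s
    rw [← toTorus_add]
    congr 3
    ext j
    by_cases hj : j = i <;> simp [hj]
  rw [e]
  exact h1.comp_hasDerivAt (0 : ℝ) h2

lemma torusPartial_lift (hf : TorusSmooth f) (i : Fin d) (y : EuclideanSpace ℝ (Fin d)) :
    torusPartial i f (toTorus y) =
      fderiv ℝ (fun y => f (toTorus y)) y (EuclideanSpace.single i 1) :=
  (hf.hasDerivAt_lift i y).deriv

lemma hasDerivAt (hf : TorusSmooth f) (i : Fin d) (x : UnitAddTorus (Fin d)) :
    HasDerivAt (fun s : ℝ => f (x + toTorus (EuclideanSpace.single i s))) (torusPartial i f x)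
      0 := by
  obtain ⟨y, rfl⟩ := toTorus_surjective x
  rw [hf.torusPartial_lift]
  exact hf.hasDerivAt_lift i y

lemma hasDerivAt_of (hf : TorusSmooth f) (i : Fin d) (x : UnitAddTorus (Fin d)) (s : ℝ) :
    HasDerivAt (fun s : ℝ => f (x + toTorus (EuclideanSpace.single i s)))
      (torusPartial i f (x + toTorus (EuclideanSpace.single i s))) s := by
  have h := hf.hasDerivAt i (x + toTorus (EuclideanSpace.single i s))
  have h2 : HasDerivAt (fun τ : ℝ => τ - s) 1 s := (hasDerivAt_id s).sub_const s
  have h3 := HasDerivAt.comp s (h := fun τ : ℝ => τ - s) (by simpa using h) h2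
  simp only [mul_one] at h3
  have e : (fun s : ℝ => f (x + toTorus (EuclideanSpace.single i s))) =
      (fun τ : ℝ => f (x + toTorus (EuclideanSpace.single i s) +
        toTorus (EuclideanSpace.single i τ))) ∘ fun τ => τ - s := by
    ext τ
    simp only [Function.comp]
    rw [add_assoc, ← toTorus_add]
    congr 3
    ext j
    by_cases hj : j = i <;> simp [hj]
  rw [e]
  exact h3

lemma torusPartial (hf : TorusSmooth f) (i : Fin d) : TorusSmooth (torusPartial i f) := by
  unfold TorusSmooth
  simp_rw [hf.torusPartial_lift i]
  exact (ContDiff.fderiv_right hf (m := ((⊤ : ℕ∞) : WithTop ℕ∞)) (by simp)).clm_apply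
    contDiff_const

lemma torusLaplacian (hf : TorusSmooth f) : TorusSmooth (torusLaplacian f) :=
  sum fun i _ => (hf.torusPartial i).torusPartial i

lemma exists_bound (hf : TorusSmooth f) : ∃ C, 0 ≤ C ∧ ∀ x, |f x| ≤ C := by
  obtain ⟨C, hC⟩ := isCompact_univ.exists_bound_of_continuousOn hf.continuous.continuousOn
  exact ⟨C, (norm_nonneg _).trans (hC 0 trivial), fun x => hC x trivial⟩

lemma aestronglyMeasurable (hf : TorusSmooth f) : AEStronglyMeasurable f volume :=
  hf.continuous.aestronglyMeasurable

lemma memLp (hf : TorusSmooth f) (p : ℝ≥0∞) : MemLp f p volume := by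
  obtain ⟨C, -, hC⟩ := hf.exists_bound
  exact MemLp.of_bound hf.aestronglyMeasurable C (ae_of_all _ hC)

lemma integrable (hf : TorusSmooth f) : Integrable f volume :=
  memLp_one_iff_integrable.1 (hf.memLp 1)

end TorusSmooth

/-! ### Calculus rules and integration by parts on the torus -/

section torusPartial

variable {d : ℕ} {f g : UnitAddTorus (Fin d) → ℝ}

lemma torusPartial_eq_of_hasDerivAt {i : Fin d} {x : UnitAddTorus (Fin d)} {c : ℝ}
    (h : HasDerivAt (fun s : ℝ => f (x + toTorus (EuclideanSpace.single i s))) c 0) :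
    torusPartial i f x = c := h.deriv

lemma single_zero_right (i : Fin d) : EuclideanSpace.single i (0 : ℝ) = 0 := by
  ext j; simp

lemma torusPartial_mul (hf : TorusSmooth f) (hg : TorusSmooth g) (i : Fin d)
    (x : UnitAddTorus (Fin d)) :
    torusPartial i (fun x => f x * g x) x = torusPartial i f x * g x + f x * torusPartial i g x := by
  have := (hf.hasDerivAt i x).mul (hg.hasDerivAt i x)
  simp only [single_zero_right, toTorus_zero, add_zero] at this
  exact torusPartial_eq_of_hasDerivAt this

lemma torusPartial_const_mul (hf : TorusSmooth f) (c : ℝ) (i : Fin d) (x : UnitAddTorus (Fin d)) :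
    torusPartial i (fun x => c * f x) x = c * torusPartial i f x :=
  torusPartial_eq_of_hasDerivAt ((hf.hasDerivAt i x).const_mul c)

lemma torusPartial_sum {ι : Type*} {s : Finset ι} {F : ι → UnitAddTorus (Fin d) → ℝ}
    (hF : ∀ j ∈ s, TorusSmooth (F j)) (i : Fin d) (x : UnitAddTorus (Fin d)) :
    torusPartial i (fun x => ∑ j ∈ s, F j x) x = ∑ j ∈ s, torusPartial i (F j) x :=
  torusPartial_eq_of_hasDerivAt (HasDerivAt.fun_sum fun j hj => (hF j hj).hasDerivAt i x)

lemma torusPartial_pow (hf : TorusSmooth f) (n : ℕ) (i : Fin d) (x : UnitAddTorus (Fin d)) :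
    torusPartial i (fun x => f x ^ n) x = n * f x ^ (n - 1) * torusPartial i f x := by
  have := (hf.hasDerivAt i x).pow n
  simp only [single_zero_right, toTorus_zero, add_zero] at this
  exact torusPartial_eq_of_hasDerivAt this

lemma torusPartial_comp_add_right (a : UnitAddTorus (Fin d)) (i : Fin d)
    (x : UnitAddTorus (Fin d)) :
    torusPartial i (fun x => f (x + a)) x = torusPartial i f (x + a) := by
  simp only [torusPartial, add_right_comm]

lemma torusPartial_comp_sub_left (a : UnitAddTorus (Fin d)) (hf : TorusSmooth f) (i : Fin d)
    (x : UnitAddTorus (Fin d)) :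
    torusPartial i (fun x => f (a - x)) x = - torusPartial i f (a - x) := by
  apply torusPartial_eq_of_hasDerivAt
  have h := hf.hasDerivAt i (a - x)
  have h2 : HasDerivAt (fun τ : ℝ => -τ) (-1) 0 := (hasDerivAt_id (0 : ℝ)).neg
  have h3 := HasDerivAt.comp (0 : ℝ) (h := fun τ : ℝ => -τ) (by simpa using h) h2
  simp only [mul_neg, mul_one] at h3
  have e : (fun s : ℝ => f (a - (x + toTorus (EuclideanSpace.single i s)))) =
      (fun τ : ℝ => f (a - x + toTorus (EuclideanSpace.single i τ))) ∘ fun τ => -τ := by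
    ext τ
    simp only [Function.comp]
    rw [show EuclideanSpace.single i (-τ) = - EuclideanSpace.single i τ by
      ext j; by_cases hj : j = i <;> simp [hj], toTorus_neg]
    congr 1; abel
  rw [e]
  exact h3

/-- By translation invariance `∫ f (x + s e_i) dx` is constant in `s`; differentiating under the
integral at `s = 0` gives the claim. -/
lemma integral_torusPartial (hf : TorusSmooth f) (i : Fin d) :
    ∫ x, torusPartial i f x = 0 := by
  obtain ⟨C, -, hC⟩ := (hf.torusPartial i).exists_bound
  have key := hasDerivAt_integral_of_dominated_loc_of_deriv_le (μ := volume) (𝕜 := ℝ)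
    (F := fun s x => f (x + toTorus (EuclideanSpace.single i s)))
    (F' := fun s x => torusPartial i f (x + toTorus (EuclideanSpace.single i s)))
    (x₀ := 0) (bound := fun _ => C) (s := Set.univ) univ_mem
    (Eventually.of_forall fun s => (hf.comp_add_right _).aestronglyMeasurable)
    (hf.comp_add_right _).integrable ((hf.torusPartial i).comp_add_right _).aestronglyMeasurable
    (ae_of_all _ fun x s _ => hC _) (integrable_const C)
    (ae_of_all _ fun x s _ => hf.hasDerivAt_of i x s)
  have h2 := key.2
  simp only [single_zero_right, toTorus_zero, add_zero] at h2
  simp_rw [integral_add_right_eq_self (μ := (volume : Measure (UnitAddTorus (Fin d)))) f] at h2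
  exact h2.unique (hasDerivAt_const _ _)

lemma integral_mul_torusPartial (hf : TorusSmooth f) (hg : TorusSmooth g) (i : Fin d) :
    ∫ x, f x * torusPartial i g x = - ∫ x, torusPartial i f x * g x := by
  have h := integral_torusPartial (hf.mul hg) i
  simp_rw [torusPartial_mul hf hg i] at h
  rw [integral_add ((hf.torusPartial i).mul hg).integrable (hf.mul (hg.torusPartial i)).integrable]
    at h
  linarith

/-- Integration by parts turns the integral into `-(2m+1) ∫ f^(2m) |∇f|²`. This is the dissipation
of the `L^(2m+2)` norm under diffusion. -/
lemma integral_pow_mul_torusLaplacian_nonpos (hf : TorusSmooth f) (m : ℕ) :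
    ∫ x, f x ^ (2 * m + 1) * torusLaplacian f x ≤ 0 := by
  unfold torusLaplacian
  simp_rw [Finset.mul_sum]
  rw [integral_finsetSum _ fun i _ =>
    ((hf.pow _).mul ((hf.torusPartial i).torusPartial i)).integrable]
  refine Finset.sum_nonpos fun i _ => ?_
  rw [integral_mul_torusPartial (hf.pow _) (hf.torusPartial i), neg_nonpos]
  refine integral_nonneg fun x => ?_
  simp only [Pi.zero_apply]
  rw [torusPartial_pow hf]
  have : (((2 * m + 1 : ℕ) : ℝ) * f x ^ (2 * m + 1 - 1) * torusPartial i f x) * torusPartial i f x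
      = ((2 * m + 1 : ℕ) : ℝ) * (f x ^ m) ^ 2 * torusPartial i f x ^ 2 := by
    rw [Nat.add_sub_cancel]; ring
  rw [this]; positivity

end torusPartial
end

noncomputable section

/-! ### Distributional ordinary differential equations -/

lemma deriv_smoothTransition_of_neg {x : ℝ} (hx : x < 0) : deriv Real.smoothTransition x = 0 := by
  have : Real.smoothTransition =ᶠ[𝓝 x] fun _ => (0 : ℝ) := by
    filter_upwards [Iio_mem_nhds hx] with y hy
    exact Real.smoothTransition.zero_of_nonpos (le_of_lt hy)
  rw [this.deriv_eq]; simp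

lemma deriv_smoothTransition_of_one_lt {x : ℝ} (hx : 1 < x) :
    deriv Real.smoothTransition x = 0 := by
  have : Real.smoothTransition =ᶠ[𝓝 x] fun _ => (1 : ℝ) := by
    filter_upwards [Ioi_mem_nhds hx] with y hy
    exact Real.smoothTransition.one_of_one_le (le_of_lt hy)
  rw [this.deriv_eq]; simp

lemma contDiff_smoothTransition : ContDiff ℝ ((⊤ : ℕ∞) : WithTop ℕ∞) Real.smoothTransition :=
  Real.smoothTransition.contDiff

/-- A smooth approximation of the indicator function of `[a, ∞)`. -/
def smoothStep (a : ℝ) (n : ℕ) (s : ℝ) : ℝ := Real.smoothTransition (n * (s - a))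

lemma contDiff_smoothStep (a : ℝ) (n : ℕ) :
    ContDiff ℝ ((⊤ : ℕ∞) : WithTop ℕ∞) (smoothStep a n) := by
  have : ContDiff ℝ ((⊤ : ℕ∞) : WithTop ℕ∞) fun s : ℝ => n * (s - a) := by fun_prop
  exact contDiff_smoothTransition.comp this

lemma deriv_smoothStep (a : ℝ) (n : ℕ) (s : ℝ) :
    deriv (smoothStep a n) s = n * deriv Real.smoothTransition (n * (s - a)) := by
  have h1 : HasDerivAt (fun s : ℝ => n * (s - a)) (n * 1) s :=
    ((hasDerivAt_id s).sub_const a).const_mul _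
  have h2 := (contDiff_smoothTransition.differentiable (by simp) (n * (s - a))).hasDerivAt
  have h3 : HasDerivAt (smoothStep a n) _ s := h2.comp s h1
  rw [h3.deriv]; ring

lemma monotone_smoothStep (a : ℝ) (n : ℕ) : Monotone (smoothStep a n) := fun x y h =>
  Real.smoothTransition.monotone (by gcongr)

lemma continuous_deriv_smoothStep (a : ℝ) (n : ℕ) : Continuous (deriv (smoothStep a n)) :=
  (contDiff_smoothStep a n).continuous_deriv (by simp)

lemma smoothStep_of_le {a s : ℝ} (n : ℕ) (h : s ≤ a) : smoothStep a n s = 0 :=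
  Real.smoothTransition.zero_of_nonpos
    (mul_nonpos_of_nonneg_of_nonpos (Nat.cast_nonneg n) (sub_nonpos.2 h))

lemma smoothStep_of_ge {a s : ℝ} {n : ℕ} (h : 1 ≤ n * (s - a)) : smoothStep a n s = 1 :=
  Real.smoothTransition.one_of_one_le h

lemma tendsto_natCast_mul_atTop {δ : ℝ} (hδ : 0 < δ) :
    Tendsto (fun n : ℕ => (n : ℝ) * δ) atTop atTop :=
  tendsto_natCast_atTop_atTop.atTop_mul_const hδ

/-- The derivatives of the smoothed steps are nonnegative, vanish outside `[a, a + 1/n]` and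
eventually have mass one on `[0, t]`, so they are an approximate identity at `a`. -/
lemma tendsto_integral_deriv_smoothStep_mul {a t : ℝ} (ha : 0 < a) (hat : a < t) {c : ℝ → ℝ}
    (hc : ContinuousOn c (Set.Icc 0 t)) :
    Tendsto (fun n : ℕ => ∫ s in Set.Icc 0 t, deriv (smoothStep a n) s * c s) atTop
      (𝓝 (c a)) := by
  have hmem : Set.Icc 0 t ∈ 𝓝 a := Icc_mem_nhds ha hat
  refine tendsto_setIntegral_peak_smul_of_integrableOn_of_tendsto (x₀ := a)
    (φ := fun (n : ℕ) s => deriv (smoothStep a n) s)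
    measurableSet_Icc measurableSet_Icc le_rfl (mem_nhdsWithin_of_mem_nhds hmem) (by simp)
    (Eventually.of_forall fun n _ _ => (monotone_smoothStep a n).deriv_nonneg) ?_ ?_
    (Eventually.of_forall fun n => (continuous_deriv_smoothStep a n).aestronglyMeasurable)
    (hc.integrableOn_Icc) (hc a (mem_of_mem_nhds hmem))
  · intro u hu hau
    obtain ⟨δ, hδ, hball⟩ := Metric.isOpen_iff.1 hu a hau
    rw [Metric.tendstoUniformlyOn_iff]
    intro ε hε
    filter_upwards [(tendsto_natCast_mul_atTop hδ).eventually_gt_atTop 1] with n hn s hs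
    have hs' : δ ≤ |s - a| := by
      by_contra h
      exact hs.2 (hball (by rw [Metric.mem_ball, Real.dist_eq]; linarith))
    have hn0 : (0 : ℝ) < n := by
      by_contra h
      have : (n : ℝ) * δ ≤ 0 := mul_nonpos_of_nonpos_of_nonneg (not_lt.1 h) hδ.le
      linarith
    have : deriv (smoothStep a n) s = 0 := by
      rw [deriv_smoothStep]
      rcases le_abs'.1 hs' with h | h
      · rw [deriv_smoothTransition_of_neg (mul_neg_of_pos_of_neg hn0 (by linarith)), mul_zero]
      · rw [deriv_smoothTransition_of_one_lt (by nlinarith), mul_zero]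
    simpa [this] using hε
  · refine tendsto_const_nhds.congr' ?_
    filter_upwards [(tendsto_natCast_mul_atTop (sub_pos.2 hat)).eventually_gt_atTop 1] with n hn
    rw [integral_Icc_eq_integral_Ioc, ← intervalIntegral.integral_of_le (ha.trans hat).le,
      intervalIntegral.integral_deriv_eq_sub
        (fun s _ => (contDiff_smoothStep a n).differentiable (by simp) s)
        ((continuous_deriv_smoothStep a n).intervalIntegrable _ _),
      smoothStep_of_ge hn.le, smoothStep_of_le n ha.le, sub_zero]

lemma timeInterval_eq_Icc_subset {T : EReal} {t : ℝ} (ht : (t : EReal) < T) :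
    Set.Icc 0 t ⊆ timeInterval T := fun _ hs =>
  ⟨hs.1, (EReal.coe_le_coe_iff.2 hs.2).trans ht.le⟩

lemma measurableSet_timeInterval (T : EReal) : MeasurableSet (timeInterval T) :=
  measurableSet_Ici.inter (measurable_coe_real_ereal measurableSet_Iic)

/-- Time test functions: smooth functions with compact support in `(0,T)`. -/
def IsTimeTest (T : EReal) (θ : ℝ → ℝ) : Prop :=
  ContDiff ℝ ((⊤ : ℕ∞) : WithTop ℕ∞) θ ∧
    ∃ a c : ℝ, 0 < a ∧ (c : EReal) < T ∧ ∀ s, s < a ∨ c < s → θ s = 0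

/-- If `c' = g` in the sense of distributions on `(0,T)` and `c` is continuous on `[0,T]`, then
`c` is an antiderivative of `g`. -/
lemma sub_eq_integral_of_distributional_deriv {T : EReal} {c g : ℝ → ℝ}
    (hc : ContinuousOn c (timeInterval T))
    (hg : ∀ t : ℝ, (t : EReal) < T → IntegrableOn g (Set.Icc 0 t))
    (h : ∀ θ, IsTimeTest T θ → ∫ s in timeInterval T, (deriv θ s * c s + θ s * g s) = 0)
    {t : ℝ} (ht : 0 ≤ t) (htT : (t : EReal) < T) :
    c t - c 0 = ∫ s in 0..t, g s := by
  -- Away from the endpoints, the difference of two smooth steps is an admissible approximation of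
  -- the indicator of `(a, b]`; its derivative picks out `c a - c b` in the limit.
  have interior : ∀ a b : ℝ, 0 < a → a < b → (b : EReal) < T →
      c b - c a = ∫ s in a..b, g s := by
    intro a b ha hab hbT
    -- The step at `b` is completed only to the right of `b`, so room is needed between `b` and `T`
    -- for the support of the test function.
    obtain ⟨t', hbt', ht'T⟩ := EReal.lt_iff_exists_real_btwn.1 hbT
    rw [EReal.coe_lt_coe_iff] at hbt'
    have hcc : ContinuousOn c (Set.Icc 0 t') := hc.mono (timeInterval_eq_Icc_subset ht'T)
    have lim1 := tendsto_integral_deriv_smoothStep_mul ha (hab.trans hbt') hcc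
    have lim2 := tendsto_integral_deriv_smoothStep_mul (ha.trans hab) hbt' hcc
    have hab0 : ∀ x : ℝ, ∀ n s, |smoothStep x n s| ≤ 1 := fun x n s => by
      rw [abs_le]
      exact ⟨(by norm_num : (-1 : ℝ) ≤ 0).trans (Real.smoothTransition.nonneg _),
        Real.smoothTransition.le_one _⟩
    have lim3 : Tendsto (fun n : ℕ => ∫ s in Set.Icc 0 t',
        (smoothStep a n s - smoothStep b n s) * g s) atTop
        (𝓝 (∫ s in Set.Icc 0 t', (Set.Ioc a b).indicator g s)) := by
      refine tendsto_integral_of_dominated_convergence (fun s => 2 * ‖g s‖) (fun n => ?_)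
        ((hg t' ht'T).norm.const_mul 2) (fun n => ae_of_all _ fun s => ?_)
        (ae_of_all _ fun s => ?_)
      · exact (((contDiff_smoothStep a n).continuous.sub
          (contDiff_smoothStep b n).continuous).aestronglyMeasurable).mul
          (hg t' ht'T).aestronglyMeasurable
      · rw [norm_mul]
        gcongr
        refine (norm_sub_le _ _).trans ?_
        have h1 := hab0 a n s
        have h2 := hab0 b n s
        rw [← Real.norm_eq_abs] at h1 h2
        linarith
      · have step : ∀ x : ℝ, x < s → ∀ᶠ n : ℕ in atTop, smoothStep x n s = 1 := fun x hx => by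
          filter_upwards [(tendsto_natCast_mul_atTop (sub_pos.2 hx)).eventually_ge_atTop 1]
            with n hn using smoothStep_of_ge hn
        refine tendsto_const_nhds.congr' ?_
        rcases le_or_gt s a with hs | hs
        · refine Eventually.of_forall fun n => ?_
          beta_reduce
          rw [smoothStep_of_le n hs, smoothStep_of_le n (hs.trans hab.le),
            Set.indicator_of_notMem (fun h => absurd h.1 (not_lt.2 hs))]
          simp
        rcases le_or_gt s b with hs' | hs'
        · filter_upwards [step a hs] with n hn
          rw [hn, smoothStep_of_le n hs', Set.indicator_of_mem (show s ∈ Set.Ioc a b from ⟨hs, hs'⟩)]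
          simp
        · filter_upwards [step a hs, step b hs'] with n hn hn'
          rw [hn, hn', Set.indicator_of_notMem (fun h => absurd h.2 (not_le.2 hs'))]
          simp
    have hev : ∀ᶠ n : ℕ in atTop, (∫ s in Set.Icc 0 t', deriv (smoothStep a n) s * c s)
        - (∫ s in Set.Icc 0 t', deriv (smoothStep b n) s * c s)
        + ∫ s in Set.Icc 0 t', (smoothStep a n s - smoothStep b n s) * g s = 0 := by
      filter_upwards [(tendsto_natCast_mul_atTop (sub_pos.2 hbt')).eventually_gt_atTop 1]
        with n hn
      have hn0 : (0 : ℝ) < n := by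
        by_contra h
        nlinarith [not_lt.1 h]
      set θ : ℝ → ℝ := fun s => smoothStep a n s - smoothStep b n s with hθ
      have hθd : ∀ s, deriv θ s = deriv (smoothStep a n) s - deriv (smoothStep b n) s := fun s =>
        deriv_sub ((contDiff_smoothStep a n).differentiable (by simp) s)
          ((contDiff_smoothStep b n).differentiable (by simp) s)
      have hzero : ∀ s, s < a ∨ t' < s → θ s = 0 := by
        rintro s (hs | hs)
        · simp [hθ, smoothStep_of_le n hs.le, smoothStep_of_le n (hs.le.trans hab.le)]
        · have h1 : 1 ≤ (n : ℝ) * (s - b) := by nlinarith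
          have h2 : 1 ≤ (n : ℝ) * (s - a) := by nlinarith
          simp [hθ, smoothStep_of_ge h1, smoothStep_of_ge h2]
      have hθ' := h θ ⟨(contDiff_smoothStep a n).sub (contDiff_smoothStep b n),
        a, t', ha, ht'T, hzero⟩
      rw [setIntegral_eq_of_subset_of_forall_sdiff_eq_zero (measurableSet_timeInterval T)
        (timeInterval_eq_Icc_subset ht'T)] at hθ'
      · have i1 : ∀ x : ℝ, IntegrableOn (fun s => deriv (smoothStep x n) s * c s)
            (Set.Icc 0 t') := fun x =>
          ((continuous_deriv_smoothStep x n).continuousOn.mul hcc).integrableOn_Icc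
        have i2 : IntegrableOn (fun s => θ s * g s) (Set.Icc 0 t') :=
          (hg t' ht'T).continuousOn_mul ((contDiff_smoothStep a n).continuous.sub
          (contDiff_smoothStep b n).continuous).continuousOn isCompact_Icc
        have i3 : IntegrableOn (fun s => deriv (smoothStep a n) s * c s
            - deriv (smoothStep b n) s * c s) (Set.Icc 0 t') := (i1 a).sub (i1 b)
        rw [← integral_sub (i1 a) (i1 b)]
        refine (integral_add i3 i2).symm.trans (Eq.trans ?_ hθ')
        refine integral_congr_ae (ae_of_all _ fun s => ?_)
        simp only [hθd]; ring
      · intro s hs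
        have hs' : t' < s := by
          by_contra hlt
          exact hs.2 ⟨hs.1.1, not_lt.1 hlt⟩
        have : θ =ᶠ[𝓝 s] fun _ => 0 := by
          filter_upwards [Ioi_mem_nhds hs'] with y hy using hzero y (Or.inr hy)
        rw [this.deriv_eq, hzero s (Or.inr hs')]
        simp
    have hfin := tendsto_nhds_unique ((lim1.sub lim2).add lim3)
      (tendsto_const_nhds.congr' (hev.mono fun n hn => hn.symm))
    rw [setIntegral_indicator measurableSet_Ioc, Set.inter_eq_self_of_subset_right
      (show Set.Ioc a b ⊆ Set.Icc 0 t' from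
        fun s hs => ⟨ha.le.trans hs.1.le, hs.2.trans hbt'.le⟩),
      ← intervalIntegral.integral_of_le hab.le] at hfin
    linarith
  rcases ht.eq_or_lt with rfl | ht0
  · simp
  have hcc : ContinuousOn c (Set.Icc 0 t) := hc.mono (timeInterval_eq_Icc_subset htT)
  -- Test functions do not see time `0`. The initial value enters through continuity of `c` and of
  -- the primitive, letting `a` decrease to `0`.
  have lim1 : Tendsto c (𝓝[>] 0) (𝓝 (c 0)) := by
    have := (hcc 0 ⟨le_rfl, ht⟩).mono_left
      (nhdsWithin_mono _ (Set.Ioo_subset_Icc_self (a := (0 : ℝ)) (b := t)))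
    rwa [nhdsWithin_Ioo_eq_nhdsGT ht0] at this
  have hint : IntervalIntegrable g volume 0 t :=
    (intervalIntegrable_iff_integrableOn_Icc_of_le ht).2 (hg t htT)
  have lim2 : Tendsto (fun a => ∫ s in a..t, g s) (𝓝[>] 0) (𝓝 (∫ s in 0..t, g s)) := by
    have h1 : ContinuousOn (fun a => ∫ s in a..t, g s) (Set.uIcc 0 t) :=
      intervalIntegral.continuousOn_primitive_interval_left
        (by rw [Set.uIcc_of_le ht]; exact hg t htT)
    rw [Set.uIcc_of_le ht] at h1
    have := (h1 0 ⟨le_rfl, ht⟩).mono_left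
      (nhdsWithin_mono _ (Set.Ioo_subset_Icc_self (a := (0 : ℝ)) (b := t)))
    rwa [nhdsWithin_Ioo_eq_nhdsGT ht0] at this
  refine tendsto_nhds_unique (tendsto_const_nhds.sub lim1) (lim2.congr' ?_)
  filter_upwards [Ioo_mem_nhdsGT ht0] with a ha
  exact (interior a t ha.1 ha.2 htT).symm

/-- The chain rule for powers of absolutely continuous functions. -/
lemma pow_sub_pow_eq_integral {g r : ℝ → ℝ} {t : ℝ} (ht : 0 ≤ t)
    (hr : IntegrableOn r (Set.Icc 0 t))
    (hg : ∀ s ∈ Set.Icc 0 t, g s - g 0 = ∫ τ in 0..s, r τ) (n : ℕ) :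
    g t ^ n - g 0 ^ n = ∫ s in 0..t, n * g s ^ (n - 1) * r s := by
  -- The primitive is absolutely continuous and agrees with `g` on `[0, t]`; products preserve
  -- absolute continuity, so the fundamental theorem of calculus applies to its powers.
  set G : ℝ → ℝ := fun s => (∫ τ in 0..s, r τ) + g 0 with hG
  have hGg : ∀ s ∈ Set.Icc 0 t, G s = g s := fun s hs => by simp [hG, ← hg s hs]
  have hint : IntervalIntegrable r volume 0 t :=
    (intervalIntegrable_iff_integrableOn_Icc_of_le ht).2 hr
  have hac : AbsolutelyContinuousOnInterval G 0 t :=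
    (hint.absolutelyContinuousOnInterval_intervalIntegral (by simp)).fun_add
      (contDiffOn_const.absolutelyContinuousOnInterval)
  have hpow : ∀ n : ℕ, AbsolutelyContinuousOnInterval (fun s => G s ^ n) 0 t := by
    intro n
    induction n with
    | zero => simpa using (contDiffOn_const (c := (1 : ℝ))).absolutelyContinuousOnInterval
    | succ k ih => simpa [pow_succ] using ih.fun_mul hac
  have h0 : (0 : ℝ) ∈ Set.Icc 0 t := ⟨le_rfl, ht⟩
  have h1 : t ∈ Set.Icc 0 t := ⟨ht, le_rfl⟩
  rw [← hGg t h1, ← hGg 0 h0, ← (hpow n).integral_deriv_eq_sub]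
  refine intervalIntegral.integral_congr_ae ?_
  filter_upwards [hint.ae_hasDerivAt_integral] with s hs hs'
  have hs2 : s ∈ Set.uIcc 0 t := Set.uIoc_subset_uIcc hs'
  have hd : HasDerivAt G (r s) s := (hs hs2 0 (by simp)).add_const _
  rw [(hd.fun_pow n).deriv, hGg s (by rwa [Set.uIcc_of_le ht] at hs2)]

end

noncomputable section

/-! ### The equation tested against a fixed function -/

lemma integral_abs_le_of_eLpNorm_two_le {α : Type*} [MeasurableSpace α] {μ : Measure α}
    [IsProbabilityMeasure μ] {f : α → ℝ} {B : ℝ} (hB : 0 ≤ B) (hf : MemLp f 2 μ)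
    (h : eLpNorm f 2 μ ≤ ENNReal.ofReal B) : ∫ x, |f x| ∂μ ≤ B := by
  have h1 : eLpNorm f 1 μ ≤ ENNReal.ofReal B :=
    (eLpNorm_le_eLpNorm_of_exponent_le (by norm_num) hf.1).trans h
  have h2 : ∫ x, |f x| ∂μ = (eLpNorm f 1 μ).toReal := by
    rw [eLpNorm_one_eq_lintegral_enorm, ← integral_norm_eq_lintegral_enorm hf.1]
    rfl
  rw [h2]
  exact ENNReal.toReal_le_of_le_ofReal hB h1

/-- Bounds and measurability of a drift `b` and a transported function `u`. -/
structure IsBoundedPair {d : ℕ} (I : Set ℝ) (b : ℝ → UnitAddTorus (Fin d) → EuclideanSpace ℝ (Fin d))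
    (u : ℝ → UnitAddTorus (Fin d) → ℝ) (M B : ℝ) : Prop where
  nonneg_left : 0 ≤ M
  nonneg_right : 0 ≤ B
  meas_left : AEStronglyMeasurable (Function.uncurry u) ((volume.restrict I).prod volume)
  meas_right : ∀ i, AEStronglyMeasurable (Function.uncurry fun s x => b s x i)
    ((volume.restrict I).prod volume)
  bdd_left : ∀ᵐ s ∂(volume.restrict I), ∀ᵐ x, |u s x| ≤ M
  bdd_right : ∀ᵐ s ∂(volume.restrict I), ∀ i, MemLp (fun x => b s x i) 2 volume ∧
    eLpNorm (fun x => b s x i) 2 volume ≤ ENNReal.ofReal B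

/-- The spatial part `∫ u (b · ∇ψ + ν Δψ)` of the weak formulation. -/
def weakFlux {d : ℕ} (ν : ℝ) (b : ℝ → UnitAddTorus (Fin d) → EuclideanSpace ℝ (Fin d))
    (u : ℝ → UnitAddTorus (Fin d) → ℝ) (ψ : UnitAddTorus (Fin d) → ℝ) (s : ℝ) : ℝ :=
  ∫ x, u s x * (∑ i, b s x i * torusPartial i ψ x + ν * torusLaplacian ψ x)

section

variable {d : ℕ} {T : EReal} {ν p : ℝ} {b : ℝ → UnitAddTorus (Fin d) → EuclideanSpace ℝ (Fin d)}
  {u : ℝ → UnitAddTorus (Fin d) → ℝ} {u₀ : UnitAddTorus (Fin d) → ℝ} {M B : ℝ} {I : Set ℝ}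

/-- The torus has measure one, so the `L²` norm is dominated by the `L^p` norm, and the essential
supremum in time supplies a single constant. It depends on `b` alone, hence not on `ν`. -/
lemma MemBochnerSobolevVec.exists_bound (hp : 2 ≤ p)
    (hb : MemBochnerSobolevVec ∞ (ENNReal.ofReal p) I b) :
    ∃ B, 0 ≤ B ∧ ∀ᵐ s ∂(volume.restrict I), ∀ i, MemLp (fun x => b s x i) 2 volume ∧
      eLpNorm (fun x => b s x i) 2 volume ≤ ENNReal.ofReal B := by
  have hp' : (2 : ℝ≥0∞) ≤ ENNReal.ofReal p := by
    rw [show (2 : ℝ≥0∞) = ENNReal.ofReal 2 by simp]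
    exact ENNReal.ofReal_le_ofReal hp
  have h : ∀ i, ∃ B : ℝ, 0 ≤ B ∧ ∀ᵐ s ∂(volume.restrict I), MemLp (fun x => b s x i) 2 volume ∧
      eLpNorm (fun x => b s x i) 2 volume ≤ ENNReal.ofReal B := by
    intro i
    obtain ⟨G, hm, -, -, hfin⟩ := hb i
    rw [eLpNorm_exponent_top] at hfin
    set K := eLpNormEssSup (fun s : ℝ => eLpNorm (fun x => b s x i) (ENNReal.ofReal p) volume +
      ∑ j, eLpNorm (G j s) (ENNReal.ofReal p) volume) (volume.restrict I)
    refine ⟨K.toReal, ENNReal.toReal_nonneg, ?_⟩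
    filter_upwards [enorm_ae_le_eLpNormEssSup (fun s : ℝ => eLpNorm (fun x => b s x i)
      (ENNReal.ofReal p) volume + ∑ j, eLpNorm (G j s) (ENNReal.ofReal p) volume)
      (volume.restrict I), hm.prodMk_left] with s hs hsm
    have h1 : eLpNorm (fun x => b s x i) 2 volume ≤ K :=
      (eLpNorm_le_eLpNorm_of_exponent_le hp' hsm).trans (le_self_add.trans hs)
    exact ⟨⟨hsm, h1.trans_lt hfin⟩, h1.trans (ENNReal.ofReal_toReal hfin.ne).ge⟩
  choose C hC0 hC using h
  refine ⟨∑ i, C i, Finset.sum_nonneg fun i _ => hC0 i, ?_⟩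
  rw [ae_all_iff]
  intro i
  filter_upwards [hC i] with s hs
  exact ⟨hs.1, hs.2.trans (ENNReal.ofReal_le_ofReal
    (Finset.single_le_sum (fun i _ => hC0 i) (Finset.mem_univ i)))⟩

/-- This bound may depend on `ν`. It serves to justify the manipulations leading to the maximum
principle, which then replaces it by a uniform one. -/
lemma IsViscousSolution.exists_bound (h : IsViscousSolution T ν b u₀ u) :
    ∃ M, 0 ≤ M ∧ ∀ᵐ s ∂(volume.restrict (timeInterval T)), ∀ᵐ x, |u s x| ≤ M := by
  have hfin := h.bounded.2
  rw [eLpNorm_exponent_top] at hfin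
  refine ⟨(eLpNormEssSup (Function.uncurry u)
    ((volume.restrict (timeInterval T)).prod volume)).toReal, ENNReal.toReal_nonneg, ?_⟩
  have h1 := enorm_ae_le_eLpNormEssSup (Function.uncurry u)
    ((volume.restrict (timeInterval T)).prod volume)
  filter_upwards [Measure.ae_ae_of_ae_prod h1] with s hs
  filter_upwards [hs] with x hx
  have := ENNReal.toReal_mono hfin.ne hx
  simpa using this

lemma IsViscousSolution.isBoundedPair (h : IsViscousSolution T ν b u₀ u) (hp : 2 ≤ p)
    (hb : MemBochnerSobolevVec ∞ (ENNReal.ofReal p) (timeInterval T) b) :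
    ∃ M B, IsBoundedPair (timeInterval T) b u M B := by
  obtain ⟨M, hM, hM'⟩ := h.exists_bound
  obtain ⟨B, hB, hB'⟩ := hb.exists_bound hp
  refine ⟨M, B, hM, hB, h.bounded.1, fun i => ?_, hM', hB'⟩
  obtain ⟨G, hm, -⟩ := hb i
  exact hm

namespace IsBoundedPair

lemma ae_memLp (h : IsBoundedPair I b u M B) :
    ∀ᵐ s ∂(volume.restrict I), MemLp (u s) ∞ volume := by
  filter_upwards [h.bdd_left, h.meas_left.prodMk_left] with s hs hm
  exact memLp_top_of_bound hm M hs

lemma ae_memLp_mul (h : IsBoundedPair I b u M B) :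
    ∀ᵐ s ∂(volume.restrict I), ∀ i, MemLp (fun x => u s x * b s x i) 2 volume := by
  filter_upwards [h.ae_memLp, h.bdd_right] with s hs hb i
  exact (hb i).1.mul hs

lemma ae_integrable_flux (h : IsBoundedPair I b u M B) {ψ : UnitAddTorus (Fin d) → ℝ}
    (hψ : TorusSmooth ψ) : ∀ᵐ s ∂(volume.restrict I),
      Integrable (fun x => u s x * (∑ i, b s x i * torusPartial i ψ x + ν * torusLaplacian ψ x)) := by
  filter_upwards [h.ae_memLp, h.bdd_right] with s hs hb
  refine memLp_one_iff_integrable.1 (MemLp.mul (p := ∞) (q := 1) (r := 1) ?_ hs)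
  refine MemLp.add (memLp_finsetSum _ fun i _ => ?_) ((hψ.torusLaplacian.const_mul ν).memLp 1)
  exact MemLp.mul (p := 2) (q := 2) (r := 1) ((hψ.torusPartial i).memLp 2) (hb i).1

lemma aestronglyMeasurable_flux [SFinite (volume.restrict I)] (h : IsBoundedPair I b u M B)
    {ψ : UnitAddTorus (Fin d) → ℝ} (hψ : TorusSmooth ψ) :
    AEStronglyMeasurable (weakFlux ν b u ψ) (volume.restrict I) := by
  have hsm : ∀ f : UnitAddTorus (Fin d) → ℝ, TorusSmooth f →
      AEStronglyMeasurable (fun z : ℝ × UnitAddTorus (Fin d) => f z.2)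
        ((volume.restrict I).prod volume) := fun f hf =>
    (hf.continuous.comp continuous_snd).aestronglyMeasurable
  have : AEStronglyMeasurable (fun z : ℝ × UnitAddTorus (Fin d) => u z.1 z.2 *
      (∑ i, b z.1 z.2 i * torusPartial i ψ z.2 + ν * torusLaplacian ψ z.2))
      ((volume.restrict I).prod volume) := by
    refine h.meas_left.mul (AEStronglyMeasurable.add ?_ (hsm _ (hψ.torusLaplacian.const_mul ν)))
    exact Finset.aestronglyMeasurable_fun_sum _ fun i _ =>
      (h.meas_right i).mul (hsm _ (hψ.torusPartial i))
  exact this.integral_prod_right'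

lemma exists_flux_bound (h : IsBoundedPair I b u M B) {ψ : UnitAddTorus (Fin d) → ℝ}
    (hψ : TorusSmooth ψ) : ∃ C, ∀ᵐ s ∂(volume.restrict I), ‖weakFlux ν b u ψ s‖ ≤ C := by
  choose K hK0 hK using fun i => (hψ.torusPartial i).exists_bound
  obtain ⟨L, hL0, hL⟩ := (hψ.torusLaplacian.const_mul ν).exists_bound
  refine ⟨M * (∑ i, B * K i + L), ?_⟩
  filter_upwards [h.bdd_left, h.bdd_right] with s hs hb
  have hint : Integrable (fun x => M * (∑ i, |b s x i| * K i + L)) :=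
    ((integrable_finsetSum _ fun i _ =>
      ((hb i).1.integrable (by norm_num)).abs.mul_const _).add (integrable_const _)).const_mul _
  have h1 : ‖weakFlux ν b u ψ s‖ ≤ ∫ x, M * (∑ i, |b s x i| * K i + L) := by
    refine norm_integral_le_of_norm_le hint ?_
    filter_upwards [hs] with x hx
    rw [norm_mul]
    refine mul_le_mul hx ?_ (norm_nonneg _) h.nonneg_left
    refine (norm_add_le _ _).trans (add_le_add ((norm_sum_le _ _).trans ?_) (hL x))
    refine Finset.sum_le_sum fun i _ => ?_
    rw [norm_mul]
    exact mul_le_mul_of_nonneg_left (hK i x) (norm_nonneg _)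
  refine h1.trans ?_
  rw [integral_const_mul, integral_add (integrable_finsetSum _ fun i _ =>
    ((hb i).1.integrable (by norm_num)).abs.mul_const _) (integrable_const _),
    integral_finsetSum _ fun i _ => ((hb i).1.integrable (by norm_num)).abs.mul_const _]
  simp_rw [integral_mul_const]
  simp only [integral_const, probReal_univ, smul_eq_mul, one_mul]
  have hM := h.nonneg_left
  gcongr with i
  · exact hK0 i
  · exact integral_abs_le_of_eLpNorm_two_le h.nonneg_right (hb i).1 (hb i).2

lemma integrableOn_flux (h : IsBoundedPair (timeInterval T) b u M B)
    {ψ : UnitAddTorus (Fin d) → ℝ} (hψ : TorusSmooth ψ) {t : ℝ} (ht : (t : EReal) < T) :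
    IntegrableOn (weakFlux ν b u ψ) (Set.Icc 0 t) := by
  obtain ⟨C, hC⟩ := h.exists_flux_bound (ν := ν) hψ
  have hle : (volume.restrict (Set.Icc 0 t) : Measure ℝ) ≤ volume.restrict (timeInterval T) :=
    Measure.restrict_mono (timeInterval_eq_Icc_subset ht) le_rfl
  exact Integrable.of_bound
    ((h.aestronglyMeasurable_flux hψ).mono_measure hle) C (ae_mono hle hC)

end IsBoundedPair

lemma IsViscousSolution.continuousOn_integral_mul (h : IsViscousSolution T ν b u₀ u)
    {ψ : UnitAddTorus (Fin d) → ℝ} (hψ : TorusSmooth ψ) :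
    ContinuousOn (fun s => ∫ x, u s x * ψ x) (timeInterval T) := by
  intro s₀ hs₀
  obtain ⟨K, hK0, hK⟩ := hψ.exists_bound
  rw [ContinuousWithinAt, tendsto_iff_norm_sub_tendsto_zero]
  have hlim : Tendsto (fun s => (eLpNorm (u s - u s₀) 2 volume).toReal * K)
      (𝓝[timeInterval T] s₀) (𝓝 0) := by
    have := (ENNReal.tendsto_toReal ENNReal.zero_ne_top).comp (h.continuous_L2 s₀ hs₀)
    simpa using this.mul_const K
  refine squeeze_zero' (Eventually.of_forall fun s => norm_nonneg _) ?_ hlim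
  filter_upwards [self_mem_nhdsWithin] with s hs
  have hd : MemLp (u s - u s₀) 2 volume := (h.memLp_two s hs).sub (h.memLp_two s₀ hs₀)
  have i1 : ∀ r ∈ timeInterval T, Integrable (fun x => u r x * ψ x) := fun r hr =>
    memLp_one_iff_integrable.1 ((hψ.memLp 2).mul (h.memLp_two r hr))
  rw [← integral_sub (i1 s hs) (i1 s₀ hs₀)]
  calc ‖∫ x, (u s x * ψ x - u s₀ x * ψ x)‖ ≤ ∫ x, |(u s - u s₀) x| * K := by
        refine norm_integral_le_of_norm_le ((hd.integrable (by norm_num)).abs.mul_const _)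
          (ae_of_all _ fun x => ?_)
        rw [← sub_mul, norm_mul]
        exact mul_le_mul_of_nonneg_left (hK x) (norm_nonneg _)
    _ = (∫ x, |(u s - u s₀) x|) * K := integral_mul_const _ _
    _ ≤ _ := by
        refine mul_le_mul_of_nonneg_right ?_ hK0
        exact integral_abs_le_of_eLpNorm_two_le ENNReal.toReal_nonneg hd
          (ENNReal.ofReal_toReal hd.2.ne).ge

lemma isSpaceTimeTest_mul {θ E : ℝ → ℝ} (hθ : IsTimeTest T θ)
    (hE : ContDiff ℝ ((⊤ : ℕ∞) : WithTop ℕ∞) E) {ψ : UnitAddTorus (Fin d) → ℝ}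
    (hψ : TorusSmooth ψ) : IsSpaceTimeTest T (fun s x => (θ s * E s) * ψ x) := by
  obtain ⟨h1, a, c, ha, hc, hz⟩ := hθ
  refine ⟨?_, a, c, ha, hc, fun s x hs => by simp [hz s hs]⟩
  exact ((h1.mul hE).comp contDiff_fst).mul (ContDiff.comp
    (g := fun y : EuclideanSpace ℝ (Fin d) => ψ (toTorus y)) hψ contDiff_snd)

/-- The weak formulation integrated in time against `E(s) ψ(x)`. -/
lemma IsViscousSolution.weighted_identity (h : IsViscousSolution T ν b u₀ u)
    (hbu : IsBoundedPair (timeInterval T) b u M B) {E : ℝ → ℝ}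
    (hE : ContDiff ℝ ((⊤ : ℕ∞) : WithTop ℕ∞) E) {ψ : UnitAddTorus (Fin d) → ℝ}
    (hψ : TorusSmooth ψ) {t : ℝ} (ht : 0 ≤ t) (htT : (t : EReal) < T) :
    E t * (∫ x, u t x * ψ x) - E 0 * (∫ x, u 0 x * ψ x) =
      ∫ s in 0..t, (deriv E s * (∫ x, u s x * ψ x) + E s * weakFlux ν b u ψ s) := by
  have hc := h.continuousOn_integral_mul hψ
  have hE' : Continuous (deriv E) := hE.continuous_deriv (by simp)
  refine sub_eq_integral_of_distributional_deriv
    (c := fun s => E s * (∫ x, u s x * ψ x)) (hE.continuous.continuousOn.mul hc) ?_ ?_ ht htT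
  · intro r hr
    refine IntegrableOn.add ?_ ?_
    · exact (hE'.continuousOn.mul (hc.mono (timeInterval_eq_Icc_subset hr))).integrableOn_Icc
    · exact (hbu.integrableOn_flux hψ hr).continuousOn_mul hE.continuous.continuousOn isCompact_Icc
  · intro θ hθ
    rw [← h.solves.2 _ (isSpaceTimeTest_mul hθ hE hψ)]
    refine integral_congr_ae ?_
    filter_upwards [hbu.ae_integrable_flux (ν := ν) hψ, hbu.ae_memLp] with s hs hus
    have hder : ∀ x, deriv (fun τ => θ τ * E τ * ψ x) s =
        (deriv θ s * E s + θ s * deriv E s) * ψ x := fun x => by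
      have := (((hθ.1.differentiable (by simp) s).hasDerivAt.mul
        (hE.differentiable (by simp) s).hasDerivAt).mul_const (ψ x)).deriv
      simpa using this
    have hlap : ∀ x, torusLaplacian (fun x => θ s * E s * ψ x) x =
        θ s * E s * torusLaplacian ψ x := fun x => by
      unfold torusLaplacian
      rw [Finset.mul_sum]
      refine Finset.sum_congr rfl fun i _ => ?_
      rw [funext fun x => torusPartial_const_mul hψ (θ s * E s) i x,
        torusPartial_const_mul (hψ.torusPartial i)]
    have i1 : Integrable (fun x => u s x * ψ x) :=
      memLp_one_iff_integrable.1 ((hψ.memLp 1).mul hus)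
    have : ∀ x, u s x * (deriv (fun τ => θ τ * E τ * ψ x) s +
        ∑ i, b s x i * torusPartial i (fun x => θ s * E s * ψ x) x +
          ν * torusLaplacian (fun x => θ s * E s * ψ x) x) =
        (deriv θ s * E s + θ s * deriv E s) * (u s x * ψ x) + (θ s * E s) *
          (u s x * (∑ i, b s x i * torusPartial i ψ x + ν * torusLaplacian ψ x)) := fun x => by
      rw [hder, hlap]
      simp_rw [torusPartial_const_mul hψ, mul_left_comm _ (θ s * E s), ← Finset.mul_sum]
      ring
    simp_rw [this]
    rw [integral_add (i1.const_mul _) (hs.const_mul _), integral_const_mul, integral_const_mul]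
    unfold weakFlux
    ring

end
end

noncomputable section

/-! ### Real Fourier modes -/

/-- The phase `2π k · y`. -/
def torusPhase {d : ℕ} (k : Fin d → ℤ) (y : EuclideanSpace ℝ (Fin d)) : ℝ :=
  2 * Real.pi * ∑ i, (k i : ℝ) * y i

/-- The mode `cos (2π k · x)`. -/
def cosMode {d : ℕ} (k : Fin d → ℤ) (x : UnitAddTorus (Fin d)) : ℝ :=
  (UnitAddTorus.mFourier k x).re

/-- The mode `sin (2π k · x)`. -/
def sinMode {d : ℕ} (k : Fin d → ℤ) (x : UnitAddTorus (Fin d)) : ℝ :=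
  (UnitAddTorus.mFourier k x).im

/-- The eigenvalue `4π² |k|²` of the negative Laplacian. -/
def laplaceEigenvalue {d : ℕ} (k : Fin d → ℤ) : ℝ := (2 * Real.pi) ^ 2 * ∑ i, (k i : ℝ) ^ 2

section

variable {d : ℕ} (k : Fin d → ℤ)

lemma laplaceEigenvalue_nonneg : 0 ≤ laplaceEigenvalue k :=
  mul_nonneg (sq_nonneg _) (Finset.sum_nonneg fun _ _ => sq_nonneg _)

lemma mFourier_toTorus (y : EuclideanSpace ℝ (Fin d)) :
    UnitAddTorus.mFourier k (toTorus y) = Complex.exp (torusPhase k y * Complex.I) := by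
  simp only [UnitAddTorus.mFourier, ContinuousMap.coe_mk, toTorus, fourier_coe_apply, torusPhase]
  rw [← Complex.exp_sum]
  congr 1
  push_cast
  rw [Finset.mul_sum, Finset.sum_mul]
  refine Finset.sum_congr rfl fun i _ => ?_
  ring

lemma cosMode_toTorus (y : EuclideanSpace ℝ (Fin d)) :
    cosMode k (toTorus y) = Real.cos (torusPhase k y) := by
  rw [cosMode, mFourier_toTorus, Complex.exp_ofReal_mul_I_re]

lemma sinMode_toTorus (y : EuclideanSpace ℝ (Fin d)) :
    sinMode k (toTorus y) = Real.sin (torusPhase k y) := by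
  rw [sinMode, mFourier_toTorus, Complex.exp_ofReal_mul_I_im]

lemma contDiff_torusPhase : ContDiff ℝ ((⊤ : ℕ∞) : WithTop ℕ∞) (torusPhase k) := by
  unfold torusPhase; fun_prop

lemma torusSmooth_cosMode : TorusSmooth (cosMode k) := by
  unfold TorusSmooth
  simp_rw [cosMode_toTorus]
  exact Real.contDiff_cos.comp (contDiff_torusPhase k)

lemma torusSmooth_sinMode : TorusSmooth (sinMode k) := by
  unfold TorusSmooth
  simp_rw [sinMode_toTorus]
  exact Real.contDiff_sin.comp (contDiff_torusPhase k)

lemma hasDerivAt_torusPhase (i : Fin d) (y : EuclideanSpace ℝ (Fin d)) :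
    HasDerivAt (fun s : ℝ => torusPhase k (y + EuclideanSpace.single i s))
      (2 * Real.pi * k i) 0 := by
  have : (fun s : ℝ => torusPhase k (y + EuclideanSpace.single i s)) =
      fun s => torusPhase k y + s * (2 * Real.pi * k i) := by
    ext s
    simp only [torusPhase, PiLp.add_apply, mul_add, Finset.sum_add_distrib,
      PiLp.single_apply, mul_ite, mul_zero, Finset.sum_ite_eq', Finset.mem_univ, if_true]
    ring
  rw [this]
  simpa using ((hasDerivAt_id (0 : ℝ)).mul_const (2 * Real.pi * (k i : ℝ))).const_add
    (torusPhase k y)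

lemma torusPartial_cosMode (i : Fin d) (x : UnitAddTorus (Fin d)) :
    torusPartial i (cosMode k) x = -(2 * Real.pi * k i) * sinMode k x := by
  obtain ⟨y, rfl⟩ := toTorus_surjective x
  apply torusPartial_eq_of_hasDerivAt
  simp_rw [← toTorus_add, cosMode_toTorus, sinMode_toTorus]
  have := (hasDerivAt_torusPhase k i y).cos
  simp only [single_zero_right, add_zero] at this
  convert this using 1
  ring

lemma torusPartial_sinMode (i : Fin d) (x : UnitAddTorus (Fin d)) :
    torusPartial i (sinMode k) x = (2 * Real.pi * k i) * cosMode k x := by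
  obtain ⟨y, rfl⟩ := toTorus_surjective x
  apply torusPartial_eq_of_hasDerivAt
  simp_rw [← toTorus_add, cosMode_toTorus, sinMode_toTorus]
  have := (hasDerivAt_torusPhase k i y).sin
  simp only [single_zero_right, add_zero] at this
  convert this using 1
  ring

lemma torusLaplacian_cosMode (x : UnitAddTorus (Fin d)) :
    torusLaplacian (cosMode k) x = -laplaceEigenvalue k * cosMode k x := by
  unfold torusLaplacian laplaceEigenvalue
  rw [Finset.mul_sum, ← Finset.sum_neg_distrib, Finset.sum_mul]
  refine Finset.sum_congr rfl fun i _ => ?_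
  rw [funext fun x => torusPartial_cosMode k i x,
    torusPartial_const_mul (torusSmooth_sinMode k), torusPartial_sinMode]
  ring

lemma torusLaplacian_sinMode (x : UnitAddTorus (Fin d)) :
    torusLaplacian (sinMode k) x = -laplaceEigenvalue k * sinMode k x := by
  unfold torusLaplacian laplaceEigenvalue
  rw [Finset.mul_sum, ← Finset.sum_neg_distrib, Finset.sum_mul]
  refine Finset.sum_congr rfl fun i _ => ?_
  rw [funext fun x => torusPartial_sinMode k i x,
    torusPartial_const_mul (torusSmooth_cosMode k), torusPartial_cosMode]
  ring

lemma torusPhase_sub (y z : EuclideanSpace ℝ (Fin d)) :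
    torusPhase k (y - z) = torusPhase k y - torusPhase k z := by
  simp only [torusPhase, PiLp.sub_apply, mul_sub, Finset.sum_sub_distrib]

lemma cosMode_sub (x : UnitAddTorus (Fin d)) (h : EuclideanSpace ℝ (Fin d)) :
    cosMode k (x - toTorus h) =
      Real.cos (torusPhase k h) * cosMode k x + Real.sin (torusPhase k h) * sinMode k x := by
  obtain ⟨y, rfl⟩ := toTorus_surjective x
  rw [sub_eq_add_neg, ← toTorus_neg, ← toTorus_add, ← sub_eq_add_neg, cosMode_toTorus,
    cosMode_toTorus, sinMode_toTorus, torusPhase_sub, Real.cos_sub]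
  ring

lemma sinMode_sub (x : UnitAddTorus (Fin d)) (h : EuclideanSpace ℝ (Fin d)) :
    sinMode k (x - toTorus h) =
      Real.cos (torusPhase k h) * sinMode k x - Real.sin (torusPhase k h) * cosMode k x := by
  obtain ⟨y, rfl⟩ := toTorus_surjective x
  rw [sub_eq_add_neg, ← toTorus_neg, ← toTorus_add, ← sub_eq_add_neg, sinMode_toTorus,
    cosMode_toTorus, sinMode_toTorus, torusPhase_sub, Real.sin_sub]
  ring

/-- Cauchy–Schwarz for `k · h`. -/
lemma abs_torusPhase_le (h : EuclideanSpace ℝ (Fin d)) :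
    |torusPhase k h| ≤ √(laplaceEigenvalue k) * ‖h‖ := by
  rw [← Real.sqrt_sq (norm_nonneg h), ← Real.sqrt_mul (laplaceEigenvalue_nonneg k)]
  refine Real.abs_le_sqrt ?_
  rw [torusPhase, laplaceEigenvalue, EuclideanSpace.norm_sq_eq, mul_pow, mul_assoc]
  refine mul_le_mul_of_nonneg_left ?_ (sq_nonneg _)
  simpa using Finset.sum_mul_sq_le_sq_mul_sq Finset.univ (fun i => (k i : ℝ)) (fun i => h i)

/-- The left side is `|e^{iφ} - 1|² ≤ min(φ², 4)`. The linear bound is preferred to the quadratic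
one because it later costs only `√λ`: the heat factor turns this into `(t - s)^(-1/2)`, whereas a
full `λ` would give the non-integrable `(t - s)^(-1)`. -/
lemma sq_cos_sub_one_add_sq_sin_le (φ : ℝ) :
    (Real.cos φ - 1) ^ 2 + Real.sin φ ^ 2 ≤ 2 * |φ| := by
  have h1 : (Real.cos φ - 1) ^ 2 + Real.sin φ ^ 2 = 2 - 2 * Real.cos φ := by
    have := Real.sin_sq_add_cos_sq φ
    nlinarith
  rw [h1]
  have h2 := Real.one_sub_sq_div_two_le_cos (x := φ)
  have h3 := Real.neg_one_le_cos φ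
  have h4 : φ ^ 2 = |φ| ^ 2 := (sq_abs φ).symm
  rcases le_total |φ| 2 with h | h
  · nlinarith [abs_nonneg φ]
  · linarith

/-- The squared modulus of the `k`-th Fourier coefficient. -/
def modeEnergy (f : UnitAddTorus (Fin d) → ℝ) : ℝ :=
  (∫ x, f x * cosMode k x) ^ 2 + (∫ x, f x * sinMode k x) ^ 2

lemma modeEnergy_nonneg (f : UnitAddTorus (Fin d) → ℝ) : 0 ≤ modeEnergy k f := by
  unfold modeEnergy; positivity

lemma integrable_mul_of_memLp_two {f ψ : UnitAddTorus (Fin d) → ℝ} (hf : MemLp f 2 volume)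
    (hψ : TorusSmooth ψ) : Integrable fun x => f x * ψ x :=
  memLp_one_iff_integrable.1 ((hψ.memLp 2).mul hf)

lemma norm_mFourierCoeff_sq {f : UnitAddTorus (Fin d) → ℝ} (hf : MemLp f 2 volume) :
    ‖∫ x, UnitAddTorus.mFourier (-k) x • (f x : ℂ)‖ ^ 2 = modeEnergy k f := by
  have hc := integrable_mul_of_memLp_two hf (torusSmooth_cosMode k)
  have hs := integrable_mul_of_memLp_two hf (torusSmooth_sinMode k)
  have h1 : ∀ x, UnitAddTorus.mFourier (-k) x • (f x : ℂ) =
      ((f x * cosMode k x : ℝ) : ℂ) - ((f x * sinMode k x : ℝ) : ℂ) * Complex.I := fun x => by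
    rw [UnitAddTorus.mFourier_neg, cosMode, sinMode, smul_eq_mul]
    apply Complex.ext <;> simp [mul_comm]
  simp_rw [h1]
  rw [integral_sub hc.ofReal (hs.ofReal.mul_const _), integral_mul_const, integral_complex_ofReal,
    integral_complex_ofReal, Complex.sq_norm, Complex.normSq_apply, modeEnergy]
  simp
  ring

/-- **Parseval's identity** for real functions on the torus. -/
lemma hasSum_modeEnergy {f : UnitAddTorus (Fin d) → ℝ} (hf : MemLp f 2 volume) :
    HasSum (fun k => modeEnergy k f) (∫ x, f x ^ 2) := by
  -- The Fourier coefficients are taken with respect to the product of normalised Haar measures;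
  -- quantifying over `μ` allows the identity to be carried to `volume` by substitution.
  have key : ∀ μ : Measure (UnitAddTorus (Fin d)),
      μ = Measure.pi (fun _ => AddCircle.haarAddCircle) → MemLp f 2 μ →
      HasSum (fun k => ‖∫ x, UnitAddTorus.mFourier (-k) x • (f x : ℂ) ∂μ‖ ^ 2)
        (∫ x, f x ^ 2 ∂μ) := by
    rintro μ rfl hμ
    have hC : MemLp (fun x => (f x : ℂ)) 2
        (Measure.pi (fun _ : Fin d => AddCircle.haarAddCircle)) := hμ.ofReal
    have h := UnitAddTorus.hasSum_sq_mFourierCoeff (d := Fin d) (hC.toLp _)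
    have e1 : ∀ n, UnitAddTorus.mFourierCoeff (hC.toLp _) n =
        ∫ x, UnitAddTorus.mFourier (-n) x • (f x : ℂ)
          ∂(Measure.pi (fun _ : Fin d => AddCircle.haarAddCircle)) := fun n => by
      refine integral_congr_ae ?_
      filter_upwards [hC.coeFn_toLp] with x hx
      rw [hx]
    simp_rw [e1] at h
    convert h using 1
    refine integral_congr_ae ?_
    filter_upwards [hC.coeFn_toLp] with x hx
    rw [hx]
    simp
  have hvol : (volume : Measure (UnitAddTorus (Fin d))) =
      Measure.pi (fun _ => AddCircle.haarAddCircle) := by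
    rw [← volume_unitAddCircle_eq_haar]; rfl
  have := key volume hvol hf
  simp_rw [norm_mFourierCoeff_sq _ hf] at this
  exact this

/-- A translation by `h` rotates the `k`-th coefficient by the phase `φ = 2π k · h`, so the
increment multiplies its energy by `|e^{iφ} - 1|²`. -/
lemma modeEnergy_increment {f : UnitAddTorus (Fin d) → ℝ} (hf : MemLp f 2 volume)
    (h : EuclideanSpace ℝ (Fin d)) :
    modeEnergy k (fun x => f (x + toTorus h) - f x) ≤
      2 * (√(laplaceEigenvalue k) * ‖h‖) * modeEnergy k f := by
  have hc := integrable_mul_of_memLp_two hf (torusSmooth_cosMode k)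
  have hs := integrable_mul_of_memLp_two hf (torusSmooth_sinMode k)
  set φ := torusPhase k h
  have trans : ∀ ψ : UnitAddTorus (Fin d) → ℝ, TorusSmooth ψ →
      ∫ x, (f (x + toTorus h) - f x) * ψ x = ∫ x, f x * (ψ (x - toTorus h) - ψ x) := by
    intro ψ hψ
    have i1 : Integrable fun x => f x * ψ (x - toTorus h) := by
      have := integrable_mul_of_memLp_two hf (hψ.comp_add_right (-toTorus h))
      simpa only [sub_eq_add_neg] using this
    have i2 := integrable_mul_of_memLp_two hf hψ
    have i3 : Integrable fun x => f (x + toTorus h) * ψ x := by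
      simpa using i1.comp_add_right (toTorus h)
    simp_rw [sub_mul, mul_sub]
    rw [integral_sub i3 i2, integral_sub i1 i2]
    congr 1
    rw [← integral_add_right_eq_self (fun x => f x * ψ (x - toTorus h)) (toTorus h)]
    simp
  have ec : ∫ x, (f (x + toTorus h) - f x) * cosMode k x =
      (Real.cos φ - 1) * (∫ x, f x * cosMode k x) + Real.sin φ * ∫ x, f x * sinMode k x := by
    rw [trans _ (torusSmooth_cosMode k), ← integral_const_mul, ← integral_const_mul,
      ← integral_add (hc.const_mul _) (hs.const_mul _)]
    refine integral_congr_ae (ae_of_all _ fun x => ?_)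
    simp only [cosMode_sub]; ring
  have es : ∫ x, (f (x + toTorus h) - f x) * sinMode k x =
      (Real.cos φ - 1) * (∫ x, f x * sinMode k x) - Real.sin φ * ∫ x, f x * cosMode k x := by
    rw [trans _ (torusSmooth_sinMode k), ← integral_const_mul, ← integral_const_mul,
      ← integral_sub (hs.const_mul _) (hc.const_mul _)]
    refine integral_congr_ae (ae_of_all _ fun x => ?_)
    simp only [sinMode_sub]; ring
  have : modeEnergy k (fun x => f (x + toTorus h) - f x) =
      ((Real.cos φ - 1) ^ 2 + Real.sin φ ^ 2) * modeEnergy k f := by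
    unfold modeEnergy
    rw [ec, es]; ring
  rw [this]
  refine mul_le_mul_of_nonneg_right ((sq_cos_sub_one_add_sq_sin_le φ).trans ?_)
    (modeEnergy_nonneg k f)
  exact mul_le_mul_of_nonneg_left (abs_torusPhase_le k h) (by norm_num)

end
end

noncomputable section

/-! ### Parabolic smoothing -/

/-- The Cauchy–Schwarz inequality with a weight. -/
lemma sq_integral_mul_le {α : Type*} [MeasurableSpace α] {μ : Measure α} {w g : α → ℝ}
    (hw : Integrable w μ) (hwg : Integrable (fun s => w s * g s) μ)
    (hwg2 : Integrable (fun s => w s * g s ^ 2) μ) (hw0 : 0 ≤ᵐ[μ] w) :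
    (∫ s, w s * g s ∂μ) ^ 2 ≤ (∫ s, w s ∂μ) * ∫ s, w s * g s ^ 2 ∂μ := by
  have key : ∀ c : ℝ, 0 ≤ (∫ s, w s ∂μ) * (c * c) + (-2 * ∫ s, w s * g s ∂μ) * c +
      ∫ s, w s * g s ^ 2 ∂μ := by
    intro c
    have h0 : 0 ≤ ∫ s, w s * (g s - c) ^ 2 ∂μ := integral_nonneg_of_ae (by
      filter_upwards [hw0] with s hs
      exact mul_nonneg hs (sq_nonneg _))
    have e : ∀ s, w s * (g s - c) ^ 2 = (c * c) * w s + (-2 * c) * (w s * g s) + w s * g s ^ 2 :=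
      fun s => by ring
    simp_rw [e] at h0
    have i1 : Integrable (fun s => (c * c) * w s + (-2 * c) * (w s * g s)) μ :=
      (hw.const_mul _).add (hwg.const_mul _)
    rw [integral_add i1 hwg2, integral_add (hw.const_mul _) (hwg.const_mul _),
      integral_const_mul, integral_const_mul] at h0
    linarith
  have := discrim_le_zero key
  rw [discrim] at this
  linarith

/-- With `κ = νλ`, the total mass of the heat weight is at most `1/(νλ)`. This pays for the factor
`λ` produced by the divergence in the source term. -/
lemma integral_exp_neg_mul_le {κ t : ℝ} :
    κ * ∫ s in 0..t, Real.exp (-(κ * (t - s))) ≤ 1 := by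
  have hd : ∀ s ∈ Set.uIcc 0 t, HasDerivAt (fun s => Real.exp (-(κ * (t - s))))
      (κ * Real.exp (-(κ * (t - s)))) s := by
    intro s _
    have h1 : HasDerivAt (fun s => -(κ * (t - s))) κ s := by
      simpa using! (((hasDerivAt_id s).const_sub t).const_mul κ).neg
    convert h1.exp using 1
    ring
  rw [← intervalIntegral.integral_const_mul, intervalIntegral.integral_eq_sub_of_hasDerivAt hd
    (by apply Continuous.intervalIntegrable; fun_prop)]
  simp [Real.exp_nonneg]

/-- With `z = λντ` this is `√z ≤ 1 + z ≤ e^z`. -/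
lemma sqrt_mul_exp_neg_le {lam ν τ : ℝ} (hlam : 0 ≤ lam) (hντ : 0 < ν * τ) :
    √lam * Real.exp (-(ν * lam * τ)) ≤ 1 / √(ν * τ) := by
  have hs := Real.sqrt_pos.2 hντ
  rw [le_div_iff₀ hs, mul_right_comm, ← Real.sqrt_mul hlam, Real.exp_neg, ← div_eq_mul_inv,
    div_le_one (Real.exp_pos _)]
  have h1 : √(lam * (ν * τ)) ≤ lam * (ν * τ) + 1 := by
    rw [Real.sqrt_le_left (by positivity)]
    nlinarith [mul_nonneg hlam hντ.le, sq_nonneg (lam * (ν * τ))]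
  have h2 := Real.add_one_le_exp (ν * lam * τ)
  calc _ ≤ _ := h1
    _ = ν * lam * τ + 1 := by ring
    _ ≤ _ := h2

lemma intervalIntegrable_one_div_sqrt_sub (t : ℝ) :
    IntervalIntegrable (fun s : ℝ => (t - s) ^ (-(1 / 2) : ℝ)) volume 0 t := by
  have := (intervalIntegral.intervalIntegrable_rpow' (a := t) (b := 0)
    (r := -(1 / 2)) (by norm_num)).comp_sub_left t
  simpa using this

lemma integral_rpow_neg_half_sub {t : ℝ} :
    ∫ s in 0..t, (t - s) ^ (-(1 / 2) : ℝ) = 2 * √t := by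
  rw [intervalIntegral.integral_comp_sub_left (fun s : ℝ => s ^ (-(1 / 2) : ℝ)), sub_self,
    sub_zero, integral_rpow (Or.inl (by norm_num)), Real.sqrt_eq_rpow]
  norm_num
  ring

/-! ### Mode-by-mode estimates for the viscous equation -/

section

variable {d : ℕ} {T : EReal} {ν : ℝ} {b : ℝ → UnitAddTorus (Fin d) → EuclideanSpace ℝ (Fin d)}
  {u : ℝ → UnitAddTorus (Fin d) → ℝ} {u₀ : UnitAddTorus (Fin d) → ℝ} {M B : ℝ}

lemma ae_restrict_Ioc_of_timeInterval {P : ℝ → Prop} {t : ℝ} (htT : (t : EReal) < T)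
    (h : ∀ᵐ s ∂(volume.restrict (timeInterval T)), P s) :
    ∀ᵐ s ∂(volume.restrict (Set.Ioc 0 t)), P s :=
  ae_mono (Measure.restrict_mono
    (Set.Ioc_subset_Icc_self.trans (timeInterval_eq_Icc_subset htT)) le_rfl) h

/-- Duhamel's formula for an eigenfunction of the Laplacian. -/
lemma IsViscousSolution.duhamel (h : IsViscousSolution T ν b u₀ u)
    (hbu : IsBoundedPair (timeInterval T) b u M B) {ψ : UnitAddTorus (Fin d) → ℝ}
    (hψ : TorusSmooth ψ) {lam : ℝ} (hlam : ∀ x, torusLaplacian ψ x = -lam * ψ x) {t : ℝ}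
    (ht : 0 ≤ t) (htT : (t : EReal) < T) :
    ∫ x, u t x * ψ x = Real.exp (-(ν * lam * t)) * (∫ x, u 0 x * ψ x) +
      ∫ s in 0..t, Real.exp (-(ν * lam * (t - s))) * weakFlux 0 b u ψ s := by
  -- The integrating factor: its derivative cancels the contribution `-νλ ∫ u ψ` of the Laplacian
  -- and only the drift is left.
  have hE : ContDiff ℝ ((⊤ : ℕ∞) : WithTop ℕ∞) fun s => Real.exp (ν * lam * s) := by fun_prop
  have hid := h.weighted_identity hbu hE hψ ht htT
  have hdE : ∀ s, deriv (fun s => Real.exp (ν * lam * s)) s =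
      ν * lam * Real.exp (ν * lam * s) := fun s => by
    have := (((hasDerivAt_id s).const_mul (ν * lam)).exp).deriv
    simp [mul_comm] at this ⊢
  have hcongr : ∫ s in 0..t, (deriv (fun s => Real.exp (ν * lam * s)) s * (∫ x, u s x * ψ x) +
      Real.exp (ν * lam * s) * weakFlux ν b u ψ s) =
      ∫ s in 0..t, Real.exp (ν * lam * s) * weakFlux 0 b u ψ s := by
    rw [intervalIntegral.integral_of_le ht, intervalIntegral.integral_of_le ht]
    refine integral_congr_ae ?_
    filter_upwards [ae_restrict_Ioc_of_timeInterval htT (hbu.ae_integrable_flux (ν := 0) hψ),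
      ae_restrict_Ioc_of_timeInterval htT hbu.ae_memLp] with s h1 h2
    have i1 : Integrable (fun x => u s x * ψ x) :=
      memLp_one_iff_integrable.1 ((hψ.memLp 1).mul h2)
    have e : weakFlux ν b u ψ s = weakFlux 0 b u ψ s + -(ν * lam) * ∫ x, u s x * ψ x := by
      unfold weakFlux
      rw [← integral_const_mul, ← integral_add h1 (i1.const_mul _)]
      refine integral_congr_ae (ae_of_all _ fun x => ?_)
      simp only [hlam]; ring
    rw [hdE, e]; ring
  rw [hcongr] at hid
  have hexp : ∀ s, Real.exp (-(ν * lam * (t - s))) =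
      Real.exp (-(ν * lam * t)) * Real.exp (ν * lam * s) := fun s => by
    rw [← Real.exp_add]; congr 1; ring
  simp_rw [hexp, mul_assoc (Real.exp (-(ν * lam * t)))]
  rw [intervalIntegral.integral_const_mul, ← hid, mul_sub, ← mul_assoc, ← Real.exp_add]
  simp

/-- The sum of the energies in the mode `k` of the components of the flux `u b`. -/
def fluxEnergy (b : ℝ → UnitAddTorus (Fin d) → EuclideanSpace ℝ (Fin d))
    (u : ℝ → UnitAddTorus (Fin d) → ℝ) (k : Fin d → ℤ) (s : ℝ) : ℝ :=
  ∑ i, modeEnergy k fun x => u s x * b s x i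

/-- The gradient of a mode is `2πk` times the conjugate mode, up to sign, so the drift term is `2πk`
paired with the Fourier coefficients of the vector `u b`. Cauchy–Schwarz over the components gives
the factor `λ = 4π²|k|²`. -/
lemma IsBoundedPair.sq_weakFlux_le (hbu : IsBoundedPair (timeInterval T) b u M B)
    (k : Fin d → ℤ) : ∀ᵐ s ∂(volume.restrict (timeInterval T)),
      weakFlux 0 b u (cosMode k) s ^ 2 + weakFlux 0 b u (sinMode k) s ^ 2 ≤
        laplaceEigenvalue k * fluxEnergy b u k s := by
  filter_upwards [hbu.ae_memLp_mul] with s hs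
  have ec : weakFlux 0 b u (cosMode k) s =
      -(2 * Real.pi) * ∑ i, (k i : ℝ) * ∫ x, (u s x * b s x i) * sinMode k x := by
    simp_rw [← integral_const_mul]
    rw [← integral_finsetSum _ fun i _ =>
      (integrable_mul_of_memLp_two (hs i) (torusSmooth_sinMode k)).const_mul _,
      ← integral_const_mul]
    refine integral_congr_ae (ae_of_all _ fun x => ?_)
    simp only [torusPartial_cosMode, zero_mul, add_zero, Finset.mul_sum]
    exact Finset.sum_congr rfl fun i _ => by ring
  have es : weakFlux 0 b u (sinMode k) s =
      (2 * Real.pi) * ∑ i, (k i : ℝ) * ∫ x, (u s x * b s x i) * cosMode k x := by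
    simp_rw [← integral_const_mul]
    rw [← integral_finsetSum _ fun i _ =>
      (integrable_mul_of_memLp_two (hs i) (torusSmooth_cosMode k)).const_mul _,
      ← integral_const_mul]
    refine integral_congr_ae (ae_of_all _ fun x => ?_)
    simp only [torusPartial_sinMode, zero_mul, add_zero, Finset.mul_sum]
    exact Finset.sum_congr rfl fun i _ => by ring
  have c1 := Finset.sum_mul_sq_le_sq_mul_sq Finset.univ (fun i => (k i : ℝ))
    (fun i => ∫ x, (u s x * b s x i) * sinMode k x)
  have c2 := Finset.sum_mul_sq_le_sq_mul_sq Finset.univ (fun i => (k i : ℝ))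
    (fun i => ∫ x, (u s x * b s x i) * cosMode k x)
  rw [ec, es, laplaceEigenvalue, fluxEnergy, mul_pow, mul_pow, neg_sq, mul_assoc, ← mul_add]
  refine mul_le_mul_of_nonneg_left ?_ (sq_nonneg _)
  simp only [modeEnergy]
  rw [Finset.sum_add_distrib, mul_add]
  linarith

lemma integral_sq_le_of_eLpNorm_two_le {α : Type*} [MeasurableSpace α] {μ : Measure α}
    {f : α → ℝ} {B : ℝ} (hB : 0 ≤ B) (hf : MemLp f 2 μ)
    (h : eLpNorm f 2 μ ≤ ENNReal.ofReal B) : ∫ x, f x ^ 2 ∂μ ≤ B ^ 2 := by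
  have h1 := hf.eLpNorm_eq_integral_rpow_norm (by norm_num) (by norm_num)
  simp only [ENNReal.toReal_ofNat, Real.rpow_ofNat, Real.norm_eq_abs, sq_abs] at h1
  rw [h1, ENNReal.ofReal_le_ofReal_iff hB] at h
  have h0 : 0 ≤ ∫ x, f x ^ 2 ∂μ := integral_nonneg fun _ => sq_nonneg _
  rw [show (2 : ℝ)⁻¹ = 1 / 2 by norm_num, ← Real.sqrt_eq_rpow] at h
  calc _ = √(∫ x, f x ^ 2 ∂μ) ^ 2 := (Real.sq_sqrt h0).symm
    _ ≤ B ^ 2 := pow_le_pow_left₀ (Real.sqrt_nonneg _) h 2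

/-- Parseval for each `u b_i`, whose `L²` norm is at most `M B`. The exceptional set of times does
not depend on `F`, and finite sums suffice since the final estimate is obtained from partial sums.
-/
lemma IsBoundedPair.sum_fluxEnergy_le (hbu : IsBoundedPair (timeInterval T) b u M B) :
    ∀ᵐ s ∂(volume.restrict (timeInterval T)), ∀ F : Finset (Fin d → ℤ),
      ∑ k ∈ F, fluxEnergy b u k s ≤ d * (M ^ 2 * B ^ 2) := by
  filter_upwards [hbu.ae_memLp_mul, hbu.bdd_left, hbu.bdd_right] with s hs hu hb F
  unfold fluxEnergy
  rw [Finset.sum_comm]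
  have : ∀ i ∈ Finset.univ, ∑ k ∈ F, modeEnergy k (fun x => u s x * b s x i) ≤ M ^ 2 * B ^ 2 := by
    intro i _
    refine (sum_le_hasSum F (fun k _ => modeEnergy_nonneg k _)
      (hasSum_modeEnergy (hs i))).trans ?_
    calc ∫ x, (u s x * b s x i) ^ 2 ≤ ∫ x, M ^ 2 * b s x i ^ 2 := by
          refine integral_mono_ae (hs i).integrable_sq ((hb i).1.integrable_sq.const_mul _) ?_
          filter_upwards [hu] with x hx
          simp only [mul_pow]
          exact mul_le_mul_of_nonneg_right (sq_le_sq.2 (hx.trans (le_abs_self M))) (sq_nonneg _)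
      _ = M ^ 2 * ∫ x, b s x i ^ 2 := integral_const_mul _ _
      _ ≤ _ := mul_le_mul_of_nonneg_left
          (integral_sq_le_of_eLpNorm_two_le hbu.nonneg_right (hb i).1 (hb i).2) (sq_nonneg _)
  refine (Finset.sum_le_sum this).trans ?_
  simp

lemma fluxEnergy_nonneg (k : Fin d → ℤ) (s : ℝ) : 0 ≤ fluxEnergy b u k s :=
  Finset.sum_nonneg fun _ _ => modeEnergy_nonneg k _

lemma IsBoundedPair.integrableOn_fluxEnergy (hbu : IsBoundedPair (timeInterval T) b u M B)
    {t : ℝ} (htT : (t : EReal) < T) (k : Fin d → ℤ) :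
    IntegrableOn (fluxEnergy b u k) (Set.Ioc 0 t) := by
  have hle : (volume.restrict (Set.Ioc 0 t) : Measure ℝ) ≤ volume.restrict (timeInterval T) :=
    Measure.restrict_mono (Set.Ioc_subset_Icc_self.trans (timeInterval_eq_Icc_subset htT)) le_rfl
  refine Integrable.of_bound (AEStronglyMeasurable.mono_measure ?_ hle) (d * (M ^ 2 * B ^ 2)) ?_
  · have hm : ∀ (i : Fin d) (ψ : UnitAddTorus (Fin d) → ℝ), TorusSmooth ψ →
        AEStronglyMeasurable (fun s => ∫ x, u s x * b s x i * ψ x)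
          (volume.restrict (timeInterval T)) := by
      intro i ψ hψ
      have : AEStronglyMeasurable (fun z : ℝ × UnitAddTorus (Fin d) =>
          u z.1 z.2 * b z.1 z.2 i * ψ z.2) ((volume.restrict (timeInterval T)).prod volume) :=
        (hbu.meas_left.mul (hbu.meas_right i)).mul
          (hψ.continuous.comp continuous_snd).aestronglyMeasurable
      exact this.integral_prod_right'
    exact Finset.aestronglyMeasurable_fun_sum _ fun i _ =>
      ((hm i _ (torusSmooth_cosMode k)).pow 2).add ((hm i _ (torusSmooth_sinMode k)).pow 2)
  · filter_upwards [ae_restrict_Ioc_of_timeInterval htT hbu.sum_fluxEnergy_le] with s hs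
    rw [Real.norm_of_nonneg (fluxEnergy_nonneg k s)]
    simpa using hs {k}

/-- The bound on a single Fourier mode. -/
lemma IsViscousSolution.modeEnergy_le (h : IsViscousSolution T ν b u₀ u)
    (hbu : IsBoundedPair (timeInterval T) b u M B) (hν : 0 < ν) {t : ℝ}
    (ht : 0 < t) (htT : (t : EReal) < T) (k : Fin d → ℤ) :
    modeEnergy k (u t) ≤ 2 * (Real.exp (-(ν * laplaceEigenvalue k * t)) * modeEnergy k (u 0)) +
      2 / ν * ∫ s in Set.Ioc 0 t, Real.exp (-(ν * laplaceEigenvalue k * (t - s))) *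
        fluxEnergy b u k s := by
  set lam := laplaceEigenvalue k with hlamdef
  have hlam : 0 ≤ lam := laplaceEigenvalue_nonneg k
  set w : ℝ → ℝ := fun s => Real.exp (-(ν * lam * (t - s))) with hw
  have hwc : Continuous w := by fun_prop
  have hw0 : ∀ s, 0 ≤ w s := fun s => (Real.exp_pos _).le
  have hwi : IntegrableOn w (Set.Ioc 0 t) :=
    (hwc.continuousOn.integrableOn_Icc (μ := volume)).mono_set Set.Ioc_subset_Icc_self
  have fluxInt : ∀ ψ : UnitAddTorus (Fin d) → ℝ, TorusSmooth ψ →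
      IntegrableOn (fun s => w s * weakFlux 0 b u ψ s) (Set.Ioc 0 t) ∧
      IntegrableOn (fun s => w s * weakFlux 0 b u ψ s ^ 2) (Set.Ioc 0 t) := by
    intro ψ hψ
    have i0 := hbu.integrableOn_flux (ν := 0) hψ htT
    obtain ⟨C, hC⟩ := hbu.exists_flux_bound (ν := 0) hψ
    have hC' := ae_mono (Measure.restrict_mono (timeInterval_eq_Icc_subset htT) le_rfl) hC
    have i1 : IntegrableOn (fun s => weakFlux 0 b u ψ s ^ 2) (Set.Icc 0 t) := by
      simp_rw [sq]
      exact Integrable.bdd_mul i0 i0.aestronglyMeasurable hC'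
    exact ⟨(i0.continuousOn_mul hwc.continuousOn isCompact_Icc).mono_set Set.Ioc_subset_Icc_self,
      (i1.continuousOn_mul hwc.continuousOn isCompact_Icc).mono_set Set.Ioc_subset_Icc_self⟩
  set W := ∫ s in Set.Ioc 0 t, w s with hWdef
  have hW0 : 0 ≤ W := integral_nonneg hw0
  -- Cauchy–Schwarz in time with weight `w` produces the mass `W`, which meets the factor `λ` of the
  -- flux bound; together they cost only `1/ν`.
  have hW : lam * W ≤ 1 / ν := by
    rw [le_div_iff₀ hν]
    have := integral_exp_neg_mul_le (κ := ν * lam) (t := t)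
    rw [intervalIntegral.integral_of_le ht.le] at this
    linarith
  have one : ∀ ψ : UnitAddTorus (Fin d) → ℝ, TorusSmooth ψ →
      (∀ x, torusLaplacian ψ x = -lam * ψ x) →
      (∫ x, u t x * ψ x) ^ 2 ≤ 2 * (Real.exp (-(ν * lam * t)) * (∫ x, u 0 x * ψ x) ^ 2) +
        2 * (W * ∫ s in Set.Ioc 0 t, w s * weakFlux 0 b u ψ s ^ 2) := by
    intro ψ hψ hψl
    rw [h.duhamel hbu hψ hψl ht.le htT, intervalIntegral.integral_of_le ht.le]
    obtain ⟨j1, j2⟩ := fluxInt ψ hψ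
    have cs := sq_integral_mul_le hwi j1 j2 (ae_of_all _ hw0)
    have he1 : Real.exp (-(ν * lam * t)) ≤ 1 := by
      rw [Real.exp_le_one_iff, neg_nonpos]; positivity
    have he2 : Real.exp (-(ν * lam * t)) ^ 2 ≤ Real.exp (-(ν * lam * t)) := by
      rw [sq]; exact mul_le_of_le_one_left (Real.exp_pos _).le he1
    refine (add_sq_le (a := Real.exp (-(ν * lam * t)) * (∫ x, u 0 x * ψ x))).trans ?_
    rw [mul_add, mul_pow]
    refine add_le_add (mul_le_mul_of_nonneg_left
      (mul_le_mul_of_nonneg_right he2 (sq_nonneg _)) (by norm_num)) ?_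
    exact mul_le_mul_of_nonneg_left cs (by norm_num)
  have h1 := one _ (torusSmooth_cosMode k) (torusLaplacian_cosMode k)
  have h2 := one _ (torusSmooth_sinMode k) (torusLaplacian_sinMode k)
  obtain ⟨-, jc⟩ := fluxInt _ (torusSmooth_cosMode k)
  obtain ⟨-, js⟩ := fluxInt _ (torusSmooth_sinMode k)
  have hH : IntegrableOn (fun s => w s * fluxEnergy b u k s) (Set.Ioc 0 t) := by
    refine Integrable.bdd_mul (hbu.integrableOn_fluxEnergy htT k)
      hwc.aestronglyMeasurable (c := 1) ?_
    filter_upwards [ae_restrict_mem measurableSet_Ioc] with s hs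
    rw [Real.norm_of_nonneg (hw0 s), hw, Real.exp_le_one_iff, neg_nonpos]
    have : 0 ≤ t - s := by linarith [hs.2]
    positivity
  have h3 : (∫ s in Set.Ioc 0 t, w s * weakFlux 0 b u (cosMode k) s ^ 2) +
      (∫ s in Set.Ioc 0 t, w s * weakFlux 0 b u (sinMode k) s ^ 2) ≤
      lam * ∫ s in Set.Ioc 0 t, w s * fluxEnergy b u k s := by
    rw [← integral_add jc js, ← integral_const_mul]
    refine integral_mono_ae (jc.add js) (hH.const_mul _) ?_
    filter_upwards [ae_restrict_Ioc_of_timeInterval htT (hbu.sq_weakFlux_le k)] with s hs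
    have := mul_le_mul_of_nonneg_left hs (hw0 s)
    linarith
  have hHn : 0 ≤ ∫ s in Set.Ioc 0 t, w s * fluxEnergy b u k s :=
    integral_nonneg fun s => mul_nonneg (hw0 s) (fluxEnergy_nonneg k s)
  have h4 := mul_le_mul_of_nonneg_left h3 hW0
  have h5 := mul_le_mul_of_nonneg_right hW hHn
  have h6 : 2 / ν * ∫ s in Set.Ioc 0 t, w s * fluxEnergy b u k s =
      2 * (1 / ν * ∫ s in Set.Ioc 0 t, w s * fluxEnergy b u k s) := by ring
  rw [h6]
  simp only [modeEnergy] at h1 h2 ⊢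
  linarith

/-- **Parabolic smoothing**: a quantitative modulus of continuity in `L²`. -/
lemma IsViscousSolution.integral_sq_increment_le (hu : IsViscousSolution T ν b u₀ u)
    (hbu : IsBoundedPair (timeInterval T) b u M B) (h0 : ∀ᵐ x, |u₀ x| ≤ M) (hν : 0 < ν)
    (hν1 : ν ≤ 1) {t : ℝ} (ht : 0 < t) (htT : (t : EReal) < T) (h : EuclideanSpace ℝ (Fin d)) :
    ∫ x, (u t (x + toTorus h) - u t x) ^ 2 ≤
      (4 * M ^ 2 / √t + 8 * √t * (d * (M ^ 2 * B ^ 2))) * (‖h‖ / (ν * √ν)) := by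
  have htI : t ∈ timeInterval T := ⟨ht.le, htT.le⟩
  have h0I : (0 : ℝ) ∈ timeInterval T :=
    ⟨le_rfl, (EReal.coe_le_coe_iff.2 ht.le).trans htT.le⟩
  have hut := hu.memLp_two t htI
  have hu0 := hu.memLp_two 0 h0I
  have hutr : MemLp (fun x => u t (x + toTorus h)) 2 volume :=
    hut.comp_measurePreserving (measurePreserving_add_right volume (toTorus h))
  have hM := hbu.nonneg_left
  set K : ℝ := d * (M ^ 2 * B ^ 2) with hK
  have hK0 : 0 ≤ K := by positivity
  have hsν := Real.sqrt_pos.2 hν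
  have hst := Real.sqrt_pos.2 ht
  have hinit : ∫ x, u 0 x ^ 2 ≤ M ^ 2 := by
    have : ∫ x, u 0 x ^ 2 ≤ ∫ _ : UnitAddTorus (Fin d), M ^ 2 := by
      refine integral_mono_ae hu0.integrable_sq (integrable_const _) ?_
      filter_upwards [hu.solves.1, h0] with x hx hx'
      rw [← hx] at hx'
      exact sq_le_sq.2 (hx'.trans (le_abs_self M))
    simpa using this
  -- By Parseval the squared `L²` norm of the increment is the sum of its mode energies, so a bound
  -- on all finite partial sums is enough.
  refine hasSum_le_of_sum_le (hasSum_modeEnergy (hutr.sub hut)) fun F => ?_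
  have hroot : IntegrableOn (fun s : ℝ => (t - s) ^ (-(1 / 2) : ℝ)) (Set.Ioc 0 t) :=
    (intervalIntegrable_iff_integrableOn_Ioc_of_le ht.le).1 (intervalIntegrable_one_div_sqrt_sub t)
  have hsing : ∀ k, IntegrableOn
      (fun s : ℝ => (t - s) ^ (-(1 / 2) : ℝ) * fluxEnergy b u k s) (Set.Ioc 0 t) := fun k => by
    refine Integrable.mul_bdd hroot (hbu.integrableOn_fluxEnergy htT k).aestronglyMeasurable
      (c := K) ?_
    filter_upwards [ae_restrict_Ioc_of_timeInterval htT hbu.sum_fluxEnergy_le] with s hs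
    rw [Real.norm_of_nonneg (fluxEnergy_nonneg k s)]
    simpa using hs {k}
  have step : ∀ k ∈ F, modeEnergy k (fun x => u t (x + toTorus h) - u t x) ≤
      4 * ‖h‖ / (√ν * √t) * modeEnergy k (u 0) + 4 * ‖h‖ / (ν * √ν) *
        ∫ s in Set.Ioc 0 t, (t - s) ^ (-(1 / 2) : ℝ) * fluxEnergy b u k s := by
    intro k _
    set lam := laplaceEigenvalue k with hlamdef
    have hlam : 0 ≤ lam := laplaceEigenvalue_nonneg k
    have m1 := modeEnergy_increment k hut h
    have m2 := hu.modeEnergy_le hbu hν ht htT k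
    rw [← hlamdef] at m1 m2
    have e0 : √lam * (Real.exp (-(ν * lam * t)) * modeEnergy k (u 0)) ≤
        1 / (√ν * √t) * modeEnergy k (u 0) := by
      rw [← mul_assoc, ← Real.sqrt_mul hν.le]
      exact mul_le_mul_of_nonneg_right (sqrt_mul_exp_neg_le hlam (mul_pos hν ht))
        (modeEnergy_nonneg k _)
    have e1 : √lam * (∫ s in Set.Ioc 0 t, Real.exp (-(ν * lam * (t - s))) *
        fluxEnergy b u k s) ≤
        1 / √ν * ∫ s in Set.Ioc 0 t, (t - s) ^ (-(1 / 2) : ℝ) * fluxEnergy b u k s := by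
      rw [← integral_const_mul, ← integral_const_mul]
      refine integral_mono_of_nonneg (ae_of_all _ fun s => mul_nonneg (Real.sqrt_nonneg _)
        (mul_nonneg (Real.exp_pos _).le (fluxEnergy_nonneg k s))) ((hsing k).const_mul _) ?_
      have hne : ∀ᵐ s ∂(volume.restrict (Set.Ioc 0 t)), s ≠ t :=
        ae_restrict_of_ae (Measure.ae_ne volume t)
      filter_upwards [ae_restrict_mem measurableSet_Ioc, hne] with s hs hst'
      have hts : 0 < t - s := sub_pos.2 (lt_of_le_of_ne hs.2 hst')
      have := mul_le_mul_of_nonneg_right (sqrt_mul_exp_neg_le hlam (mul_pos hν hts))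
        (fluxEnergy_nonneg (b := b) (u := u) k s)
      rw [Real.sqrt_mul hν.le] at this
      have e2 : (t - s) ^ (-(1 / 2) : ℝ) = 1 / √(t - s) := by
        rw [Real.rpow_neg hts.le, Real.sqrt_eq_rpow, one_div]
        norm_num
      simp only [e2]
      calc _ = √lam * Real.exp (-(ν * lam * (t - s))) * fluxEnergy b u k s := by ring
        _ ≤ _ := this
        _ = _ := by field_simp
    have hm0 := mul_le_mul_of_nonneg_left m2
      (mul_nonneg (by norm_num : (0 : ℝ) ≤ 2) (mul_nonneg (Real.sqrt_nonneg lam) (norm_nonneg h)))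
    refine m1.trans (hm0.trans ?_)
    have e0' := mul_le_mul_of_nonneg_left e0 (by positivity : 0 ≤ 4 * ‖h‖)
    have e1' := mul_le_mul_of_nonneg_left e1 (by positivity : 0 ≤ 4 * ‖h‖ / ν)
    refine le_trans (le_of_eq ?_) ((add_le_add e0' e1').trans (le_of_eq ?_))
    · ring
    · field_simp
  -- The singular weight no longer depends on `k`, so the modes can be summed at fixed time first;
  -- then `∫ (t - s)^(-1/2) ds = 2√t`.
  have hB : (∑ k ∈ F, ∫ s in Set.Ioc 0 t, (t - s) ^ (-(1 / 2) : ℝ) * fluxEnergy b u k s) ≤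
      2 * √t * K := by
    rw [← integral_finsetSum _ fun k _ => hsing k, ← integral_rpow_neg_half_sub,
      intervalIntegral.integral_of_le ht.le, ← integral_mul_const]
    refine integral_mono_ae (integrable_finsetSum _ fun k _ => hsing k)
      (hroot.mul_const _) ?_
    filter_upwards [ae_restrict_mem measurableSet_Ioc,
      ae_restrict_Ioc_of_timeInterval htT hbu.sum_fluxEnergy_le] with s hs hsum
    rw [← Finset.mul_sum]
    exact mul_le_mul_of_nonneg_left (hsum F) (Real.rpow_nonneg (sub_nonneg.2 hs.2) _)
  have hA : ∑ k ∈ F, modeEnergy k (u 0) ≤ M ^ 2 :=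
    (sum_le_hasSum F (fun k _ => modeEnergy_nonneg k _) (hasSum_modeEnergy hu0)).trans hinit
  refine (Finset.sum_le_sum step).trans ?_
  rw [Finset.sum_add_distrib, ← Finset.mul_sum, ← Finset.mul_sum]
  refine (add_le_add (mul_le_mul_of_nonneg_left hA (by positivity))
    (mul_le_mul_of_nonneg_left hB (by positivity))).trans ?_
  -- The initial datum contributes only `ν^(-1/2)`; for `ν ≤ 1` it is absorbed into the `ν^(-3/2)`
  -- of the source term.
  have hν2 : 4 * ‖h‖ / (√ν * √t) * M ^ 2 ≤ 4 * M ^ 2 / √t * (‖h‖ / (ν * √ν)) := by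
    have : 4 * ‖h‖ / (√ν * √t) * M ^ 2 = ν * (4 * M ^ 2 / √t * (‖h‖ / (ν * √ν))) := by
      field_simp
    rw [this]
    exact mul_le_of_le_one_left (by positivity) hν1
  refine (add_le_add_left hν2 _).trans (le_of_eq ?_)
  ring

end
end

noncomputable section

/-! ### Mollification by trigonometric kernels -/

/-- `(x, y) ↦ K (y - x)` is a finite sum of products of smooth functions. -/
def IsSeparableKernel {d : ℕ} (K : UnitAddTorus (Fin d) → ℝ) : Prop :=
  ∃ (ι : Type) (_ : Fintype ι) (A B : ι → UnitAddTorus (Fin d) → ℝ),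
    (∀ j, TorusSmooth (A j)) ∧ (∀ j, TorusSmooth (B j)) ∧ ∀ x y, K (y - x) = ∑ j, A j y * B j x

/-- A nonnegative, even, separable convolution kernel of unit mass. -/
structure IsTorusKernel {d : ℕ} (K : UnitAddTorus (Fin d) → ℝ) : Prop where
  smooth : TorusSmooth K
  nonneg : ∀ x, 0 ≤ K x
  even : ∀ x, K (-x) = K x
  integral_eq_one : ∫ x, K x = 1
  separable : IsSeparableKernel K

/-- Convolution with the kernel `K`. -/
def torusConv {d : ℕ} (K f : UnitAddTorus (Fin d) → ℝ) (x : UnitAddTorus (Fin d)) : ℝ :=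
  ∫ y, f y * K (y - x)

/-- The `L²` modulus of continuity. -/
def translationModulus {d : ℕ} (f : UnitAddTorus (Fin d) → ℝ) (z : UnitAddTorus (Fin d)) : ℝ≥0∞ :=
  eLpNorm (fun x => f (x + z) - f x) 2 volume

section

variable {d : ℕ} {K L f g : UnitAddTorus (Fin d) → ℝ}

namespace IsSeparableKernel

lemma const (c : ℝ) : IsSeparableKernel fun _ : UnitAddTorus (Fin d) => c :=
  ⟨Unit, inferInstance, fun _ _ => c, fun _ _ => 1, fun _ => TorusSmooth.const _,
    fun _ => TorusSmooth.const _, fun x y => by simp⟩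

lemma mul (hK : IsSeparableKernel K) (hL : IsSeparableKernel L) :
    IsSeparableKernel fun x => K x * L x := by
  obtain ⟨ι, hι, A, B, hA, hB, h⟩ := hK
  obtain ⟨κ, hκ, A', B', hA', hB', h'⟩ := hL
  refine ⟨ι × κ, inferInstance, fun j x => A j.1 x * A' j.2 x, fun j x => B j.1 x * B' j.2 x,
    fun j => (hA _).mul (hA' _), fun j => (hB _).mul (hB' _), fun x y => ?_⟩
  beta_reduce
  rw [h, h', Finset.sum_mul_sum, ← Finset.univ_product_univ, Finset.sum_product]
  refine Finset.sum_congr rfl fun i _ => Finset.sum_congr rfl fun j _ => ?_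
  ring

lemma pow (hK : IsSeparableKernel K) (n : ℕ) : IsSeparableKernel fun x => K x ^ n := by
  induction n with
  | zero => simpa using const (d := d) 1
  | succ n ih => simpa [pow_succ] using ih.mul hK

lemma prod {ι : Type*} (s : Finset ι) {F : ι → UnitAddTorus (Fin d) → ℝ}
    (hF : ∀ i, IsSeparableKernel (F i)) : IsSeparableKernel fun x => ∏ i ∈ s, F i x := by
  classical
  induction s using Finset.induction_on with
  | empty => simpa using const (d := d) 1
  | insert i s hi ih =>
    simp_rw [Finset.prod_insert hi]
    exact (hF i).mul ih

/-- The addition formula `cos(a - b) = cos a cos b + sin a sin b`, together with the constant, gives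
three products. -/
lemma half_one_add_cosMode (k : Fin d → ℤ) :
    IsSeparableKernel fun x => (1 + cosMode k x) / 2 := by
  refine ⟨Fin 3, inferInstance, ![fun _ => 1 / 2, fun x => 1 / 2 * cosMode k x,
    fun x => 1 / 2 * sinMode k x], ![fun _ => 1, cosMode k, sinMode k], ?_, ?_, fun x y => ?_⟩
  · intro j
    fin_cases j
    · exact TorusSmooth.const _
    · exact (torusSmooth_cosMode k).const_mul _
    · exact (torusSmooth_sinMode k).const_mul _
  · intro j
    fin_cases j
    · exact TorusSmooth.const _
    · exact torusSmooth_cosMode k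
    · exact torusSmooth_sinMode k
  · obtain ⟨z, rfl⟩ := toTorus_surjective x
    beta_reduce
    rw [cosMode_sub, ← cosMode_toTorus, ← sinMode_toTorus, Fin.sum_univ_three]
    simp
    ring

end IsSeparableKernel

/-! ### Powers of a trigonometric peak as an approximate identity -/

lemma TorusSmooth.prod {ι : Type*} (s : Finset ι) {F : ι → UnitAddTorus (Fin d) → ℝ}
    (hF : ∀ i, TorusSmooth (F i)) : TorusSmooth fun x => ∏ i ∈ s, F i x :=
  contDiff_prod fun i _ => hF i

/-- The function `∏ (1 + cos (2π x_i)) / 2`, which peaks at the origin. -/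
def torusPeak (x : UnitAddTorus (Fin d)) : ℝ :=
  ∏ i, (1 + cosMode (Pi.single i 1) x) / 2

/-- The normalized powers of `torusPeak`. -/
def torusMollifier (n : ℕ) (x : UnitAddTorus (Fin d)) : ℝ :=
  (∫ z : UnitAddTorus (Fin d), torusPeak z ^ n)⁻¹ * torusPeak x ^ n

lemma torusPhase_single (i : Fin d) (y : EuclideanSpace ℝ (Fin d)) :
    torusPhase (Pi.single i 1) y = 2 * Real.pi * y i := by
  simp [torusPhase, Pi.single_apply]

lemma half_one_add_cosMode_nonneg (k : Fin d → ℤ) (x : UnitAddTorus (Fin d)) :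
    0 ≤ (1 + cosMode k x) / 2 := by
  obtain ⟨y, rfl⟩ := toTorus_surjective x
  rw [cosMode_toTorus]
  linarith [Real.neg_one_le_cos (torusPhase k y)]

lemma half_one_add_cosMode_le_one (k : Fin d → ℤ) (x : UnitAddTorus (Fin d)) :
    (1 + cosMode k x) / 2 ≤ 1 := by
  obtain ⟨y, rfl⟩ := toTorus_surjective x
  rw [cosMode_toTorus]
  linarith [Real.cos_le_one (torusPhase k y)]

lemma torusSmooth_torusPeak : TorusSmooth (torusPeak (d := d)) := by
  refine TorusSmooth.prod _ fun i => ?_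
  have := ((TorusSmooth.const 1).add (torusSmooth_cosMode (d := d) (Pi.single i 1))).const_mul
    (1 / 2)
  simpa only [one_div_mul_eq_div] using this

lemma torusPeak_nonneg (x : UnitAddTorus (Fin d)) : 0 ≤ torusPeak x :=
  Finset.prod_nonneg fun _ _ => half_one_add_cosMode_nonneg _ _

lemma torusPeak_zero : torusPeak (0 : UnitAddTorus (Fin d)) = 1 := by
  unfold torusPeak
  refine Finset.prod_eq_one fun i _ => ?_
  rw [← toTorus_zero, cosMode_toTorus, torusPhase_single]
  simp

lemma torusPeak_neg (x : UnitAddTorus (Fin d)) : torusPeak (-x) = torusPeak x := by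
  obtain ⟨y, rfl⟩ := toTorus_surjective x
  simp only [torusPeak, ← toTorus_neg, cosMode_toTorus, torusPhase_single, PiLp.neg_apply, mul_neg,
    Real.cos_neg]

/-- A nonzero point has a coordinate outside `ℤ`, where the cosine is below `1`; the other factors
lie in `[0, 1]`. Uniqueness of the maximum makes the normalised powers concentrate at the origin. -/
lemma torusPeak_lt_one {x : UnitAddTorus (Fin d)} (hx : x ≠ 0) : torusPeak x < 1 := by
  classical
  obtain ⟨i, hi⟩ := Function.ne_iff.1 hx
  have h1 : (1 + cosMode (Pi.single i 1) x) / 2 < 1 := by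
    obtain ⟨y, rfl⟩ := toTorus_surjective x
    rw [cosMode_toTorus, torusPhase_single]
    have hne : Real.cos (2 * Real.pi * y i) ≠ 1 := by
      intro h
      obtain ⟨n, hn⟩ := (Real.cos_eq_one_iff _).1 h
      apply hi
      have : y i = n := by
        have := Real.pi_pos
        field_simp at hn
        linarith
      simp only [toTorus, this, Pi.zero_apply]
      exact (AddCircle.coe_eq_zero_iff 1).2 ⟨n, by simp⟩
    linarith [lt_of_le_of_ne (Real.cos_le_one (2 * Real.pi * y i)) hne]
  unfold torusPeak
  rw [← Finset.mul_prod_erase _ _ (Finset.mem_univ i)]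
  refine (mul_le_of_le_one_right (half_one_add_cosMode_nonneg _ _) ?_).trans_lt h1
  exact Finset.prod_le_one (fun _ _ => half_one_add_cosMode_nonneg _ _)
    fun _ _ => half_one_add_cosMode_le_one _ _

lemma integral_torusPeak_pow_pos (n : ℕ) : 0 < ∫ z : UnitAddTorus (Fin d), torusPeak z ^ n := by
  refine Continuous.integral_pos_of_hasCompactSupport_nonneg_nonzero
    (torusSmooth_torusPeak.pow n).continuous (HasCompactSupport.of_compactSpace _)
    (fun x => pow_nonneg (torusPeak_nonneg x) n) (x := 0) ?_
  simp [torusPeak_zero]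

lemma isTorusKernel_torusMollifier (n : ℕ) : IsTorusKernel (torusMollifier (d := d) n) where
  smooth := (torusSmooth_torusPeak.pow n).const_mul _
  nonneg x := mul_nonneg (inv_nonneg.2 (integral_torusPeak_pow_pos n).le)
    (pow_nonneg (torusPeak_nonneg x) n)
  even x := by simp only [torusMollifier, torusPeak_neg]
  integral_eq_one := by
    unfold torusMollifier
    rw [integral_const_mul, inv_mul_cancel₀ (integral_torusPeak_pow_pos n).ne']
  separable := (IsSeparableKernel.const _).mul
    ((IsSeparableKernel.prod _ fun _ => IsSeparableKernel.half_one_add_cosMode _).pow n)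

lemma tendsto_integral_torusMollifier_mul (hg : Continuous g) :
    Tendsto (fun n => ∫ x, torusMollifier n x * g x) atTop (𝓝 (g 0)) := by
  have h := tendsto_setIntegral_pow_smul_of_unique_maximum_of_isCompact_of_continuousOn
    (μ := volume) (x₀ := (0 : UnitAddTorus (Fin d))) (c := torusPeak) (g := g) isCompact_univ
    torusSmooth_torusPeak.continuous.continuousOn
    (fun y _ hy => by rw [torusPeak_zero]; exact torusPeak_lt_one hy)
    (fun x _ => torusPeak_nonneg x) (by simp [torusPeak_zero]) (by simp) hg.continuousOn
  refine h.congr fun n => ?_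
  simp only [Measure.restrict_univ, smul_eq_mul, torusMollifier]
  rw [← integral_const_mul]
  simp only [mul_assoc]

lemma _root_.MeasureTheory.Integrable.mul_torusSmooth (hf : Integrable f) (hg : TorusSmooth g) :
    Integrable fun x => f x * g x := by
  obtain ⟨C, -, hC⟩ := hg.exists_bound
  exact hf.mul_bdd hg.aestronglyMeasurable (ae_of_all _ hC)

namespace IsTorusKernel

lemma integral_sub_eq_one (hK : IsTorusKernel K) (x : UnitAddTorus (Fin d)) :
    ∫ y, K (y - x) = 1 := by
  rw [integral_sub_right_eq_self (fun y => K y) x, hK.integral_eq_one]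

lemma smooth_sub (hK : IsTorusKernel K) (x : UnitAddTorus (Fin d)) :
    TorusSmooth fun y => K (y - x) := by
  simpa only [sub_eq_add_neg] using hK.smooth.comp_add_right (-x)

lemma sub_comm (hK : IsTorusKernel K) (x y : UnitAddTorus (Fin d)) : K (y - x) = K (x - y) := by
  rw [← hK.even, neg_sub]

lemma torusPartial_sub_left (hK : IsTorusKernel K) (i : Fin d) (x y : UnitAddTorus (Fin d)) :
    torusPartial i (fun x => K (y - x)) x = -torusPartial i (fun y => K (y - x)) y := by
  rw [torusPartial_comp_sub_left y hK.smooth]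
  simp_rw [sub_eq_add_neg]
  rw [torusPartial_comp_add_right]

lemma torusLaplacian_sub_left (hK : IsTorusKernel K) (x y : UnitAddTorus (Fin d)) :
    torusLaplacian (fun x => K (y - x)) x = torusLaplacian (fun y => K (y - x)) y := by
  unfold torusLaplacian
  refine Finset.sum_congr rfl fun i _ => ?_
  have e1 : torusPartial i (fun x => K (y - x)) = fun x => -1 * torusPartial i K (y - x) := by
    ext x
    rw [torusPartial_comp_sub_left y hK.smooth]; ring
  have hs : TorusSmooth fun x => torusPartial i K (y - x) := by
    have := (((hK.smooth.torusPartial i).comp_add_right y).comp_neg)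
    simpa only [neg_add_eq_sub] using this
  have e2 : torusPartial i (fun y => K (y - x)) = fun y => torusPartial i K (y + -x) := by
    ext y
    simp_rw [sub_eq_add_neg]
    rw [torusPartial_comp_add_right]
  rw [e1, torusPartial_const_mul hs, torusPartial_comp_sub_left y (hK.smooth.torusPartial i), e2,
    torusPartial_comp_add_right, sub_eq_add_neg]
  ring

/-- For a separable kernel the convolution is a finite combination of the smooth `B j` with
coefficients `∫ f A_j`. Derivatives in `x` therefore need no differentiation under the integral;
moving one to `y` changes the sign, moving two does not. -/
lemma torusSmooth_torusConv (hK : IsTorusKernel K) (hf : Integrable f) :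
    TorusSmooth (torusConv K f) ∧
    (∀ i x, torusPartial i (torusConv K f) x = -∫ y, f y * torusPartial i (fun y => K (y - x)) y) ∧
    ∀ x, torusLaplacian (torusConv K f) x = ∫ y, f y * torusLaplacian (fun y => K (y - x)) y := by
  obtain ⟨ι, hι, A, B, hA, hB, h⟩ := hK.separable
  have hint : ∀ j, Integrable fun y => f y * A j y := fun j =>
    hf.mul_torusSmooth (hA j)
  have expand : ∀ D : ι → UnitAddTorus (Fin d) → ℝ, ∀ x,
      ∑ j, (∫ y, f y * A j y) * D j x = ∫ y, f y * ∑ j, A j y * D j x := by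
    intro D x
    simp_rw [← integral_mul_const]
    rw [← integral_finsetSum _ fun j _ => (hint j).mul_const _]
    refine integral_congr_ae (ae_of_all _ fun y => ?_)
    simp only [Finset.mul_sum, mul_assoc]
  have hconv : torusConv K f = fun x => ∑ j, (∫ y, f y * A j y) * B j x := by
    ext x
    rw [expand B x, torusConv]
    simp_rw [h]
  have hKx : ∀ y, (fun x => K (y - x)) = fun x => ∑ j, A j y * B j x := fun y => by
    ext x; rw [h]
  refine ⟨?_, fun i x => ?_, fun x => ?_⟩
  · rw [hconv]
    exact TorusSmooth.sum fun j _ => (hB j).const_mul _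
  · rw [hconv, torusPartial_sum (fun j _ => (hB j).const_mul _)]
    simp_rw [torusPartial_const_mul (hB _)]
    rw [expand (fun j => torusPartial i (B j)) x, ← integral_neg]
    refine integral_congr_ae (ae_of_all _ fun y => ?_)
    simp only
    rw [← mul_neg, ← hK.torusPartial_sub_left, hKx,
      torusPartial_sum (fun j _ => (hB j).const_mul _)]
    simp_rw [torusPartial_const_mul (hB _)]
  · have lap : ∀ c : ι → ℝ, torusLaplacian (fun x => ∑ j, c j * B j x) x =
        ∑ j, c j * torusLaplacian (B j) x := by
      intro c
      unfold torusLaplacian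
      simp_rw [Finset.mul_sum]
      rw [Finset.sum_comm]
      refine Finset.sum_congr rfl fun i _ => ?_
      have : torusPartial i (fun x => ∑ j, c j * B j x) =
          fun x => ∑ j, c j * torusPartial i (B j) x := by
        ext x
        rw [torusPartial_sum (fun j _ => (hB j).const_mul _)]
        simp_rw [torusPartial_const_mul (hB _)]
      rw [this, torusPartial_sum (fun j _ => ((hB j).torusPartial i).const_mul _)]
      simp_rw [torusPartial_const_mul ((hB _).torusPartial i)]
    rw [hconv, lap, expand (fun j => torusLaplacian (B j)) x]
    refine integral_congr_ae (ae_of_all _ fun y => ?_)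
    simp only
    rw [← hK.torusLaplacian_sub_left, hKx, lap]

lemma torusPartial_torusConv (hK : IsTorusKernel K) (hf : Integrable f) {i : Fin d}
    (hg : IsWeakPartial i f g) (x : UnitAddTorus (Fin d)) :
    torusPartial i (torusConv K f) x = torusConv K g x := by
  rw [(hK.torusSmooth_torusConv hf).2.1, hg _ (hK.smooth_sub x), neg_neg]
  rfl

lemma abs_torusConv_le (hK : IsTorusKernel K) {M : ℝ} (hf : ∀ᵐ x, |f x| ≤ M)
    (x : UnitAddTorus (Fin d)) : |torusConv K f x| ≤ M := by
  have h1 : ‖torusConv K f x‖ ≤ ∫ y, M * K (y - x) := by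
    refine norm_integral_le_of_norm_le ((hK.smooth_sub x).integrable.const_mul M) ?_
    filter_upwards [hf] with y hy
    rw [norm_mul, Real.norm_of_nonneg (hK.nonneg _)]
    exact mul_le_mul_of_nonneg_right hy (hK.nonneg _)
  rwa [integral_const_mul, hK.integral_sub_eq_one, mul_one] at h1

end IsTorusKernel

/-! ### Translation moduli and commutators -/

lemma translationModulus_lt_top (hf : MemLp f 2 volume) (z : UnitAddTorus (Fin d)) :
    translationModulus f z < ∞ :=
  ((hf.comp_measurePreserving (measurePreserving_add_right volume z)).sub hf).2

lemma translationModulus_le (hf : MemLp f 2 volume) (z : UnitAddTorus (Fin d)) :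
    translationModulus f z ≤ 2 * eLpNorm f 2 volume := by
  have hz := measurePreserving_add_right (volume : Measure (UnitAddTorus (Fin d))) z
  refine (eLpNorm_sub_le (hf.comp_measurePreserving hz).1 hf.1 (by norm_num)).trans ?_
  rw [eLpNorm_comp_measurePreserving hf.1 hz, two_mul]

lemma continuous_translationModulus (hf : MemLp f 2 volume) :
    Continuous fun z => (translationModulus f z).toReal := by
  let τ : UnitAddTorus (Fin d) → C(UnitAddTorus (Fin d), UnitAddTorus (Fin d)) := fun z =>
    ⟨fun x => x + z, by fun_prop⟩
  have hτc : Continuous τ :=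
    ContinuousMap.continuous_of_continuous_uncurry _ (by
      change Continuous fun p : UnitAddTorus (Fin d) × UnitAddTorus (Fin d) => p.2 + p.1
      fun_prop)
  have hτ : ∀ z, MeasurePreserving (τ z) volume volume := fun z =>
    measurePreserving_add_right volume z
  have h : ∀ z : UnitAddTorus (Fin d), (translationModulus f z).toReal =
      ‖Lp.compMeasurePreserving (τ z) (hτ z) (hf.toLp f) - hf.toLp f‖ := by
    intro z
    rw [Lp.toLp_compMeasurePreserving, ← MemLp.toLp_sub, Lp.norm_toLp]
    rfl
  simp_rw [h]
  exact ((continuous_const.compMeasurePreservingLp hτc hτ (by norm_num)).sub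
    continuous_const).norm

lemma translationModulus_zero : translationModulus f 0 = 0 := by
  simp [translationModulus]

/-- The commutator of multiplication by `f` and mollification, applied to `g`. -/
def mollifyCommutator (K f g : UnitAddTorus (Fin d) → ℝ) : ℝ≥0∞ :=
  ∫⁻ x, ∫⁻ y, ENNReal.ofReal (K (y - x)) * (‖f x - f y‖ₑ * ‖g y‖ₑ)

lemma lintegral_mul_le_eLpNorm_two {α : Type*} [MeasurableSpace α] {μ : Measure α} {f g : α → ℝ}
    (hf : AEStronglyMeasurable f μ) (hg : AEStronglyMeasurable g μ) :
    ∫⁻ x, ‖f x‖ₑ * ‖g x‖ₑ ∂μ ≤ eLpNorm f 2 μ * eLpNorm g 2 μ := by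
  have h := ENNReal.lintegral_mul_le_Lp_mul_Lq μ Real.HolderConjugate.two_two hf.enorm hg.enorm
  rw [eLpNorm_eq_lintegral_rpow_enorm_toReal (by norm_num) (by norm_num),
    eLpNorm_eq_lintegral_rpow_enorm_toReal (by norm_num) (by norm_num)]
  simpa using h

/-- After `y = x + z` and an exchange of integrals, Cauchy–Schwarz in `x` at fixed `z` bounds the
commutator by the `K`-average of the translation modulus of `f`, which tends to `0` as `K`
concentrates. -/
lemma mollifyCommutator_le (hK : IsTorusKernel K) (hf : MemLp f 2 volume) (hg : MemLp g 2 volume) :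
    mollifyCommutator K f g ≤
      ENNReal.ofReal (∫ z, K z * (translationModulus f z).toReal) * eLpNorm g 2 volume := by
  have tr : ∀ z : UnitAddTorus (Fin d), MeasurePreserving (fun x => x + z) volume volume :=
    fun z => measurePreserving_add_right volume z
  have e1 : mollifyCommutator K f g = ∫⁻ x, ∫⁻ z,
      ENNReal.ofReal (K z) * (‖f x - f (x + z)‖ₑ * ‖g (x + z)‖ₑ) := by
    unfold mollifyCommutator
    refine lintegral_congr fun x => ?_
    rw [← lintegral_add_left_eq_self _ x]
    simp
  have hKm : Measurable fun z => ENNReal.ofReal (K z) := hK.smooth.continuous.measurable.ennreal_ofReal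
  have qmp : Measure.QuasiMeasurePreserving
      (fun p : UnitAddTorus (Fin d) × UnitAddTorus (Fin d) => p.1 + p.2)
      (volume.prod volume) volume := quasiMeasurePreserving_add _ _
  have hm : AEMeasurable (Function.uncurry fun x z =>
      ENNReal.ofReal (K z) * (‖f x - f (x + z)‖ₑ * ‖g (x + z)‖ₑ)) (volume.prod volume) := by
    have m1 := (hf.1.comp_fst.sub (hf.1.comp_quasiMeasurePreserving qmp)).enorm
    have m2 := (hg.1.comp_quasiMeasurePreserving qmp).enorm
    exact (hKm.comp measurable_snd).aemeasurable.mul (m1.mul m2)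
  rw [e1, lintegral_lintegral_swap hm]
  have e2 : ∀ z, ∫⁻ x, ENNReal.ofReal (K z) * (‖f x - f (x + z)‖ₑ * ‖g (x + z)‖ₑ) ≤
      ENNReal.ofReal (K z * (translationModulus f z).toReal) * eLpNorm g 2 volume := by
    intro z
    have hfz := hf.comp_measurePreserving (tr z)
    have hgz := hg.comp_measurePreserving (tr z)
    rw [lintegral_const_mul' _ _ ENNReal.ofReal_ne_top, ENNReal.ofReal_mul (hK.nonneg z),
      ENNReal.ofReal_toReal (translationModulus_lt_top hf z).ne, mul_assoc]
    gcongr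
    refine (lintegral_mul_le_eLpNorm_two (hf.sub hfz).1 hgz.1).trans (le_of_eq ?_)
    rw [eLpNorm_comp_measurePreserving hg.1 (tr z), eLpNorm_sub_comm]
    rfl
  refine (lintegral_mono e2).trans ?_
  have hc : Continuous fun z => K z * (translationModulus f z).toReal :=
    hK.smooth.continuous.mul (continuous_translationModulus hf)
  rw [lintegral_mul_const _ hc.measurable.ennreal_ofReal,
    ofReal_integral_eq_lintegral_ofReal
      (hc.integrable_of_hasCompactSupport (HasCompactSupport.of_compactSpace _))
      (ae_of_all _ fun z => mul_nonneg (hK.nonneg z) ENNReal.toReal_nonneg)]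

lemma tendsto_integral_mollifier_translationModulus (hf : MemLp f 2 volume) :
    Tendsto (fun n => ∫ z, torusMollifier n z * (translationModulus f z).toReal) atTop (𝓝 0) := by
  simpa [translationModulus_zero] using
    tendsto_integral_torusMollifier_mul (continuous_translationModulus hf)

/-- A bound uniform in the kernel, used as the majorant for dominated convergence in time. -/
lemma integral_mul_translationModulus_le (hK : IsTorusKernel K) (hf : MemLp f 2 volume) :
    ENNReal.ofReal (∫ z, K z * (translationModulus f z).toReal) ≤ 2 * eLpNorm f 2 volume := by
  have hfin : (2 * eLpNorm f 2 volume) ≠ ∞ := ENNReal.mul_ne_top (by norm_num) hf.2.ne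
  refine ENNReal.ofReal_le_of_le_toReal ?_
  calc ∫ z, K z * (translationModulus f z).toReal
      ≤ ∫ z, K z * (2 * eLpNorm f 2 volume).toReal := by
        refine integral_mono_of_nonneg
          (ae_of_all _ fun z => mul_nonneg (hK.nonneg z) ENNReal.toReal_nonneg)
          (hK.smooth.integrable.mul_const _) (ae_of_all _ fun z => ?_)
        exact mul_le_mul_of_nonneg_left
          (ENNReal.toReal_mono hfin (translationModulus_le hf z)) (hK.nonneg z)
    _ = _ := by rw [integral_mul_const, hK.integral_eq_one, one_mul]

end
end

noncomputable section

/-! ### The energy flux of a mollified solution -/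

section

variable {d : ℕ} {K f g u : UnitAddTorus (Fin d) → ℝ} {ν M : ℝ}
  {b : UnitAddTorus (Fin d) → EuclideanSpace ℝ (Fin d)} {G : Fin d → UnitAddTorus (Fin d) → ℝ}

lemma aemeasurable_mollifyCommutator (hK : IsTorusKernel K) (hf : AEStronglyMeasurable f volume)
    (hg : AEStronglyMeasurable g volume) :
    AEMeasurable (Function.uncurry fun x y => ENNReal.ofReal (K (y - x)) * (‖f x - f y‖ₑ * ‖g y‖ₑ))
      (volume.prod volume) := by
  have m0 : Measurable fun p : UnitAddTorus (Fin d) × UnitAddTorus (Fin d) =>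
      ENNReal.ofReal (K (p.2 - p.1)) :=
    (hK.smooth.continuous.comp (continuous_snd.sub continuous_fst)).measurable.ennreal_ofReal
  have m1 := (hf.comp_fst (ν := (volume : Measure (UnitAddTorus (Fin d))))
    |>.sub (hf.comp_snd (μ := (volume : Measure (UnitAddTorus (Fin d)))))).enorm
  have m2 := (hg.comp_snd (μ := (volume : Measure (UnitAddTorus (Fin d))))).enorm
  exact m0.aemeasurable.mul (m1.mul m2)

lemma mollifyCommutator_symm (hK : IsTorusKernel K) (hf : AEStronglyMeasurable f volume)
    (hg : AEStronglyMeasurable g volume) :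
    ∫⁻ x, ∫⁻ y, ENNReal.ofReal (K (y - x)) * (‖f y - f x‖ₑ * ‖g x‖ₑ) = mollifyCommutator K f g := by
  unfold mollifyCommutator
  rw [lintegral_lintegral_swap (aemeasurable_mollifyCommutator hK hf hg)]
  refine lintegral_congr fun x => lintegral_congr fun y => ?_
  rw [hK.sub_comm]

lemma torusConv_sub_eq (hK : IsTorusKernel K) (hf : Integrable f) (x : UnitAddTorus (Fin d)) :
    torusConv K f x - f x = ∫ y, (f y - f x) * K (y - x) := by
  simp_rw [sub_mul]
  rw [integral_sub (hf.mul_torusSmooth (hK.smooth_sub x))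
    ((hK.smooth_sub x).integrable.const_mul _), integral_const_mul, hK.integral_sub_eq_one, mul_one]
  rfl

lemma tendsto_mollifyCommutator (hf : MemLp f 2 volume) (hg : MemLp g 2 volume) :
    Tendsto (fun n => mollifyCommutator (torusMollifier n) f g) atTop (𝓝 0) := by
  have h := ENNReal.Tendsto.mul_const (b := eLpNorm g 2 volume)
    (ENNReal.tendsto_ofReal (tendsto_integral_mollifier_translationModulus hf))
    (Or.inr hg.2.ne)
  rw [ENNReal.ofReal_zero, zero_mul] at h
  exact tendsto_of_tendsto_of_tendsto_of_le_of_le tendsto_const_nhds h (fun _ => zero_le)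
    fun n => mollifyCommutator_le (isTorusKernel_torusMollifier n) hf hg

/-- Since `K` has mass one, `K * f - f` is the average of `f y - f x`, and pairing it with `g` gives
the commutator with the two variables exchanged. Weak convergence of mollifications thus needs no
separate argument. -/
lemma enorm_integral_mul_torusConv_sub_le (hK : IsTorusKernel K) (hf : MemLp f 2 volume)
    (hg : MemLp g 2 volume) :
    ‖(∫ x, g x * torusConv K f x) - ∫ x, g x * f x‖ₑ ≤ mollifyCommutator K f g := by
  have hfi : Integrable f := hf.integrable (by norm_num)
  have hgf : Integrable fun x => g x * f x := memLp_one_iff_integrable.1 (hf.mul hg)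
  rw [← integral_sub (integrable_mul_of_memLp_two hg (hK.torusSmooth_torusConv hfi).1) hgf, ← mollifyCommutator_symm hK hf.1 hg.1]
  refine (enorm_integral_le_lintegral_enorm _).trans (lintegral_mono fun x => ?_)
  rw [← mul_sub, torusConv_sub_eq hK hfi, ← integral_const_mul]
  refine (enorm_integral_le_lintegral_enorm _).trans (le_of_eq (lintegral_congr fun y => ?_))
  rw [enorm_mul, enorm_mul, Real.enorm_of_nonneg (hK.nonneg _)]
  ring

lemma tendsto_integral_mul_torusConv (hf : MemLp f 2 volume) (hg : MemLp g 2 volume) :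
    Tendsto (fun n => ∫ x, g x * torusConv (torusMollifier n) f x) atTop (𝓝 (∫ x, g x * f x)) := by
  rw [tendsto_iff_edist_tendsto_0]
  refine tendsto_of_tendsto_of_tendsto_of_le_of_le tendsto_const_nhds
    (tendsto_mollifyCommutator hf hg) (fun _ => zero_le) fun n => ?_
  rw [edist_eq_enorm_sub]
  exact enorm_integral_mul_torusConv_sub_le (isTorusKernel_torusMollifier n) hf hg

/-- A divergence free field is orthogonal to gradients of products `u ψ` with `u` in `W^{1,2}`. -/
lemma integral_drift_torusPartial (hb : ∀ i, MemLp (fun x => b x i) 2 volume)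
    (hdiv : ∀ φ : UnitAddTorus (Fin d) → ℝ, TorusSmooth φ →
      ∫ x, ∑ i, b x i * torusPartial i φ x = 0)
    (hu : MemLp u 2 volume) (hG : ∀ i, MemLp (G i) 2 volume)
    (huG : ∀ i, IsWeakPartial i u (G i)) {ψ : UnitAddTorus (Fin d) → ℝ} (hψ : TorusSmooth ψ) :
    ∑ i, ∫ x, (b x i * torusPartial i ψ x) * u x = - ∑ i, ∫ x, (b x i * ψ x) * G i x := by
  have hbψ : ∀ i, ∀ φ : UnitAddTorus (Fin d) → ℝ, TorusSmooth φ →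
      MemLp (fun x => b x i * φ x) 2 volume := fun i φ hφ => (hφ.memLp ∞).mul (hb i)
  have hui : Integrable u := hu.integrable (by norm_num)
  have lim : Tendsto (fun n => (∑ i, ∫ x, (b x i * torusPartial i ψ x) *
      torusConv (torusMollifier n) u x) + ∑ i, ∫ x, (b x i * ψ x) *
      torusConv (torusMollifier n) (G i) x) atTop
      (𝓝 ((∑ i, ∫ x, (b x i * torusPartial i ψ x) * u x) + ∑ i, ∫ x, (b x i * ψ x) * G i x)) :=
    (tendsto_finsetSum _ fun i _ =>
      tendsto_integral_mul_torusConv hu (hbψ i _ (hψ.torusPartial i))).add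
    (tendsto_finsetSum _ fun i _ => tendsto_integral_mul_torusConv (hG i) (hbψ i _ hψ))
  -- The divergence condition is tested with the smooth function `(K_n * u) ψ`; the product rule and
  -- `∂_i (K_n * u) = K_n * G_i` give the two sums.
  have zero : ∀ n, (∑ i, ∫ x, (b x i * torusPartial i ψ x) *
      torusConv (torusMollifier n) u x) + ∑ i, ∫ x, (b x i * ψ x) *
      torusConv (torusMollifier n) (G i) x = 0 := by
    intro n
    have hK := isTorusKernel_torusMollifier (d := d) n
    have hv := (hK.torusSmooth_torusConv hui).1
    have hGi : ∀ i, TorusSmooth (torusConv (torusMollifier n) (G i)) := fun i =>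
      (hK.torusSmooth_torusConv ((hG i).integrable (by norm_num))).1
    rw [← Finset.sum_add_distrib, ← hdiv _ (hv.mul hψ), integral_finsetSum]
    · refine Finset.sum_congr rfl fun i _ => ?_
      rw [← integral_add (integrable_mul_of_memLp_two (hbψ i _ (hψ.torusPartial i)) hv)
        (integrable_mul_of_memLp_two (hbψ i _ hψ) (hGi i))]
      refine integral_congr_ae (ae_of_all _ fun x => ?_)
      simp only
      rw [torusPartial_mul hv hψ, hK.torusPartial_torusConv hui (huG i)]
      ring
    · intro i _
      exact integrable_mul_of_memLp_two (hb i) ((hv.mul hψ).torusPartial i)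
  simp_rw [zero] at lim
  linarith [tendsto_nhds_unique lim tendsto_const_nhds]

/-- `v^(2m+1) ∇v` is a multiple of the gradient of `v^(2m+2)`. -/
lemma integral_pow_mul_drift_eq_zero (hdiv : ∀ φ : UnitAddTorus (Fin d) → ℝ, TorusSmooth φ →
      ∫ x, ∑ i, b x i * torusPartial i φ x = 0) {v : UnitAddTorus (Fin d) → ℝ}
    (hv : TorusSmooth v) (m : ℕ) :
    ∫ x, v x ^ (2 * m + 1) * ∑ i, b x i * torusPartial i v x = 0 := by
  have h := hdiv _ (hv.pow (2 * m + 2))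
  have e : ∀ x, ∑ i, b x i * torusPartial i (fun x => v x ^ (2 * m + 2)) x =
      ((2 * m + 2 : ℕ) : ℝ) * (v x ^ (2 * m + 1) * ∑ i, b x i * torusPartial i v x) := fun x => by
    simp_rw [torusPartial_pow hv, Finset.mul_sum]
    refine Finset.sum_congr rfl fun i _ => ?_
    rw [show 2 * m + 2 - 1 = 2 * m + 1 from rfl]
    ring
  simp_rw [e, integral_const_mul] at h
  exact (mul_eq_zero.1 h).resolve_left (by positivity)

/-- The energy production of a mollified solution is controlled by commutators. -/
lemma ofReal_energyFlux_le (hK : IsTorusKernel K) (hν : 0 ≤ ν)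
    (hb : ∀ i, MemLp (fun x => b x i) 2 volume)
    (hdiv : ∀ φ : UnitAddTorus (Fin d) → ℝ, TorusSmooth φ →
      ∫ x, ∑ i, b x i * torusPartial i φ x = 0)
    (hu : MemLp u ∞ volume) (huM : ∀ᵐ x, |u x| ≤ M) (hG : ∀ i, MemLp (G i) 2 volume)
    (huG : ∀ i, IsWeakPartial i u (G i)) (m : ℕ) :
    ENNReal.ofReal (∫ x, torusConv K u x ^ (2 * m + 1) *
      (∫ y, u y * (∑ i, b y i * torusPartial i (fun y => K (y - x)) y +
        ν * torusLaplacian (fun y => K (y - x)) y))) ≤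
    ENNReal.ofReal (M ^ (2 * m + 1)) * ∑ i, mollifyCommutator K (fun x => b x i) (G i) := by
  have hu2 : MemLp u 2 volume := hu.mono_exponent le_top
  have hui : Integrable u := hu2.integrable (by norm_num)
  set v := torusConv K u with hvdef
  have hv : TorusSmooth v := (hK.torusSmooth_torusConv hui).1
  have hbG : ∀ i, Integrable fun x => b x i * G i x := fun i =>
    memLp_one_iff_integrable.1 ((hG i).mul (hb i))
  have hGi : ∀ i, Integrable (G i) := fun i => (hG i).integrable (by norm_num)
  set D : Fin d → UnitAddTorus (Fin d) → ℝ := fun i x =>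
    b x i * torusConv K (G i) x - torusConv K (fun y => b y i * G i y) x with hD
  -- The equation satisfied by `v = K * u`: `∂_s v = ∑ D_i - b · ∇v + νΔv`. The derivative is moved
  -- from the kernel onto `u`, so the commutator `D_i = b_i (K * G_i) - K * (b_i G_i)` contains no
  -- derivative of `b` or of `K`.
  have inner : ∀ x, ∫ y, u y * (∑ i, b y i * torusPartial i (fun y => K (y - x)) y +
        ν * torusLaplacian (fun y => K (y - x)) y) =
      (∑ i, D i x - ∑ i, b x i * torusPartial i v x) + ν * torusLaplacian v x := by
    intro x
    have hψ := hK.smooth_sub x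
    have i1 : ∀ i, Integrable fun y => (b y i * torusPartial i (fun y => K (y - x)) y) * u y :=
      fun i => memLp_one_iff_integrable.1
        (hu2.mul (p := 2) (q := 2) (((hψ.torusPartial i).memLp ∞).mul (hb i)))
    have i2 : Integrable fun y => ν * (u y * torusLaplacian (fun y => K (y - x)) y) :=
      (hui.mul_torusSmooth hψ.torusLaplacian).const_mul ν
    have e : ∀ y, u y * (∑ i, b y i * torusPartial i (fun y => K (y - x)) y +
        ν * torusLaplacian (fun y => K (y - x)) y) =
        ∑ i, (b y i * torusPartial i (fun y => K (y - x)) y) * u y +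
          ν * (u y * torusLaplacian (fun y => K (y - x)) y) := fun y => by
      rw [← Finset.sum_mul]; ring
    simp_rw [e]
    rw [integral_add (integrable_finsetSum _ fun i _ => i1 i) i2,
      integral_finsetSum _ fun i _ => i1 i, integral_const_mul,
      integral_drift_torusPartial hb hdiv hu2 hG huG hψ, ← (hK.torusSmooth_torusConv hui).2.2 x,
      ← Finset.sum_sub_distrib, ← Finset.sum_neg_distrib]
    congr 1
    refine Finset.sum_congr rfl fun i _ => ?_
    rw [hK.torusPartial_torusConv hui (huG i), hD]
    simp only [sub_sub_cancel_left, torusConv]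
    congr 1
    refine integral_congr_ae (ae_of_all _ fun y => ?_)
    simp only; ring
  have hDi : ∀ i, Integrable (D i) := fun i =>
    ((hb i).integrable (by norm_num)).mul_torusSmooth (hK.torusSmooth_torusConv (hGi i)).1 |>.sub
      (hK.torusSmooth_torusConv (hbG i)).1.integrable
  have j1 : Integrable fun x => v x ^ (2 * m + 1) * ∑ i, D i x := by
    simp_rw [mul_comm (v _ ^ _)]
    exact (integrable_finsetSum _ fun i _ => hDi i).mul_torusSmooth (hv.pow _)
  have j2 : Integrable fun x => v x ^ (2 * m + 1) * ∑ i, b x i * torusPartial i v x := by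
    simp_rw [mul_comm (v _ ^ _)]
    exact (integrable_finsetSum _ fun i _ => integrable_mul_of_memLp_two (hb i)
      (hv.torusPartial i)).mul_torusSmooth (hv.pow _)
  have j3 : Integrable fun x => ν * (v x ^ (2 * m + 1) * torusLaplacian v x) :=
    (((hv.pow _).mul hv.torusLaplacian).integrable).const_mul ν
  have total : ∫ x, v x ^ (2 * m + 1) *
      (∫ y, u y * (∑ i, b y i * torusPartial i (fun y => K (y - x)) y +
        ν * torusLaplacian (fun y => K (y - x)) y)) ≤ ∫ x, v x ^ (2 * m + 1) * ∑ i, D i x := by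
    simp_rw [inner, mul_add, mul_sub, mul_left_comm _ ν]
    have j12 : Integrable fun x => v x ^ (2 * m + 1) * ∑ i, D i x -
        v x ^ (2 * m + 1) * ∑ i, b x i * torusPartial i v x := j1.sub j2
    rw [integral_add j12 j3, integral_sub j1 j2, integral_pow_mul_drift_eq_zero hdiv hv,
      integral_const_mul, sub_zero]
    have := mul_nonpos_of_nonneg_of_nonpos hν (integral_pow_mul_torusLaplacian_nonpos hv m)
    linarith
  refine (ENNReal.ofReal_le_ofReal (total.trans (le_abs_self _))).trans ?_
  rw [← Real.norm_eq_abs, ofReal_norm]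
  refine (enorm_integral_le_lintegral_enorm _).trans ?_
  unfold mollifyCommutator
  have hmeas : ∀ i ∈ Finset.univ, AEMeasurable (fun x => ∫⁻ y, ENNReal.ofReal (K (y - x)) *
      (‖b x i - b y i‖ₑ * ‖G i y‖ₑ)) volume := fun i _ =>
    (aemeasurable_mollifyCommutator hK (hb i).1 (hG i).1).lintegral_prod_right'
  rw [← lintegral_finsetSum' _ hmeas, ← lintegral_const_mul' _ _ ENNReal.ofReal_ne_top]
  refine lintegral_mono fun x => ?_
  rw [enorm_mul]
  have hM : |v x| ≤ M := hK.abs_torusConv_le huM x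
  gcongr
  · rw [enorm_pow, Real.enorm_eq_ofReal_abs, ← ENNReal.ofReal_pow (abs_nonneg _)]
    exact ENNReal.ofReal_le_ofReal (pow_le_pow_left₀ (abs_nonneg _) hM _)
  · refine (enorm_sum_le _ _).trans (Finset.sum_le_sum fun i _ => ?_)
    have e : D i x = ∫ y, (b x i - b y i) * G i y * K (y - x) := by
      simp only [hD, torusConv]
      rw [← integral_const_mul, ← integral_sub
        (((hGi i).mul_torusSmooth (hK.smooth_sub x)).const_mul _)
        ((hbG i).mul_torusSmooth (hK.smooth_sub x))]
      refine integral_congr_ae (ae_of_all _ fun y => ?_)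
      simp only; ring
    rw [e]
    refine (enorm_integral_le_lintegral_enorm _).trans (le_of_eq (lintegral_congr fun y => ?_))
    rw [enorm_mul, enorm_mul, Real.enorm_of_nonneg (hK.nonneg _)]
    ring

end
end

noncomputable section

/-! ### The maximum principle -/

/-- Integrability is not required: otherwise the left side has the default value `0`. -/
lemma integral_le_toReal_lintegral_ofReal {α : Type*} [MeasurableSpace α] {μ : Measure α}
    (f : α → ℝ) : ∫ x, f x ∂μ ≤ (∫⁻ x, ENNReal.ofReal (f x) ∂μ).toReal := by
  by_cases hf : Integrable f μ
  · rw [integral_eq_lintegral_pos_part_sub_lintegral_neg_part hf]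
    linarith [ENNReal.toReal_nonneg (a := ∫⁻ x, ENNReal.ofReal (-f x) ∂μ)]
  · rw [integral_undef hf]
    exact ENNReal.toReal_nonneg

/-- The convex function `y ↦ y^(2m+2)` lies above its tangent at `x`; Bernoulli's inequality for `|y
/ x|` proves it. It makes weak convergence of the mollified solutions sufficient to pass an upper
bound on their `L^(2m+2)` norm to the limit. -/
lemma pow_add_mul_sub_le_pow (x y : ℝ) (m : ℕ) :
    x ^ (2 * m + 2) + (2 * m + 2 : ℕ) * (x ^ (2 * m + 1) * y - x ^ (2 * m + 2)) ≤
      y ^ (2 * m + 2) := by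
  rcases eq_or_ne x 0 with rfl | hx
  · have : 0 ≤ y ^ (2 * m + 2) := (Even.pow_nonneg ⟨m + 1, by ring⟩ y)
    simpa using this
  · have hxm : 0 < x ^ (2 * m + 2) := Even.pow_pos ⟨m + 1, by ring⟩ hx
    have hb := one_add_mul_le_pow (a := |y / x| - 1)
      (by linarith [abs_nonneg (y / x)]) (2 * m + 2)
    rw [add_sub_cancel, Even.pow_abs ⟨m + 1, by ring⟩, div_pow, le_div_iff₀ hxm] at hb
    have h1 : y / x ≤ |y / x| := le_abs_self _
    have h2 : x ^ (2 * m + 1) * y = y / x * x ^ (2 * m + 2) := by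
      rw [show 2 * m + 2 = 2 * m + 1 + 1 from rfl, pow_succ x (2 * m + 1)]
      field_simp
    rw [h2]
    refine le_trans ?_ hb
    have h3 : (0 : ℝ) ≤ ((2 * m + 2 : ℕ) : ℝ) * x ^ (2 * m + 2) := by positivity
    nlinarith [mul_le_mul_of_nonneg_left h1 h3]

/-- Chebyshev gives `μ {|f| ≥ M + δ} ≤ (M/(M+δ))^(2m+2)`, which tends to `0` as `m → ∞`. -/
lemma ae_abs_le_of_integral_pow_le {α : Type*} [MeasurableSpace α] {μ : Measure α}
    [IsFiniteMeasure μ] {f : α → ℝ} {M : ℝ} (hM : 0 ≤ M)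
    (hint : ∀ m : ℕ, Integrable (fun x => f x ^ (2 * m + 2)) μ)
    (h : ∀ m : ℕ, ∫ x, f x ^ (2 * m + 2) ∂μ ≤ M ^ (2 * m + 2)) : ∀ᵐ x ∂μ, |f x| ≤ M := by
  have key : ∀ δ : ℝ, 0 < δ → μ {x | M + δ ≤ |f x|} = 0 := by
    intro δ hδ
    have hMδ : 0 < M + δ := by linarith
    have hle : ∀ m : ℕ, μ.real {x | M + δ ≤ |f x|} ≤ (M / (M + δ)) ^ (2 * m + 2) := by
      intro m
      have h1 := mul_meas_ge_le_integral_of_nonneg (μ := μ)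
        (ae_of_all _ fun x => Even.pow_nonneg ⟨m + 1, by ring⟩ (f x)) (hint m)
        ((M + δ) ^ (2 * m + 2))
      rw [div_pow, le_div_iff₀ (by positivity), mul_comm]
      refine le_trans (mul_le_mul_of_nonneg_left (measureReal_mono fun x hx => ?_)
        (by positivity)) (h1.trans (h m))
      have hx' : M + δ ≤ |f x| := hx
      change (M + δ) ^ (2 * m + 2) ≤ f x ^ (2 * m + 2)
      rw [← Even.pow_abs ⟨m + 1, by ring⟩ (f x)]
      exact pow_le_pow_left₀ hMδ.le hx' _
    have hlim : Tendsto (fun m : ℕ => (M / (M + δ)) ^ (2 * m + 2)) atTop (𝓝 0) := by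
      have h1 := tendsto_pow_atTop_nhds_zero_of_lt_one (r := M / (M + δ)) (by positivity)
        ((div_lt_one hMδ).2 (by linarith))
      refine h1.comp (tendsto_atTop_mono (fun m => ?_) tendsto_id)
      simp only [id]; omega
    have := ge_of_tendsto' hlim hle
    exact (measureReal_eq_zero_iff).1 (le_antisymm this measureReal_nonneg)
  have hk : ∀ᵐ x ∂μ, ∀ k : ℕ, |f x| < M + 1 / ((k : ℝ) + 1) := by
    rw [ae_all_iff]
    intro k
    rw [ae_iff]
    simp only [not_lt]
    exact key _ (by positivity)
  filter_upwards [hk] with x hx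
  have h1 : Tendsto (fun k : ℕ => M + 1 / ((k : ℝ) + 1)) atTop (𝓝 (M + 0)) :=
    tendsto_one_div_add_atTop_nhds_zero_nat.const_add M
  rw [add_zero] at h1
  exact ge_of_tendsto' h1 fun k => (hx k).le

section

variable {d : ℕ} {T : EReal} {ν : ℝ} {b : ℝ → UnitAddTorus (Fin d) → EuclideanSpace ℝ (Fin d)}
  {u : ℝ → UnitAddTorus (Fin d) → ℝ} {u₀ : UnitAddTorus (Fin d) → ℝ} {M B M₀ : ℝ}
  {K : UnitAddTorus (Fin d) → ℝ}

/-- The coefficients are quantified inside the almost-everywhere statement, so that at a good time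
they may be taken as `B_j(x)` for all `x` simultaneously. -/
lemma IsBoundedPair.weakFlux_sum {I : Set ℝ} (hbu : IsBoundedPair I b u M B) {ι : Type*}
    [Fintype ι] {A : ι → UnitAddTorus (Fin d) → ℝ} (hA : ∀ j, TorusSmooth (A j)) :
    ∀ᵐ s ∂(volume.restrict I), ∀ c : ι → ℝ,
      weakFlux ν b u (fun y => ∑ j, A j y * c j) s = ∑ j, weakFlux ν b u (A j) s * c j := by
  filter_upwards [ae_all_iff.2 fun j => hbu.ae_integrable_flux (ν := ν) (hA j)] with s hs c
  have e1 : ∀ i, torusPartial i (fun y => ∑ j, A j y * c j) =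
      fun y => ∑ j, c j * torusPartial i (A j) y := by
    intro i
    ext y
    simp_rw [mul_comm (A _ _)]
    rw [torusPartial_sum (fun j _ => (hA j).const_mul _)]
    simp_rw [torusPartial_const_mul (hA _)]
  have e2 : ∀ y, torusLaplacian (fun y => ∑ j, A j y * c j) y =
      ∑ j, c j * torusLaplacian (A j) y := by
    intro y
    unfold torusLaplacian
    simp_rw [e1, Finset.mul_sum]
    rw [Finset.sum_comm]
    refine Finset.sum_congr rfl fun i _ => ?_
    rw [torusPartial_sum (fun j _ => ((hA j).torusPartial i).const_mul _)]
    simp_rw [torusPartial_const_mul ((hA _).torusPartial i)]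
  unfold weakFlux
  simp_rw [← integral_mul_const]
  rw [← integral_finsetSum _ fun j _ => (hs j).mul_const _]
  refine integral_congr_ae (ae_of_all _ fun y => ?_)
  simp only [e1, e2]
  simp_rw [Finset.mul_sum]
  rw [Finset.sum_comm, ← Finset.sum_add_distrib, Finset.mul_sum]
  refine Finset.sum_congr rfl fun j _ => ?_
  rw [mul_assoc (u s y), mul_comm _ (c j), mul_add (c j), Finset.mul_sum]
  congr 2
  · exact Finset.sum_congr rfl fun i _ => by ring
  · ring

/-- The rate of change of the `L^{2m+2}` energy of the mollified solution. -/
def energyFlux (ν : ℝ) (b : ℝ → UnitAddTorus (Fin d) → EuclideanSpace ℝ (Fin d))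
    (u : ℝ → UnitAddTorus (Fin d) → ℝ) (K : UnitAddTorus (Fin d) → ℝ) (m : ℕ) (s : ℝ) : ℝ :=
  ∫ x, torusConv K (u s) x ^ (2 * m + 1) * weakFlux ν b u (fun y => K (y - x)) s

/-- At fixed `x` the mollified solution is a primitive in time of the flux against `K(· - x)`. The
chain rule for its power holds pointwise in `x`, and Fubini integrates it over the torus.
Separability provides the joint measurability and boundedness. -/
lemma IsViscousSolution.energy_identity (h : IsViscousSolution T ν b u₀ u)
    (hbu : IsBoundedPair (timeInterval T) b u M B) (hK : IsTorusKernel K) (m : ℕ) {t : ℝ}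
    (ht : 0 ≤ t) (htT : (t : EReal) < T) :
    IntegrableOn (energyFlux ν b u K m) (Set.Ioc 0 t) ∧
    ∫ x, torusConv K (u t) x ^ (2 * m + 2) = (∫ x, torusConv K (u 0) x ^ (2 * m + 2)) +
      (2 * m + 2 : ℕ) * ∫ s in Set.Ioc 0 t, energyFlux ν b u K m s := by
  obtain ⟨ι, hι, A, B', hA, hB', hsep⟩ := hK.separable
  have hKx : ∀ x, (fun y => K (y - x)) = fun y => ∑ j, A j y * B' j x := fun x => by
    ext y; rw [hsep]
  have hsub := timeInterval_eq_Icc_subset htT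
  have hui : ∀ s ∈ Set.Icc 0 t, Integrable (u s) := fun s hs =>
    (h.memLp_two s (hsub hs)).integrable (by norm_num)
  set c : ι → ℝ → ℝ := fun j s => ∫ y, u s y * A j y with hc
  set R : ι → ℝ → ℝ := fun j s => weakFlux ν b u (A j) s with hR
  have hconv : ∀ s ∈ Set.Icc 0 t, ∀ x, torusConv K (u s) x = ∑ j, c j s * B' j x := by
    intro s hs x
    simp only [hc, ← integral_mul_const]
    rw [← integral_finsetSum _ fun j _ => ((hui s hs).mul_torusSmooth (hA j)).mul_const _]
    unfold torusConv
    simp_rw [hsep, Finset.mul_sum, mul_assoc]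
  have hle : (volume.restrict (Set.Ioc 0 t) : Measure ℝ) ≤ volume.restrict (Set.Icc 0 t) :=
    Measure.restrict_mono Set.Ioc_subset_Icc_self le_rfl
  have hcc : ∀ j, ContinuousOn (c j) (Set.Icc 0 t) := fun j =>
    (h.continuousOn_integral_mul (hA j)).mono hsub
  have hRi : ∀ j, IntegrableOn (R j) (Set.Ioc 0 t) := fun j =>
    (hbu.integrableOn_flux (hA j) htT).mono_set Set.Ioc_subset_Icc_self
  have hflux := ae_restrict_Ioc_of_timeInterval htT (hbu.weakFlux_sum (ν := ν) hA)
  set H : UnitAddTorus (Fin d) → ℝ → ℝ := fun x s =>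
    (∑ j, c j s * B' j x) ^ (2 * m + 1) * ∑ j, R j s * B' j x with hH
  -- Joint integrability
  have hHint : Integrable (Function.uncurry H)
      ((volume : Measure (UnitAddTorus (Fin d))).prod (volume.restrict (Set.Ioc 0 t))) := by
    have hcm : ∀ j, AEStronglyMeasurable (c j) (volume.restrict (Set.Ioc 0 t)) := fun j =>
      ((hcc j).mono Set.Ioc_subset_Icc_self).aestronglyMeasurable measurableSet_Ioc
    choose Cc hCc using fun j => isCompact_Icc.exists_bound_of_continuousOn (hcc j)
    choose CR hCR using fun j => hbu.exists_flux_bound (ν := ν) (hA j)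
    choose CB hCB0 hCB using fun j => (hB' j).exists_bound
    have meas : AEStronglyMeasurable (Function.uncurry H)
        ((volume : Measure (UnitAddTorus (Fin d))).prod (volume.restrict (Set.Ioc 0 t))) := by
      refine AEStronglyMeasurable.mul (AEStronglyMeasurable.pow ?_ _) ?_
      · exact Finset.aestronglyMeasurable_fun_sum _ fun j _ =>
          (hcm j).comp_snd.mul (hB' j).aestronglyMeasurable.comp_fst
      · exact Finset.aestronglyMeasurable_fun_sum _ fun j _ =>
          (hRi j).aestronglyMeasurable.comp_snd.mul (hB' j).aestronglyMeasurable.comp_fst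
    refine Integrable.of_bound meas ((∑ j, Cc j * CB j) ^ (2 * m + 1) * ∑ j, CR j * CB j) ?_
    have hae : ∀ᵐ s ∂(volume.restrict (Set.Ioc 0 t)), (∀ j, ‖c j s‖ ≤ Cc j) ∧
        ∀ j, ‖R j s‖ ≤ CR j := by
      filter_upwards [ae_restrict_mem measurableSet_Ioc,
        ae_restrict_Ioc_of_timeInterval htT (ae_all_iff.2 hCR)] with s hs hs'
      exact ⟨fun j => hCc j s (Set.Ioc_subset_Icc_self hs), hs'⟩
    filter_upwards [Measure.quasiMeasurePreserving_snd.ae hae] with p hp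
    have n1 : ∀ j, (0 : ℝ) ≤ Cc j := fun j => (norm_nonneg _).trans (hp.1 j)
    have n2 : ∀ j, (0 : ℝ) ≤ CR j := fun j => (norm_nonneg _).trans (hp.2 j)
    simp only [Function.uncurry, hH, norm_mul, norm_pow]
    refine mul_le_mul (pow_le_pow_left₀ (norm_nonneg _) ((norm_sum_le _ _).trans
      (Finset.sum_le_sum fun j _ => ?_)) _) ((norm_sum_le _ _).trans
      (Finset.sum_le_sum fun j _ => ?_)) (norm_nonneg _) (pow_nonneg
      (Finset.sum_nonneg fun j _ => mul_nonneg (n1 j) (hCB0 j)) _)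
    · rw [norm_mul]
      exact mul_le_mul (hp.1 j) (hCB j _) (norm_nonneg _) (n1 j)
    · rw [norm_mul]
      exact mul_le_mul (hp.2 j) (hCB j _) (norm_nonneg _) (n2 j)
  have hEF : energyFlux ν b u K m =ᵐ[volume.restrict (Set.Ioc 0 t)] fun s => ∫ x, H x s := by
    filter_upwards [ae_restrict_mem measurableSet_Ioc, hflux] with s hs hfs
    refine integral_congr_ae (ae_of_all _ fun x => ?_)
    simp only [hH]
    rw [hconv s (Set.Ioc_subset_Icc_self hs), hKx, hfs fun j => B' j x]
  have hpt : ∀ x, torusConv K (u t) x ^ (2 * m + 2) - torusConv K (u 0) x ^ (2 * m + 2) =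
      ∫ s in Set.Ioc 0 t, (2 * m + 2 : ℕ) * H x s := by
    intro x
    have hψ := hK.smooth_sub x
    have hanti : ∀ s ∈ Set.Icc 0 t, (∫ y, u s y * K (y - x)) - (∫ y, u 0 y * K (y - x)) =
        ∫ τ in 0..s, weakFlux ν b u (fun y => K (y - x)) τ := by
      intro s hs
      have := h.weighted_identity hbu (E := fun _ => 1) contDiff_const hψ hs.1
        (lt_of_le_of_lt (EReal.coe_le_coe_iff.2 hs.2) htT)
      simpa using this
    have hpow := pow_sub_pow_eq_integral ht (hbu.integrableOn_flux (ν := ν) hψ htT) hanti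
      (2 * m + 2)
    rw [intervalIntegral.integral_of_le ht] at hpow
    refine hpow.trans (integral_congr_ae ?_)
    filter_upwards [ae_restrict_mem measurableSet_Ioc, hflux] with s hs hfs
    have e := hconv s (Set.Ioc_subset_Icc_self hs) x
    rw [torusConv] at e
    simp only [hH]
    rw [e, show 2 * m + 2 - 1 = 2 * m + 1 from rfl, hKx, hfs fun j => B' j x, mul_assoc]
  have hsm : ∀ s ∈ Set.Icc 0 t, TorusSmooth (torusConv K (u s)) := fun s hs =>
    (hK.torusSmooth_torusConv (hui s hs)).1
  refine ⟨(hHint.integral_prod_right).congr hEF.symm, ?_⟩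
  have hfub := integral_integral_swap hHint
  rw [integral_congr_ae hEF, ← hfub, ← sub_eq_iff_eq_add',
    ← integral_sub ((hsm t ⟨ht, le_rfl⟩).pow _).integrable ((hsm 0 ⟨le_rfl, ht⟩).pow _).integrable,
    ← integral_const_mul]
  refine integral_congr_ae (ae_of_all _ fun x => ?_)
  simp only
  rw [hpt x, integral_const_mul]

/-- Only the positive part is controlled, dissipation having been discarded. At almost every time
the commutators vanish in the limit, and they are dominated by a multiple of `B ∑ ‖G_i s‖₂`, which
is integrable because `u` lies in `L¹ W^{1,2}`. -/
lemma IsViscousSolution.tendsto_lintegral_energyFlux (h : IsViscousSolution T ν b u₀ u)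
    (hbu : IsBoundedPair (timeInterval T) b u M B) (hdiv : IsDivFree (timeInterval T) b)
    (hν : 0 ≤ ν) (m : ℕ) {t : ℝ} (ht : 0 ≤ t) (htT : (t : EReal) < T) :
    Tendsto (fun n => ∫⁻ s in Set.Ioc 0 t,
      ENNReal.ofReal (energyFlux ν b u (torusMollifier n) m s)) atTop (𝓝 0) := by
  obtain ⟨G, -, hGm, hGw, hGfin⟩ := h.sobolev
  rw [eLpNorm_one_eq_lintegral_enorm] at hGfin
  have hGmeas : ∀ i, AEMeasurable (fun s => eLpNorm (G i s) 2 volume)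
      (volume.restrict (timeInterval T)) := by
    intro i
    simp_rw [eLpNorm_eq_lintegral_rpow_enorm_toReal (p := 2) (by norm_num) (by norm_num)]
    refine AEMeasurable.pow_const ?_ _
    exact ((hGm i).enorm.pow_const _).lintegral_prod_right'
  have hGfin' : ∀ i, ∫⁻ s in timeInterval T, eLpNorm (G i s) 2 volume < ∞ := fun i => by
    refine lt_of_le_of_lt (lintegral_mono fun s => ?_) hGfin
    exact (Finset.single_le_sum (f := fun i => eLpNorm (G i s) 2 volume)
      (fun _ _ => zero_le) (Finset.mem_univ i)).trans le_add_self
  have hG2 : ∀ᵐ s ∂(volume.restrict (timeInterval T)), ∀ i, MemLp (G i s) 2 volume := by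
    rw [ae_all_iff]
    intro i
    filter_upwards [ae_lt_top' (hGmeas i) (hGfin' i).ne, (hGm i).prodMk_left] with s h1 h2
    exact ⟨h2, h1⟩
  have hcomm : ∀ᵐ s ∂(volume.restrict (timeInterval T)), ∀ n,
      ENNReal.ofReal (energyFlux ν b u (torusMollifier n) m s) ≤ ENNReal.ofReal (M ^ (2 * m + 1)) *
        ∑ i, mollifyCommutator (torusMollifier n) (fun x => b s x i) (G i s) := by
    filter_upwards [hG2, hGw, hbu.ae_memLp, hbu.bdd_left, hbu.bdd_right, hdiv]
      with s h1 h2 h3 h4 h5 h6 n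
    exact ofReal_energyFlux_le (isTorusKernel_torusMollifier n) hν (fun i => (h5 i).1) h6 h3 h4
      h1 h2 m
  have hres := Measure.restrict_mono (Set.Ioc_subset_Icc_self.trans
    (timeInterval_eq_Icc_subset htT)) (le_refl (volume : Measure ℝ))
  have key := tendsto_lintegral_of_dominated_convergence'
    (μ := volume.restrict (Set.Ioc 0 t)) (f := fun _ => 0)
    (F := fun n s => ENNReal.ofReal (energyFlux ν b u (torusMollifier n) m s))
    (fun s => ENNReal.ofReal (M ^ (2 * m + 1)) *
      (2 * ENNReal.ofReal B * ∑ i, eLpNorm (G i s) 2 volume))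
    (fun n => (h.energy_identity hbu (isTorusKernel_torusMollifier n) m ht htT).1
      |>.aestronglyMeasurable.aemeasurable.ennreal_ofReal) (fun n => ?_) ?_ ?_
  · simpa using key
  · filter_upwards [ae_restrict_Ioc_of_timeInterval htT hcomm,
      ae_restrict_Ioc_of_timeInterval htT hG2,
      ae_restrict_Ioc_of_timeInterval htT hbu.bdd_right] with s h1 h2 h3
    refine (h1 n).trans ?_
    gcongr
    rw [Finset.mul_sum]
    refine Finset.sum_le_sum fun i _ => ?_
    have hK := isTorusKernel_torusMollifier (d := d) n
    refine (mollifyCommutator_le hK (h3 i).1 (h2 i)).trans ?_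
    gcongr
    exact (integral_mul_translationModulus_le hK (h3 i).1).trans (by gcongr; exact (h3 i).2)
  · rw [lintegral_const_mul' _ _ ENNReal.ofReal_ne_top, lintegral_const_mul' _ _
      (ENNReal.mul_ne_top (by norm_num) ENNReal.ofReal_ne_top),
      lintegral_finsetSum' _ fun i _ => (hGmeas i).mono_measure hres]
    refine ENNReal.mul_ne_top ENNReal.ofReal_ne_top (ENNReal.mul_ne_top
      (ENNReal.mul_ne_top (by norm_num) ENNReal.ofReal_ne_top) ?_)
    exact (ENNReal.sum_lt_top.2 fun i _ =>
      (lintegral_mono' hres le_rfl).trans_lt (hGfin' i)).ne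
  · filter_upwards [ae_restrict_Ioc_of_timeInterval htT hcomm,
      ae_restrict_Ioc_of_timeInterval htT hG2,
      ae_restrict_Ioc_of_timeInterval htT hbu.bdd_right] with s h1 h2 h3
    have lim : Tendsto (fun n => ENNReal.ofReal (M ^ (2 * m + 1)) *
        ∑ i, mollifyCommutator (torusMollifier n) (fun x => b s x i) (G i s)) atTop
        (𝓝 (ENNReal.ofReal (M ^ (2 * m + 1)) * ∑ _i : Fin d, 0)) :=
      ENNReal.Tendsto.const_mul (tendsto_finsetSum _ fun i _ =>
        tendsto_mollifyCommutator (h3 i).1 (h2 i)) (Or.inr ENNReal.ofReal_ne_top)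
    simp only [Finset.sum_const_zero, mul_zero] at lim
    exact tendsto_of_tendsto_of_tendsto_of_le_of_le tendsto_const_nhds lim (fun _ => zero_le) h1

/-- **Maximum principle** for bounded weak solutions. -/
lemma IsViscousSolution.ae_abs_le (h : IsViscousSolution T ν b u₀ u)
    (hbu : IsBoundedPair (timeInterval T) b u M B) (hdiv : IsDivFree (timeInterval T) b)
    (hν : 0 ≤ ν) (hM₀ : 0 ≤ M₀) (h0 : ∀ᵐ x, |u₀ x| ≤ M₀) :
    ∀ᵐ s ∂(volume.restrict (timeInterval T)), ∀ᵐ x, |u s x| ≤ M₀ := by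
  have hnull : ∀ᵐ s : ℝ ∂(volume.restrict (timeInterval T)), (s : EReal) ≠ T := by
    refine ae_restrict_of_ae ?_
    rw [ae_iff]
    refine Set.Subsingleton.measure_zero (fun x hx y hy => ?_) volume
    simp only [ne_eq, not_not, Set.mem_ofPred_eq] at hx hy
    exact EReal.coe_eq_coe_iff.1 (hx.trans hy.symm)
  filter_upwards [hnull, ae_restrict_mem (measurableSet_timeInterval T), hbu.ae_memLp,
    hbu.bdd_left] with t htne htI hut hutM
  have htT : (t : EReal) < T := lt_of_le_of_ne htI.2 htne
  have ht : 0 ≤ t := htI.1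
  have hut2 : MemLp (u t) 2 volume := h.memLp_two t htI
  have h0' : ∀ᵐ x, |u 0 x| ≤ M₀ := by
    filter_upwards [h.solves.1, h0] with x hx hx'
    rwa [hx]
  have hpow : ∀ n : ℕ, MemLp (fun x => u t x ^ n) ∞ volume := fun n =>
    memLp_top_of_bound (hut.1.pow n) (M ^ n) (by
      filter_upwards [hutM] with x hx
      rw [norm_pow]
      exact pow_le_pow_left₀ (norm_nonneg _) hx n)
  refine ae_abs_le_of_integral_pow_le hM₀ (fun m => (hpow _).integrable le_top) fun m => ?_
  set q : ℝ := ((2 * m + 2 : ℕ) : ℝ) with hq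
  have hp1 : MemLp (fun x => u t x ^ (2 * m + 1)) 2 volume := (hpow _).mono_exponent le_top
  have hp2 : Integrable fun x => u t x ^ (2 * m + 2) := (hpow _).integrable le_top
  set ε : ℕ → ℝ≥0∞ := fun n => ∫⁻ s in Set.Ioc 0 t,
    ENNReal.ofReal (energyFlux ν b u (torusMollifier n) m s)
  have hε : Tendsto (fun n => (ε n).toReal) atTop (𝓝 0) := by
    have := (ENNReal.tendsto_toReal ENNReal.zero_ne_top).comp
      (h.tendsto_lintegral_energyFlux hbu hdiv hν m ht htT)
    rwa [ENNReal.toReal_zero] at this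
  -- The tangent inequality between `u t` and its mollification, integrated in `x`, followed by the
  -- energy identity. As `n → ∞` the bracket multiplied by `q` and the flux error both vanish.
  have hstep : ∀ n, (∫ x, u t x ^ (2 * m + 2)) + q * ((∫ x, u t x ^ (2 * m + 1) *
      torusConv (torusMollifier n) (u t) x) - ∫ x, u t x ^ (2 * m + 2)) ≤
      M₀ ^ (2 * m + 2) + q * (ε n).toReal := by
    intro n
    have hK := isTorusKernel_torusMollifier (d := d) n
    have hv := (hK.torusSmooth_torusConv (hut2.integrable (by norm_num))).1
    have i1 := integrable_mul_of_memLp_two hp1 hv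
    have i2 : Integrable fun x => u t x ^ (2 * m + 1) * torusConv (torusMollifier n) (u t) x -
        u t x ^ (2 * m + 2) := i1.sub hp2
    calc _ = ∫ x, (u t x ^ (2 * m + 2) + q * (u t x ^ (2 * m + 1) *
          torusConv (torusMollifier n) (u t) x - u t x ^ (2 * m + 2))) := by
          rw [integral_add hp2 (i2.const_mul q), integral_const_mul,
            integral_sub i1 hp2]
      _ ≤ ∫ x, torusConv (torusMollifier n) (u t) x ^ (2 * m + 2) :=
          integral_mono (hp2.add (i2.const_mul q)) (hv.pow _).integrable
            fun x => pow_add_mul_sub_le_pow _ _ m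
      _ = _ := (h.energy_identity hbu hK m ht htT).2
      _ ≤ _ := by
          refine add_le_add ?_ (mul_le_mul_of_nonneg_left
            (integral_le_toReal_lintegral_ofReal _) (by positivity))
          have hb0 := hK.abs_torusConv_le h0'
          have h0I : (0 : ℝ) ∈ timeInterval T :=
            ⟨le_rfl, (EReal.coe_le_coe_iff.2 ht).trans htT.le⟩
          have hv0 := (hK.torusSmooth_torusConv
            ((h.memLp_two 0 h0I).integrable (by norm_num))).1
          calc ∫ x, torusConv (torusMollifier n) (u 0) x ^ (2 * m + 2)
              ≤ ∫ _ : UnitAddTorus (Fin d), M₀ ^ (2 * m + 2) := by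
                refine integral_mono (hv0.pow _).integrable (integrable_const _) fun x => ?_
                simp only
                rw [← Even.pow_abs ⟨m + 1, by ring⟩]
                exact pow_le_pow_left₀ (abs_nonneg _) (hb0 x) _
            _ = _ := by simp
  have lim1 := (((tendsto_integral_mul_torusConv hut2 hp1).sub
    (tendsto_const_nhds (x := ∫ x, u t x ^ (2 * m + 2)))).const_mul q).const_add
    (∫ x, u t x ^ (2 * m + 2))
  have lim2 := (hε.const_mul q).const_add (M₀ ^ (2 * m + 2))
  have := le_of_tendsto_of_tendsto' lim1 lim2 hstep
  simp_rw [← pow_succ] at this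
  simpa using this

end
end

noncomputable section

/-! ### The log-Sobolev seminorm -/

section

variable {d : ℕ} {v w : UnitAddTorus (Fin d) → ℝ} {h : EuclideanSpace ℝ (Fin d)}

/-- The integrand is nonnegative with antiderivative `(-log ρ)^(-δ) / δ`, which extends continuously
by `0` to `ρ = 0`. -/
lemma integrableOn_inv_mul_log_rpow {δ : ℝ} (hδ : 0 < δ) :
    IntegrableOn (fun ρ : ℝ => ρ⁻¹ * Real.log (1 / ρ) ^ (-1 - δ)) (Set.Ioc 0 (1 / 3)) := by
  have hlog : ∀ {x : ℝ}, 0 < x → x < 1 → 0 < -Real.log x := fun hx hx1 => by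
    linarith [Real.log_neg hx hx1]
  refine intervalIntegral.integrableOn_deriv_of_nonneg
    (g := fun ρ => (-Real.log ρ) ^ (-δ) / δ) (fun x hx => ?_) (fun x hx => ?_) fun x hx => ?_
  · rcases eq_or_lt_of_le hx.1 with rfl | hx0
    -- The default values `Real.log 0 = 0` and `0 ^ (-δ) = 0` agree with the limit at the origin.
    · refine ContinuousAt.continuousWithinAt (continuousAt_iff_punctured_nhds.2 ?_)
      have := ((tendsto_rpow_neg_atTop hδ).comp
        (tendsto_neg_atBot_atTop.comp Real.tendsto_log_nhdsNE_zero)).div_const δ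
      simpa [Real.zero_rpow (neg_ne_zero.2 hδ.ne'), Function.comp_def] using this
    · refine ContinuousAt.continuousWithinAt ?_
      have := hlog hx0 (by linarith [hx.2])
      exact (((Real.continuousAt_log hx0.ne').neg).rpow_const (Or.inl this.ne')).div_const _
  · have h1 := hlog hx.1 (by linarith [hx.2])
    have h2 := (((Real.hasDerivAt_log hx.1.ne').neg).rpow_const (p := -δ)
      (Or.inl h1.ne')).div_const δ
    refine h2.congr_deriv ?_
    rw [one_div, Real.log_inv, show -δ - 1 = -1 - δ by ring, Pi.neg_apply]
    field_simp
  · have h1 := hlog hx.1 (by linarith [hx.2])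
    have h0 := hx.1
    rw [one_div, Real.log_inv]
    positivity

/-- In polar coordinates the Jacobian `ρ^(d-1)` reduces `ρ^(-d)` to `ρ⁻¹`, and the logarithms
combine to the exponent `-r - (1 - r₁) = -1 - (r - r₁) < -1`. -/
lemma logSobolevSeminormSq_lt_top (hd : 2 ≤ d) (hv : MemLp v 2 volume) {C r r₁ : ℝ}
    (hr : r₁ < r) (hmod : ∀ h : EuclideanSpace ℝ (Fin d), 0 < ‖h‖ → ‖h‖ < 1 / 3 →
      ∫ x, (v (x + toTorus h) - v x) ^ 2 ≤ C * Real.log (1 / ‖h‖) ^ (-r)) :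
    logSobolevSeminormSq r₁ v < ∞ := by
  have : Nonempty (Fin d) := ⟨⟨0, by omega⟩⟩
  set f : ℝ → ℝ := fun ρ => C * ((ρ ^ d)⁻¹ * Real.log (1 / ρ) ^ (-1 - (r - r₁))) with hf
  have hint : IntegrableOn (fun h : EuclideanSpace ℝ (Fin d) => f ‖h‖)
      (Metric.ball 0 (1 / 3)) := by
    rw [integrableOn_fun_norm_addHaar]
    refine IntegrableOn.congr_fun (((integrableOn_inv_mul_log_rpow (sub_pos.2 hr)).mono_set
      Set.Ioo_subset_Ioc_self).const_mul C) (fun ρ hρ => ?_) measurableSet_Ioo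
    have h0 : ρ ≠ 0 := hρ.1.ne'
    have h1 : ρ ^ d = ρ ^ (d - 1) * ρ := by rw [← pow_succ]; congr 1; omega
    simp only [hf, finrank_euclideanSpace, Fintype.card_fin, smul_eq_mul, h1]
    field_simp
  refine lt_of_le_of_lt (setLIntegral_mono' measurableSet_ball fun h hh => ?_)
    hint.lintegral_lt_top
  have hh' : ‖h‖ < 1 / 3 := by simpa using hh
  have hsq : Integrable fun x => (v (x + toTorus h) - v x) ^ 2 :=
    ((hv.comp_measurePreserving (measurePreserving_add_right volume (toTorus h))).sub
      hv).integrable_sq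
  rcases eq_or_lt_of_le (norm_nonneg h) with h0 | h0
  · have : h = 0 := norm_eq_zero.1 h0.symm
    have h2 : toTorus (0 : EuclideanSpace ℝ (Fin d)) = 0 := by ext i; simp [toTorus]
    simp [this, h2]
  have hL : 0 < Real.log (1 / ‖h‖) := Real.log_pos (by
    rw [lt_div_iff₀ h0]; linarith)
  have hc : 0 ≤ (‖h‖ ^ d)⁻¹ * (1 / Real.log (1 / ‖h‖) ^ (1 - r₁)) := by positivity
  have he : ∀ x, |v (x + toTorus h) - v x| ^ 2 / ‖h‖ ^ d *
      (1 / Real.log (1 / ‖h‖) ^ (1 - r₁)) = (v (x + toTorus h) - v x) ^ 2 *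
      ((‖h‖ ^ d)⁻¹ * (1 / Real.log (1 / ‖h‖) ^ (1 - r₁))) := fun x => by
    rw [sq_abs, div_eq_mul_inv, mul_assoc]
  simp_rw [he]
  rw [← ofReal_integral_eq_lintegral_ofReal (hsq.mul_const _)
    (ae_of_all _ fun x => mul_nonneg (sq_nonneg _) hc), integral_mul_const]
  refine ENNReal.ofReal_le_ofReal ((mul_le_mul_of_nonneg_right (hmod h h0 hh') hc).trans_eq ?_)
  simp only [hf]
  rw [show -1 - (r - r₁) = -r - (1 - r₁) by ring, Real.rpow_sub hL (-r) (1 - r₁),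
    div_eq_mul_one_div (Real.log (1 / ‖h‖) ^ (-r))]
  ac_rfl

lemma integral_increment_sq_le (hv : MemLp v 2 volume) (z : UnitAddTorus (Fin d)) :
    ∫ x, (v (x + z) - v x) ^ 2 ≤ 4 * ∫ x, v x ^ 2 := by
  have tr := measurePreserving_add_right (volume : Measure (UnitAddTorus (Fin d))) z
  have hv' : MemLp (fun x => v (x + z)) 2 volume := hv.comp_measurePreserving tr
  have i1 := hv'.integrable_sq
  have i2 := hv.integrable_sq
  have e : ∫ x, v (x + z) ^ 2 = ∫ x, v x ^ 2 := integral_add_right_eq_self (fun x => v x ^ 2) z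
  calc ∫ x, (v (x + z) - v x) ^ 2 ≤ ∫ x, (2 * v (x + z) ^ 2 + 2 * v x ^ 2) :=
        integral_mono (hv'.sub hv).integrable_sq ((i1.const_mul 2).add (i2.const_mul 2))
          fun x => by simp only; nlinarith [sq_nonneg (v (x + z) + v x)]
    _ = 4 * ∫ x, v x ^ 2 := by
        rw [integral_add (i1.const_mul 2) (i2.const_mul 2), integral_const_mul,
          integral_const_mul, e]
        ring

lemma integral_increment_sq_le_of_approx (hv : MemLp v 2 volume) (hw : MemLp w 2 volume)
    (z : UnitAddTorus (Fin d)) :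
    ∫ x, (v (x + z) - v x) ^ 2 ≤
      8 * (∫ x, (w x - v x) ^ 2) + 2 * ∫ x, (w (x + z) - w x) ^ 2 := by
  have tr := measurePreserving_add_right (volume : Measure (UnitAddTorus (Fin d))) z
  have hg : MemLp (fun x => w x - v x) 2 volume := hw.sub hv
  have hgz : MemLp (fun x => (w (x + z) - v (x + z)) - (w x - v x)) 2 volume :=
    (hg.comp_measurePreserving tr).sub hg
  have hwz : MemLp (fun x => w (x + z) - w x) 2 volume := (hw.comp_measurePreserving tr).sub hw
  have hvz : MemLp (fun x => v (x + z) - v x) 2 volume := (hv.comp_measurePreserving tr).sub hv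
  have key := integral_increment_sq_le hg z
  have i1 := hgz.integrable_sq
  have i2 := hwz.integrable_sq
  calc ∫ x, (v (x + z) - v x) ^ 2
      ≤ ∫ x, (2 * ((w (x + z) - v (x + z)) - (w x - v x)) ^ 2 + 2 * (w (x + z) - w x) ^ 2) :=
        integral_mono hvz.integrable_sq ((i1.const_mul 2).add (i2.const_mul 2)) fun x => by
          simp only
          nlinarith [sq_nonneg ((w (x + z) - v (x + z)) - (w x - v x) + (w (x + z) - w x))]
    _ ≤ _ := by
        rw [integral_add (i1.const_mul 2) (i2.const_mul 2), integral_const_mul,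
          integral_const_mul]
        linarith

/-- A function that is approximated at a logarithmic rate by functions of controlled translation
modulus has a logarithmic translation modulus. -/
lemma exists_log_modulus {V : ℝ → UnitAddTorus (Fin d) → ℝ} {ν₀ C K r : ℝ}
    (hv : MemLp v 2 volume) (hV : ∀ ν, 0 < ν → MemLp (V ν) 2 volume)
    (hν₀ : 0 < ν₀) (hν₀' : ν₀ < 1) (hC : 0 ≤ C) (hK : 0 ≤ K) (hr : 0 < r)
    (hrate : ∀ ν : ℝ, 0 < ν → ν < ν₀ →
      ∫ x, (V ν x - v x) ^ 2 ≤ C * Real.log (1 / ν) ^ (-r))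
    (hreg : ∀ ν : ℝ, 0 < ν → ν ≤ 1 → ∀ h : EuclideanSpace ℝ (Fin d),
      ∫ x, (V ν (x + toTorus h) - V ν x) ^ 2 ≤ K * (‖h‖ / (ν * √ν))) :
    ∃ C', ∀ h : EuclideanSpace ℝ (Fin d), 0 < ‖h‖ → ‖h‖ < 1 / 3 →
      ∫ x, (v (x + toTorus h) - v x) ^ 2 ≤ C' * Real.log (1 / ‖h‖) ^ (-r) := by
  set A := ∫ x, v x ^ 2
  have hA : 0 ≤ A := integral_nonneg fun x => sq_nonneg _
  set L₀ := Real.log (1 / ν₀ ^ 3)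
  have hL₀ : 0 < L₀ := Real.log_pos (by
    rw [lt_div_iff₀ (by positivity), one_mul]
    exact pow_lt_one₀ hν₀.le hν₀' (by norm_num))
  refine ⟨8 * (C * 3 ^ r) + 2 * (K * (2 * r) ^ r) + 4 * A * L₀ ^ r, fun h h0 h3 => ?_⟩
  set ρ := ‖h‖
  set L := Real.log (1 / ρ) with hLdef
  have hL : 0 < L := Real.log_pos (by rw [lt_div_iff₀ h0]; linarith)
  have hLr : 0 < L ^ (-r) := Real.rpow_pos_of_pos hL _
  rcases lt_or_ge ρ (ν₀ ^ 3) with hs | hs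
  -- The balance: `ν^(3/2) = ρ^(1/2)` leaves a positive power of `ρ`, while `log(1/ν)` is still
  -- comparable to `log(1/ρ)`. The condition `ρ < ν₀³` is precisely `ν < ν₀`.
  · set ν := ρ ^ (1 / 3 : ℝ) with hν
    have hν0 : 0 < ν := Real.rpow_pos_of_pos h0 _
    have hν1 : ν < ν₀ := by
      have h2 := Real.rpow_lt_rpow h0.le hs (show (0 : ℝ) < 1 / 3 by norm_num)
      rwa [← Real.rpow_natCast, ← Real.rpow_mul hν₀.le, show ((3 : ℕ) : ℝ) * (1 / 3) = 1 by
        norm_num, Real.rpow_one] at h2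
    have e1 : Real.log (1 / ν) = L / 3 := by
      rw [hν, hLdef, one_div ρ, one_div (ρ ^ _), Real.log_inv, Real.log_inv, Real.log_rpow h0]
      ring
    have e2 : ρ / (ν * √ν) = ρ ^ (1 / 2 : ℝ) := by
      rw [Real.sqrt_eq_rpow, hν, ← Real.rpow_mul h0.le, ← Real.rpow_add h0]
      nth_rw 1 [← Real.rpow_one ρ]
      rw [← Real.rpow_sub h0]
      norm_num
    have e3 : (L / 3) ^ (-r) = 3 ^ r * L ^ (-r) := by
      rw [Real.div_rpow hL.le (by norm_num), Real.rpow_neg (by norm_num : (0 : ℝ) ≤ 3)]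
      field_simp
    -- This is `log x ≤ x^ε / ε` at `x = 1/ρ`, with `ε = 1/(2r)` chosen so that its `r`-th power
    -- produces exactly `ρ^(-1/2)`.
    have e4 : ρ ^ (1 / 2 : ℝ) ≤ (2 * r) ^ r * L ^ (-r) := by
      have h1 : L ≤ (1 / ρ) ^ (1 / (2 * r)) * (2 * r) := by
        have := Real.log_le_rpow_div (x := 1 / ρ) (by positivity)
          (show 0 < 1 / (2 * r) by positivity)
        rwa [div_div_eq_mul_div, div_one] at this
      have h2 := Real.rpow_le_rpow hL.le h1 hr.le
      rw [Real.mul_rpow (by positivity) (by positivity), ← Real.rpow_mul (by positivity),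
        show 1 / (2 * r) * r = 1 / 2 by field_simp, one_div ρ, Real.inv_rpow h0.le] at h2
      rw [Real.rpow_neg hL.le, ← div_eq_mul_inv, le_div_iff₀ (by positivity)]
      calc _ ≤ ρ ^ (1 / 2 : ℝ) * ((ρ ^ (1 / 2 : ℝ))⁻¹ * (2 * r) ^ r) := by gcongr
        _ = _ := by field_simp
    have h1 := hrate ν hν0 hν1
    have h2 := hreg ν hν0 (hν1.trans hν₀').le h
    rw [e1, e3] at h1
    rw [e2] at h2
    have h4 : K * ρ ^ (1 / 2 : ℝ) ≤ K * ((2 * r) ^ r * L ^ (-r)) :=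
      mul_le_mul_of_nonneg_left e4 hK
    have h5 := integral_increment_sq_le_of_approx hv (hV ν hν0) (toTorus h)
    have h6 : 0 ≤ 4 * A * L₀ ^ r * L ^ (-r) := by positivity
    linarith
  -- For `ρ` bounded away from `0` the trivial bound `4‖v‖²` suffices, since `L ≤ L₀` makes `L₀^r
  -- L^(-r)` at least `1`.
  · have h1 := integral_increment_sq_le hv (toTorus h)
    have h2 : L ≤ L₀ := Real.log_le_log (by positivity) (by gcongr)
    have h3 : 1 ≤ L₀ ^ r * L ^ (-r) := by
      rw [Real.rpow_neg hL.le, ← div_eq_mul_inv, le_div_iff₀ (by positivity), one_mul]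
      exact Real.rpow_le_rpow hL.le h2 hr.le
    have h4 : 4 * A * 1 ≤ 4 * A * (L₀ ^ r * L ^ (-r)) := by gcongr
    have h5 : 0 ≤ (8 * (C * 3 ^ r) + 2 * (K * (2 * r) ^ r)) * L ^ (-r) := by positivity
    linarith

end

end

/-! ### Conclusion -/

theorem mainTheorem9 (d : ℕ) (hd : 2 ≤ d) (T : EReal) (hT : 0 < T) (p : ℝ) (hp : 2 < p)
    (b : ℝ → UnitAddTorus (Fin d) → EuclideanSpace ℝ (Fin d))
    (hb : MemBochnerSobolevVec ∞ (ENNReal.ofReal p) (timeInterval T) b)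
    (hdiv : IsDivFree (timeInterval T) b)
    (u₀ : UnitAddTorus (Fin d) → ℝ) (hu₀ : MemSobolevOne 2 u₀) (hu₀' : MemLp u₀ ∞ volume)
    (uν : ℝ → ℝ → UnitAddTorus (Fin d) → ℝ)
    (huν : ∀ ν : ℝ, 0 < ν → IsViscousSolution T ν b u₀ (uν ν))
    (u0 : ℝ → UnitAddTorus (Fin d) → ℝ) (hu0 : IsTransportSolution T b u₀ u0)
    (t : ℝ) (ht : 0 < t) (htT : (t : EReal) < T)
    (ν₀ : ℝ) (hν₀ : 0 < ν₀) (hν₀' : ν₀ < 1) (C : ℝ) (hC : 0 < C) (r : ℝ) (hr : 0 < r)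
    (hrate : ∀ ν : ℝ, 0 < ν → ν < ν₀ →
      ∫ x, (uν ν t x - u0 t x) ^ 2 ≤ C * Real.log (1 / ν) ^ (-r)) :
    ∀ r₁ : ℝ, 0 < r₁ → r₁ < r → MemLogSobolev r₁ (u0 t) := by
  intro r₁ _ hr₁r
  have htI : t ∈ timeInterval T := ⟨ht.le, htT.le⟩
  have hv : MemLp (u0 t) 2 volume := (hu0.memLp_top t htI).mono_exponent le_top
  obtain ⟨B, hB0, hB⟩ := hb.exists_bound hp.le
  set M₀ := (eLpNorm u₀ ∞ volume).toReal
  have hM₀ : ∀ᵐ x, |u₀ x| ≤ M₀ := by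
    have h1 := enorm_ae_le_eLpNormEssSup u₀ volume
    rw [← eLpNorm_exponent_top] at h1
    filter_upwards [h1] with x hx
    have := ENNReal.toReal_mono hu₀'.2.ne hx
    rwa [toReal_enorm] at this
  -- The maximum principle replaces the `ν`-dependent sup bound by `M₀ = ‖u₀‖_∞`; the constant in
  -- the smoothing estimate thereby becomes independent of `ν`.
  have hpair : ∀ ν, 0 < ν → IsBoundedPair (timeInterval T) b (uν ν) M₀ B := fun ν hν => by
    obtain ⟨M, B', hbu⟩ := (huν ν hν).isBoundedPair hp.le hb
    exact ⟨ENNReal.toReal_nonneg, hB0, hbu.meas_left, hbu.meas_right,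
      (huν ν hν).ae_abs_le hbu hdiv hν.le ENNReal.toReal_nonneg hM₀, hB⟩
  obtain ⟨C', hC'⟩ := exists_log_modulus hv (fun ν hν => (huν ν hν).memLp_two t htI) hν₀ hν₀'
    hC.le (by positivity) hr hrate fun ν hν hν1 h =>
      (huν ν hν).integral_sq_increment_le (hpair ν hν) hM₀ hν hν1 ht htT h
  exact ⟨hv, logSobolevSeminormSq_lt_top hd hv hr₁r hC'⟩
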